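/- Let $\mathbb T^2=\mathbb R^2/\mathbb Z^2$ with Lebesgue measure and let $\xi$ be a real spatial white noise on $\mathbb T^2$, i.e. a random distribution such that $\xi(f)$ is a centred Gaussian variable of variance $\|f\|_{L^2}^2$ for every $f\in C^\infty(\mathbb T^2)$. Let $\Delta^{-1}:=-\int_0^1 e^{t\Delta}\,dt$ (an inverse of the Laplacian up to the smoothing operator $e^{\Delta}$) and $\nabla^\perp\varphi:=(-\partial_2\varphi,\partial_1\varphi)$. For a mollifier $\rho\in C_c^\infty(\mathbb R^2)$ with $\int\rho=1$ and $\varepsilon>0$, let $\rho_\varepsilon$ be the periodisation of $\varepsilon^{-2}\rho(\cdot/\varepsilon)$ and set $$\xi_\varepsilon:=\xi*\rho_\varepsilon,\qquad A_\varepsilon:=\nabla^\perp\Delta^{-1}\xi_\varepsilon,\qquad c_\varepsilon:=\mathbb E[A_\varepsilon(0)\cdot A_\varepsilon(0)].$$ For $s\in\mathbb R$ let $\mathcal C^{s}=B^{s}_{\infty,\infty}(\mathbb T^2)$ be the Besov–Hölder space with norm $\|u\|_{\mathcal C^s}=\sup_{j\ge-1}2^{js}\|\Delta_ju\|_{L^\infty}$,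 where $(\Delta_j)_{j\ge-1}$ are the Littlewood–Paley projectors of a fixed smooth dyadic partition of unity. **Theorem.** There exists a random distribution $A^2$ on $\mathbb T^2$, which depends neither on $\rho$ nor on the parameters $\alpha,p$ below, such that: 1. for every $\alpha<1$, $A^2\in\mathcal C^{2\alpha-2}$ almost surely; 2. for every mollifier $\rho$, the potentials $A_\varepsilon$ are smooth for all $\varepsilon>0$, and for every $\alpha<1$ and every $p\in[1,\infty)$, $$\lim_{\varepsilon\to0}\mathbb E\Big[\big\|A^2-(A_\varepsilon\cdot A_\varepsilon-c_\varepsilon)\big\|_{\mathcal C^{2\alpha-2}}^p\Big]=0;$$ 3. for every mollifier $\rho$, the constants $c_\varepsilon$ diverge logarithmically: $$c_\varepsilon\underset{\varepsilon\to0}{\sim}\frac1{2\pi}\ln\frac1\varepsilon .$$ -/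

import Mathlib

open MeasureTheory ProbabilityTheory Filter Topology
open scoped ENNReal

noncomputable section

/-! ### The torus, smooth functions and distributions -/

/-- The two-dimensional torus `𝕋² = ℝ² / ℤ²`. -/
abbrev Torus2 : Type := UnitAddTorus (Fin 2)

/-- Lebesgue (normalised Haar) measure on `𝕋²`. -/
def torusMeasure : Measure Torus2 :=
  Measure.pi fun _ => (AddCircle.haarAddCircle : Measure UnitAddCircle)

/-- The projection `ℝ² → 𝕋²`. -/
def toTorus (v : Fin 2 → ℝ) : Torus2 := fun i => (v i : UnitAddCircle)

/-- `f : 𝕋² → ℝ` is `C^∞`: its periodic lift to `ℝ²` is. -/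
def IsSmooth (f : Torus2 → ℝ) : Prop := ContDiff ℝ (⊤ : ℕ∞) fun v : Fin 2 → ℝ => f (toTorus v)

/-- The space `C^∞(𝕋²)` of real test functions. -/
def TestFunctions : Submodule ℝ (Torus2 → ℝ) where
  carrier := {f | IsSmooth f}
  add_mem' := fun {f g} (hf : IsSmooth f) (hg : IsSmooth g) => by
    unfold IsSmooth at hf hg
    exact hf.add hg
  zero_mem' := by
    change ContDiff ℝ (⊤ : ℕ∞) fun _ : Fin 2 → ℝ => (0 : ℝ)
    exact contDiff_const
  smul_mem' := fun c f (hf : IsSmooth f) => by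
    unfold IsSmooth at hf
    exact contDiff_const.smul hf

/-- The linear forms `u` on `C^∞(𝕋²)` that are continuous, i.e. `|u(f)| ≤ C ‖f‖_{C^N}` for some
`C` and `N`. -/
def continuousForms : Submodule ℝ (TestFunctions →ₗ[ℝ] ℝ) where
  carrier := {u | ∃ (C : ℝ) (N : ℕ), ∀ (f : TestFunctions) (M : ℝ),
    (∀ n ≤ N, ∀ v : Fin 2 → ℝ, ‖iteratedFDeriv ℝ n (fun w => f.1 (toTorus w)) v‖ ≤ M) →
      |u f| ≤ C * M}
  add_mem' := by
    rintro u v ⟨C, N, hu⟩ ⟨C', N', hv⟩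
    refine ⟨C + C', max N N', fun f M h => ?_⟩
    have h1 := hu f M fun n hn => h n (hn.trans (le_max_left _ _))
    have h2 := hv f M fun n hn => h n (hn.trans (le_max_right _ _))
    rw [LinearMap.add_apply, add_mul]
    exact (abs_add_le _ _).trans (add_le_add h1 h2)
  zero_mem' := ⟨0, 0, fun f M _ => by simp⟩
  smul_mem' := by
    rintro c u ⟨C, N, hu⟩
    refine ⟨|c| * C, N, fun f M h => ?_⟩
    rw [LinearMap.smul_apply, smul_eq_mul, abs_mul, mul_assoc]
    exact mul_le_mul_of_nonneg_left (hu f M h) (abs_nonneg c)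

/-- The space `𝒟'(𝕋²)` of real distributions. -/
abbrev TorusDistribution : Type := continuousForms

/-- The pairing `u(f)` of a distribution with a test function. -/
def TorusDistribution.pair (u : TorusDistribution) (f : TestFunctions) : ℝ := u.1 f

lemma toTorus_isOpenQuotientMap : IsOpenQuotientMap toTorus where
  surjective x := by
    choose v hv using fun i => QuotientAddGroup.mk_surjective (x i)
    exact ⟨v, funext hv⟩
  continuous := continuous_pi fun i => (AddCircle.continuous_mk' 1).comp (continuous_apply i)
  isOpenMap := by
    have h : ∀ i : Fin 2, IsOpenMap (fun t : ℝ => (t : UnitAddCircle)) :=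
      fun _ => QuotientAddGroup.isOpenMap_coe
    exact IsOpenMap.piMap h (by simp)

lemma IsSmooth.continuous {f : Torus2 → ℝ} (hf : IsSmooth f) : Continuous f :=
  toTorus_isOpenQuotientMap.isQuotientMap.continuous_iff.2 (ContDiff.continuous hf)

lemma integrable_mul_testFunction {g : Torus2 → ℝ} (hg : Integrable g torusMeasure)
    (f : TestFunctions) : Integrable (fun x => g x * f.1 x) torusMeasure := by
  have hf : Continuous f.1 := IsSmooth.continuous f.2
  obtain ⟨B, hB⟩ := (isCompact_univ (X := Torus2)).exists_bound_of_continuousOn hf.continuousOn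
  exact hg.mul_bdd hf.aestronglyMeasurable (Eventually.of_forall fun x => hB x (Set.mem_univ x))

open Classical in
/-- The distribution `f ↦ ∫ g f` defined by an integrable function `g`
(by convention `0` if `g` is not integrable). -/
def distOfFun (g : Torus2 → ℝ) : TorusDistribution :=
  if hg : Integrable g torusMeasure then
    ⟨{ toFun := fun f => ∫ x, g x * f.1 x ∂torusMeasure
       map_add' := fun f f' => by
        rw [← integral_add (integrable_mul_testFunction hg f) (integrable_mul_testFunction hg f')]
        exact integral_congr_ae (Eventually.of_forall fun x => mul_add _ _ _)
       map_smul' := fun c f => by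
        rw [RingHom.id_apply, smul_eq_mul, ← integral_const_mul]
        exact integral_congr_ae (Eventually.of_forall fun x => mul_left_comm _ _ _) },
      ∫ x, |g x| ∂torusMeasure, 0, fun f M h => by
        have hM : ∀ x, |f.1 x| ≤ M := fun x => by
          obtain ⟨v, rfl⟩ := toTorus_isOpenQuotientMap.surjective x
          simpa using h 0 le_rfl v
        rw [← integral_mul_const]
        refine (abs_integral_le_integral_abs).trans (integral_mono
          (integrable_mul_testFunction hg f).abs (hg.abs.mul_const M) fun x => ?_)
        simp only [abs_mul]
        exact mul_le_mul_of_nonneg_left (hM x) (abs_nonneg _)⟩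
  else 0

/-! ### Fourier modes and Besov–Hölder spaces -/

lemma contDiff_mFourier (k : Fin 2 → ℤ) :
    ContDiff ℝ (⊤ : ℕ∞) fun v : Fin 2 → ℝ => UnitAddTorus.mFourier k (toTorus v) := by
  have h : (fun v : Fin 2 → ℝ => UnitAddTorus.mFourier k (toTorus v)) = fun v =>
      ∏ i, Complex.exp (2 * Real.pi * Complex.I * k i * ((v i : ℝ) : ℂ)) := by
    funext v
    simp [UnitAddTorus.mFourier, toTorus]
  rw [h]
  refine contDiff_prod fun i _ => ContDiff.cexp (contDiff_const.mul ?_)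
  exact Complex.ofRealCLM.contDiff.comp (contDiff_apply ℝ ℝ i)

/-- The test function `x ↦ cos (2π k·x)`. -/
def cosMode (k : Fin 2 → ℤ) : TestFunctions :=
  ⟨fun x => (UnitAddTorus.mFourier k x).re, Complex.reCLM.contDiff.comp (contDiff_mFourier k)⟩

/-- The test function `x ↦ sin (2π k·x)`. -/
def sinMode (k : Fin 2 → ℤ) : TestFunctions :=
  ⟨fun x => (UnitAddTorus.mFourier k x).im, Complex.imCLM.contDiff.comp (contDiff_mFourier k)⟩

/-- The Fourier coefficient `û(k) = u(e^{-2πi k·x})`. -/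
def TorusDistribution.coeff (u : TorusDistribution) (k : Fin 2 → ℤ) : ℂ :=
  (u.pair (cosMode k) : ℂ) - Complex.I * (u.pair (sinMode k) : ℂ)

/-- The squared Euclidean norm of a frequency `k ∈ ℤ²`. -/
def freqSq (k : Fin 2 → ℤ) : ℝ := ∑ i, (k i : ℝ) ^ 2

/-- A smooth cutoff: `1` on `(-∞, 1]`, `0` on `[2, ∞)`. -/
def cutoff (r : ℝ) : ℝ := Real.smoothTransition (2 - r)

/-- The dyadic partition of unity of Littlewood–Paley theory. The index `j` stands for the block
usually numbered `j - 1`, so the numbering starts at `0` instead of `-1`. -/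
def dyadic : ℕ → ℝ → ℝ
  | 0, r => cutoff r
  | j + 1, r => cutoff (r / 2 ^ (j + 1)) - cutoff (r / 2 ^ j)

/-- The Littlewood–Paley block `Δ_{j-1} u`, a trigonometric polynomial (the sum is finite). -/
def TorusDistribution.block (u : TorusDistribution) (j : ℕ) (x : Torus2) : ℂ :=
  ∑' k : Fin 2 → ℤ, (dyadic j (Real.sqrt (freqSq k)) : ℂ) * u.coeff k * UnitAddTorus.mFourier k x

/-- The Besov–Hölder norm `‖u‖_{𝒞^s} = sup_{j ≥ -1} 2^{js} ‖Δ_j u‖_{L^∞}`, `𝒞^s = B^s_{∞,∞}`. -/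
def besovHolderNorm (s : ℝ) (u : TorusDistribution) : ℝ≥0∞ :=
  ⨆ (j : ℕ) (x : Torus2), ENNReal.ofReal ((2 : ℝ) ^ (((j : ℝ) - 1) * s)) * ‖u.block j x‖ₑ

/-- The Besov–Hölder space `𝒞^s(𝕋²)`. -/
def BesovHolder (s : ℝ) : Set TorusDistribution := {u | besovHolderNorm s u < ∞}

/-! ### White noise and its regularisation -/

/-- `ξ` is a (real, spatial) white noise on `𝕋²`: a random distribution such that `ξ(f)` is a
centred Gaussian variable with variance `‖f‖²_{L²}` for every test function `f`. By linearity the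
variables `ξ(f)` are then jointly Gaussian with covariance `𝔼[ξ(f) ξ(g)] = ∫ f g`. -/
def IsWhiteNoise {Ω : Type*} [MeasurableSpace Ω] (μ : Measure Ω) (ξ : Ω → TorusDistribution) :
    Prop :=
  ∀ f : TestFunctions, HasLaw (fun ω => (ξ ω).pair f)
    (gaussianReal 0 (∫ x, f.1 x ^ 2 ∂torusMeasure).toNNReal) μ

/-- A mollifier `ρ ∈ C_c^∞(ℝ²)` with `∫ ρ = 1`. -/
structure Mollifier where
  toFun : (Fin 2 → ℝ) → ℝ
  contDiff : ContDiff ℝ (⊤ : ℕ∞) toFun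
  hasCompactSupport : HasCompactSupport toFun
  integral_eq_one : ∫ v, toFun v = 1

/-- The rescaled mollifier `ε⁻² ρ(·/ε)` on `ℝ²`. -/
def Mollifier.rescale (ρ : Mollifier) (ε : ℝ) (v : Fin 2 → ℝ) : ℝ :=
  ε⁻¹ ^ 2 * ρ.toFun (ε⁻¹ • v)

/-- The periodisation of `g : ℝ² → ℝ`: the sum of `g` over all representatives of a point. -/
def periodize (g : (Fin 2 → ℝ) → ℝ) (x : Torus2) : ℝ :=
  ∑' v : {v : Fin 2 → ℝ // toTorus v = x}, g v

lemma toTorus_eq_iff (v w : Fin 2 → ℝ) :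
    toTorus w = toTorus v ↔ ∃ n : Fin 2 → ℤ, w = v + fun i => (n i : ℝ) := by
  constructor
  · intro h
    have h' : ∀ i, ∃ m : ℤ, w i = v i + m := fun i => by
      have hi : ((w i - v i : ℝ) : UnitAddCircle) = 0 := by
        rw [AddCircle.coe_sub, sub_eq_zero]
        exact congrFun h i
      obtain ⟨m, hm⟩ := (AddCircle.coe_eq_zero_iff 1).1 hi
      exact ⟨m, by simp at hm; linarith⟩
    choose n hn using h'
    exact ⟨n, funext hn⟩
  · rintro ⟨n, rfl⟩
    funext i
    simp [toTorus]

lemma periodize_toTorus (g : (Fin 2 → ℝ) → ℝ) (v : Fin 2 → ℝ) :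
    periodize g (toTorus v) = ∑' n : Fin 2 → ℤ, g (v + fun i => (n i : ℝ)) := by
  let e : (Fin 2 → ℤ) ≃ {w : Fin 2 → ℝ // toTorus w = toTorus v} :=
    Equiv.ofBijective (fun n => ⟨v + fun i => (n i : ℝ), (toTorus_eq_iff _ _).2 ⟨n, rfl⟩⟩)
      ⟨fun n m h => by
        have h' := congrArg Subtype.val h
        funext i
        simpa using congrFun h' i,
      fun ⟨w, hw⟩ => by
        obtain ⟨n, rfl⟩ := (toTorus_eq_iff _ _).1 hw
        exact ⟨n, rfl⟩⟩
  exact (e.tsum_eq (fun w => g w)).symm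

lemma isSmooth_periodize {g : (Fin 2 → ℝ) → ℝ} (hg : ContDiff ℝ (⊤ : ℕ∞) g)
    (hc : HasCompactSupport g) : IsSmooth (periodize g) := by
  unfold IsSmooth
  simp_rw [periodize_toTorus]
  rw [contDiff_iff_contDiffAt]
  intro v₀
  obtain ⟨R, hR⟩ := hc.isCompact.isBounded.subset_closedBall 0
  have hfin : {n : Fin 2 → ℤ | ∀ i, |(n i : ℝ)| ≤ R + ‖v₀‖ + 1}.Finite := by
    refine (Set.Finite.pi' fun _ : Fin 2 =>
      Set.finite_Icc (-⌊R + ‖v₀‖ + 1⌋) ⌊R + ‖v₀‖ + 1⌋).subset fun n hn i => ?_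
    have h := abs_le.1 (hn i)
    refine ⟨?_, Int.le_floor.2 h.2⟩
    have : -(n i) ≤ ⌊R + ‖v₀‖ + 1⌋ := Int.le_floor.2 (by push_cast; linarith [h.1])
    linarith
  have hsum : ContDiff ℝ (⊤ : ℕ∞) fun v : Fin 2 → ℝ =>
      ∑ n ∈ hfin.toFinset, g (v + fun i => (n i : ℝ)) :=
    ContDiff.sum fun n _ => hg.comp (contDiff_id.add contDiff_const)
  refine hsum.contDiffAt.congr_of_eventuallyEq ?_
  filter_upwards [Metric.ball_mem_nhds v₀ one_pos] with v hv
  refine tsum_eq_sum fun n hn => ?_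
  by_contra hne
  refine hn (hfin.mem_toFinset.2 fun i => ?_)
  have h1 : ‖v + fun i => (n i : ℝ)‖ ≤ R := by
    simpa using hR (subset_tsupport g (Function.mem_support.2 hne))
  have h2 : ‖v - v₀‖ < 1 := by simpa [dist_eq_norm] using hv
  have h3 : |v i + n i| ≤ R := (norm_le_pi_norm (v + fun i => (n i : ℝ)) i).trans h1
  have h4 : |v i - v₀ i| ≤ 1 := (norm_le_pi_norm (v - v₀) i).trans h2.le
  have h5 : |v₀ i| ≤ ‖v₀‖ := norm_le_pi_norm v₀ i
  rw [abs_le] at *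
  constructor <;> linarith [h3.1, h3.2, h4.1, h4.2, h5.1, h5.2]

lemma Mollifier.isSmooth_periodize_rescale (ρ : Mollifier) (ε : ℝ) :
    IsSmooth (periodize (ρ.rescale ε)) := by
  refine isSmooth_periodize
    (contDiff_const.mul (ρ.contDiff.comp (contDiff_const_smul ε⁻¹))) ?_
  rcases eq_or_ne ε 0 with rfl | hε
  · have h : ρ.rescale 0 = 0 := by
      funext v
      simp [Mollifier.rescale]
    rw [h]
    exact HasCompactSupport.zero
  · exact (ρ.hasCompactSupport.comp_smul (inv_ne_zero hε)).mul_left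

/-- The mollifier `ρ_ε` on `𝕋²`: the periodisation of `ε⁻² ρ(·/ε)`. -/
def Mollifier.onTorus (ρ : Mollifier) (ε : ℝ) : TestFunctions :=
  ⟨periodize (ρ.rescale ε), ρ.isSmooth_periodize_rescale ε⟩

/-- The test function `y ↦ f (x - y)`. -/
def TestFunctions.reflect (f : TestFunctions) (x : Torus2) : TestFunctions :=
  ⟨fun y => f.1 (x - y), by
    obtain ⟨v, rfl⟩ := toTorus_isOpenQuotientMap.surjective x
    exact ContDiff.comp (f := fun w : Fin 2 → ℝ => v - w) (show IsSmooth f.1 from f.2)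
      (contDiff_const.sub contDiff_id)⟩

/-- The convolution `(u * f)(x) = u(f(x - ·))` of a distribution with a test function. -/
def TorusDistribution.conv (u : TorusDistribution) (f : TestFunctions) (x : Torus2) : ℝ :=
  u.pair (TestFunctions.reflect f x)

/-! ### The magnetic potential -/

/-- The heat semigroup `e^{tΔ} f = ∑_k e^{-4π²|k|²t} f̂(k) e^{2πi k·x}` on `𝕋²`. -/
def heat (t : ℝ) (f : Torus2 → ℝ) (x : Torus2) : ℝ :=
  (∑' k : Fin 2 → ℤ, (Real.exp (-(4 * Real.pi ^ 2 * freqSq k * t)) : ℂ) *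
    UnitAddTorus.mFourierCoeff (fun y => (f y : ℂ)) k * UnitAddTorus.mFourier k x).re

/-- The inverse of the Laplacian up to a smoothing operator, `Δ⁻¹ := -∫₀¹ e^{tΔ} dt`. -/
def invLaplacian (f : Torus2 → ℝ) (x : Torus2) : ℝ := -∫ t in (0 : ℝ)..1, heat t f x

/-- The partial derivative `∂_i f` on `𝕋²`. -/
def partialDeriv (i : Fin 2) (f : Torus2 → ℝ) (x : Torus2) : ℝ :=
  deriv (fun s : ℝ => f (x + toTorus (Pi.single i s))) 0

/-- The orthogonal gradient `∇^⊥ φ = (-∂₂ φ, ∂₁ φ)`. -/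
def gradPerp (φ : Torus2 → ℝ) : Fin 2 → Torus2 → ℝ := ![-partialDeriv 1 φ, partialDeriv 0 φ]

/-- The regularised potential `A_ε = ∇^⊥ Δ⁻¹ ξ_ε` with `ξ_ε = ξ * ρ_ε`. -/
def potential (ρ : Mollifier) (ε : ℝ) (ξ : TorusDistribution) : Fin 2 → Torus2 → ℝ :=
  gradPerp (invLaplacian (ξ.conv (ρ.onTorus ε)))

/-- The product `A_ε · A_ε`. -/
def potentialSq (ρ : Mollifier) (ε : ℝ) (ξ : TorusDistribution) (x : Torus2) : ℝ :=
  ∑ i, potential ρ ε ξ i x * potential ρ ε ξ i x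

/-- The renormalisation constant `c_ε = 𝔼[A_ε(0) · A_ε(0)]`. -/
def renormConst {Ω : Type*} [MeasurableSpace Ω] (μ : Measure Ω) (ξ : Ω → TorusDistribution)
    (ρ : Mollifier) (ε : ℝ) : ℝ :=
  ∫ ω, potentialSq ρ ε (ξ ω) 0 ∂μ

end

/-!
# The renormalised square of the magnetic potential of white noise

In Fourier space the potential is `Â_ε(k) = potMult k · ρ̂(ε k) · z_k`, where `z_k = ξ̂(k)` are
the modes of the white noise and `potMult k` is of size `|k|⁻¹`. Hence `A_ε · A_ε - c_ε` is a
quadratic form in the `z_k`: its `n`-th Fourier coefficient is the sum over `k + l = n` of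
`potKernel k l · ρ̂(ε k) ρ̂(ε l) · (z_k z_l - 𝔼[z_k z_l])`, and `A²` is the same expression with
`ρ̂` replaced by `1`. The mollifier is thus only present in the kernel, and all estimates reduce
to one bound for quadratic forms in terms of their kernel.

*Moments of quadratic forms.* The variables `ξ(cos (2πk·x) + sin (2πk·x))` are independent
standard Gaussians. Diagonalising a finite symmetric quadratic form in them turns it into `∑ λ_i
(y_i² - 1)` with independent Gaussian `y_i`, whose exponential moments are explicit; this bounds
its moment of order `2m` by the `m`-th power of the sum of the squared coefficients
(`IsStdGaussianFamily.lintegral_wick_le`).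

*Besov–Hölder norms.* A Littlewood–Paley block is a trigonometric polynomial of degree `2 ^ (j +
1)`, so its sup norm is controlled by its `L^{2m}` norm with a loss of order `2 ^ (j / m)`,
negligible for large `m` (Bernstein's inequality, proved by applying Cauchy–Schwarz and Parseval
to the `m`-th power). If the kernel is bounded by `η |k|^{κ-1} |l|^{κ-1}`, the lattice sums
`∑_{|k+l| ≤ R} |k|^{2κ-2} |l|^{2κ-2} ≲ R^{9κ}` give moments of order `η` in `𝒞^s` for every `s <
0`, when `κ` is small and `m` large (`IsStdGaussianFamily.exists_besovHolderNorm_le`).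

*Conclusion.* With `η` constant, this yields the regularity of `A²`, whose coefficients are
constructed as almost sure limits along the truncations `|k|_∞ ≤ 2^i - 1`
(`IsStdGaussianFamily.ae_tendsto_coeff_renormSquare`). The difference of `A²` and `A_ε · A_ε -
c_ε` has the kernel `potKernel k l (1 - ρ̂(ε k) ρ̂(ε l))`, for which `η` is of order `ε^κ`
(`norm_potKernel_mul_one_sub_le`). Finally `c_ε` is the lattice sum of `|potMult k|² |ρ̂(ε k)|²`
(`IsWhiteNoise.hasSum_renormConst`), which is up to a bounded error the sum of `(4π² |k|²)⁻¹` over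
`0 < |k|_∞ ≤ 1/ε`; a comparison with the integral of `1 / (a² + t²)` in each row of the lattice
evaluates it as `(2π)⁻¹ log (1/ε) + O(1)` (`IsWhiteNoise.abs_renormConst_sub_log_le`).
-/

noncomputable section

/-! ### Moments of quadratic forms in Gaussian variables -/

lemma exp_neg_add_sq_le {v : ℝ} (hv : |v| ≤ 1 / 2) : Real.exp (-(v + v ^ 2)) ≤ 1 - v := by
  obtain ⟨h1, h2⟩ := abs_le.1 hv
  rcases le_total 0 v with h | h
  · have hq := Real.quadratic_le_exp_of_nonneg (x := v + v ^ 2) (by positivity)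
    rw [Real.exp_neg, inv_le_comm₀ (Real.exp_pos _) (by linarith)]
    refine le_trans ?_ hq
    rw [inv_le_iff_one_le_mul₀ (by linarith)]
    have : 0 ≤ v ^ 2 * ((1 - v) * (1 + v) ^ 2 / 2 - v) :=
      mul_nonneg (sq_nonneg _) (by nlinarith [mul_nonneg h h, mul_nonneg h (mul_nonneg h h)])
    nlinarith
  · have := (abs_le.1 (Real.abs_exp_sub_one_sub_id_le (x := -(v + v ^ 2))
      (abs_le.2 ⟨by nlinarith, by nlinarith⟩))).2
    have h3 : v ^ 2 * (1 + v) ^ 2 ≤ v ^ 2 * 1 :=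
      mul_le_mul_of_nonneg_left (by nlinarith) (sq_nonneg _)
    nlinarith

lemma gaussian_exp_sq_aux (u x : ℝ) : gaussianPDFReal 0 1 x • Real.exp (u * (x ^ 2 - 1)) =
    (√(2 * Real.pi))⁻¹ * Real.exp (-u) * Real.exp (-(1 / 2 - u) * x ^ 2) := by
  simp only [gaussianPDFReal, NNReal.coe_one, mul_one, sub_zero, smul_eq_mul]
  rw [mul_assoc, mul_assoc, ← Real.exp_add, ← Real.exp_add]
  congr 2
  ring

lemma integrable_gaussian_exp_sq {u : ℝ} (hu : |u| ≤ 1 / 4) :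
    Integrable (fun x => Real.exp (u * (x ^ 2 - 1))) (gaussianReal 0 1) := by
  have hu' := (abs_le.1 hu).2
  rw [gaussianReal_of_var_ne_zero 0 one_ne_zero, gaussianPDF_def,
    integrable_withDensity_iff_integrable_smul' (by fun_prop) (by simp)]
  refine ((integrable_exp_neg_mul_sq (b := 1 / 2 - u) (by linarith)).const_mul
    ((√(2 * Real.pi))⁻¹ * Real.exp (-u))).congr (Eventually.of_forall fun x => ?_)
  simp only [ENNReal.toReal_ofReal (gaussianPDFReal_nonneg 0 1 x)]
  rw [gaussian_exp_sq_aux]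

/-- The exponential moment of the centred square of a standard Gaussian variable is bounded by a
Gaussian one near the origin. -/
lemma integral_gaussian_exp_sq_le {u : ℝ} (hu : |u| ≤ 1 / 4) :
    ∫ x, Real.exp (u * (x ^ 2 - 1)) ∂(gaussianReal 0 1) ≤ Real.exp (2 * u ^ 2) := by
  have hu' := (abs_le.1 hu).2
  rw [integral_gaussianReal_eq_integral_smul one_ne_zero]
  simp_rw [gaussian_exp_sq_aux]
  rw [integral_const_mul, integral_gaussian]
  have hv := exp_neg_add_sq_le (v := 2 * u) (by rw [abs_mul, abs_two]; linarith)
  have h0 : 0 < 1 - 2 * u := by linarith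
  have h1 : √(Real.pi / (1 / 2 - u)) = √(2 * Real.pi) * (√(1 - 2 * u))⁻¹ := by
    rw [← Real.sqrt_inv, ← Real.sqrt_mul (by positivity)]
    congr 1
    field_simp
  rw [h1]
  have h2 : Real.exp (-u - 2 * u ^ 2) ≤ √(1 - 2 * u) := by
    apply Real.le_sqrt_of_sq_le
    rw [← Real.exp_nat_mul]
    refine le_trans (le_of_eq ?_) hv
    congr 1; push_cast; ring
  have h3 : 0 < √(2 * Real.pi) := by positivity
  have h4 : 0 < √(1 - 2 * u) := Real.sqrt_pos.2 h0
  calc _ = Real.exp (-u) * (√(1 - 2 * u))⁻¹ := by field_simp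
    _ ≤ Real.exp (2 * u ^ 2) := by
      rw [← div_eq_mul_inv, div_le_iff₀ h4]
      calc _ = Real.exp (2 * u ^ 2) * Real.exp (-u - 2 * u ^ 2) := by
            rw [← Real.exp_add]; congr 1; ring
        _ ≤ _ := by gcongr

/-- A family of real random variables that is jointly standard Gaussian: all finite linear
combinations are centred Gaussian with the variance of an orthonormal family. -/
structure IsStdGaussianFamily {Ω κ : Type*} [MeasurableSpace Ω] (μ : Measure Ω)
    (g : κ → Ω → ℝ) : Prop where
  measurable : ∀ k, Measurable (g k)
  hasLaw : ∀ (S : Finset κ) (c : κ → ℝ), HasLaw (fun ω => ∑ k ∈ S, c k * g k ω)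
    (gaussianReal 0 (∑ k ∈ S, c k ^ 2).toNNReal) μ

lemma lintegral_pi_exp_le {ι : Type*} [Fintype ι] {l : ι → ℝ} {t : ℝ}
    (h : ∀ i, |t * l i| ≤ 1 / 4) :
    ∫⁻ y, ENNReal.ofReal (Real.exp (t * ∑ i, l i * (y i ^ 2 - 1)))
      ∂(Measure.pi fun _ : ι => gaussianReal 0 1) ≤
      ENNReal.ofReal (Real.exp (2 * t ^ 2 * ∑ i, l i ^ 2)) := by
  have he : ∀ y : ι → ℝ, Real.exp (t * ∑ i, l i * (y i ^ 2 - 1)) =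
      ∏ i, Real.exp (t * l i * (y i ^ 2 - 1)) := fun y => by
    rw [← Real.exp_sum, Finset.mul_sum]
    simp_rw [mul_assoc]
  simp_rw [he]
  rw [← ofReal_integral_eq_lintegral_ofReal
    (Integrable.fintype_prod (f := fun i y => Real.exp (t * l i * (y ^ 2 - 1)))
      fun i => integrable_gaussian_exp_sq (h i))
    (Eventually.of_forall fun y => Finset.prod_nonneg fun i _ => (Real.exp_pos _).le)]
  refine ENNReal.ofReal_le_ofReal ?_
  rw [integral_fintype_prod_eq_prod (f := fun i y => Real.exp (t * l i * (y ^ 2 - 1))),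
    Finset.mul_sum, Real.exp_sum]
  refine Finset.prod_le_prod (fun i _ => integral_nonneg fun y => (Real.exp_pos _).le)
    fun i _ => (integral_gaussian_exp_sq_le (h i)).trans (le_of_eq ?_)
  congr 1; ring

lemma pow_le_exp_add_exp (x : ℝ) (m : ℕ) :
    x ^ (2 * m) ≤ (2 * m).factorial * (Real.exp x + Real.exp (-x)) := by
  have h := Real.pow_div_factorial_le_exp |x| (abs_nonneg x) (2 * m)
  rw [div_le_iff₀ (by positivity), (even_two_mul m).pow_abs, mul_comm (Real.exp _)] at h
  refine h.trans (mul_le_mul_of_nonneg_left ?_ (by positivity))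
  rcases abs_cases x with h | h <;> rw [h.1] <;> linarith [Real.exp_pos x, Real.exp_pos (-x)]

/-- The constant in the equivalence of moments on the second Gaussian chaos. -/
def chaosConst (m : ℕ) : ℝ := (2 * m).factorial * 4 ^ (2 * m) * (2 * Real.exp (1 / 8))

lemma chaosConst_nonneg (m : ℕ) : 0 ≤ chaosConst m := by unfold chaosConst; positivity

lemma lintegral_pi_diag_le {ι : Type*} [Fintype ι] (l : ι → ℝ) {m : ℕ} (hm : m ≠ 0) :
    ∫⁻ y, ENNReal.ofReal ((∑ i, l i * (y i ^ 2 - 1)) ^ (2 * m))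
      ∂(Measure.pi fun _ : ι => gaussianReal 0 1) ≤
      ENNReal.ofReal (chaosConst m * (∑ i, l i ^ 2) ^ m) := by
  set σ := √(∑ i, l i ^ 2) with hσ
  have hs0 : 0 ≤ ∑ i, l i ^ 2 := Finset.sum_nonneg fun i _ => sq_nonneg _
  have hσ2 : σ ^ 2 = ∑ i, l i ^ 2 := Real.sq_sqrt hs0
  rcases eq_or_lt_of_le hs0 with h0 | h0
  · have hl : ∀ i, l i = 0 := fun i => by
      have := (Finset.sum_eq_zero_iff_of_nonneg fun i _ => sq_nonneg (l i)).1 h0.symm i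
        (Finset.mem_univ i)
      simpa using this
    simp [hl, hm]
  · have hσ0 : 0 < σ := Real.sqrt_pos.2 h0
    have hls : ∀ i, |l i| ≤ σ := fun i => Real.abs_le_sqrt
      (Finset.single_le_sum (f := fun i => l i ^ 2) (fun i _ => sq_nonneg _) (Finset.mem_univ i))
    set t : ℝ := 1 / (4 * σ) with ht
    have htl : ∀ s : ℝ, |s| = t → ∀ i, |s * l i| ≤ 1 / 4 := fun s hs i => by
      rw [abs_mul, hs, ht, div_mul_eq_mul_div, one_mul, div_le_iff₀ (by positivity)]
      linarith [hls i]
    have hexp : ∀ s : ℝ, |s| = t → ∫⁻ y, ENNReal.ofReal (Real.exp (s * ∑ i, l i * (y i ^ 2 - 1)))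
        ∂(Measure.pi fun _ : ι => gaussianReal 0 1) ≤ ENNReal.ofReal (Real.exp (1 / 8)) :=
      fun s hs => by
        refine (lintegral_pi_exp_le (htl s hs)).trans (ENNReal.ofReal_le_ofReal (le_of_eq ?_))
        congr 1
        rw [← hσ2, ← sq_abs, hs, ht]
        field_simp; norm_num
    have ht0 : 0 < t := by positivity
    have hpt : ∀ Q : ℝ, Q ^ (2 * m) ≤ ((2 * m).factorial * (4 * σ) ^ (2 * m)) *
        (Real.exp (t * Q) + Real.exp (-t * Q)) := fun Q => by
      have h := pow_le_exp_add_exp (t * Q) m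
      have hQ : Q ^ (2 * m) = (4 * σ) ^ (2 * m) * (t * Q) ^ (2 * m) := by
        rw [← mul_pow]; congr 1; rw [ht]; field_simp
      rw [hQ, mul_comm ((2 * m).factorial : ℝ), mul_assoc, neg_mul]
      exact mul_le_mul_of_nonneg_left h (by positivity)
    calc _ ≤ ∫⁻ y, ENNReal.ofReal ((2 * m).factorial * (4 * σ) ^ (2 * m)) *
          (ENNReal.ofReal (Real.exp (t * ∑ i, l i * (y i ^ 2 - 1))) +
            ENNReal.ofReal (Real.exp (-t * ∑ i, l i * (y i ^ 2 - 1))))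
            ∂(Measure.pi fun _ : ι => gaussianReal 0 1) := by
          refine lintegral_mono fun y => ?_
          rw [← ENNReal.ofReal_add (Real.exp_pos _).le (Real.exp_pos _).le,
            ← ENNReal.ofReal_mul (by positivity)]
          exact ENNReal.ofReal_le_ofReal (hpt _)
      _ ≤ ENNReal.ofReal ((2 * m).factorial * (4 * σ) ^ (2 * m)) *
          (ENNReal.ofReal (Real.exp (1 / 8)) + ENNReal.ofReal (Real.exp (1 / 8))) := by
          rw [lintegral_const_mul _ (by fun_prop), lintegral_add_left (by fun_prop)]
          gcongr
          · exact hexp t (abs_of_pos ht0)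
          · exact hexp (-t) (by rw [abs_neg, abs_of_pos ht0])
      _ = _ := by
          rw [← ENNReal.ofReal_add (by positivity) (by positivity),
            ← ENNReal.ofReal_mul (by positivity), ← hσ2, chaosConst]
          congr 1
          rw [mul_pow, ← pow_mul]
          ring

open Matrix in
lemma Matrix.IsHermitian.quadratic_sub_trace {ι : Type*} [Fintype ι] [DecidableEq ι]
    {B : Matrix ι ι ℝ} (hB : B.IsHermitian) (y : ι → ℝ) :
    (hB.eigenvectorUnitary : Matrix ι ι ℝ) *ᵥ y ⬝ᵥ B *ᵥ ((hB.eigenvectorUnitary : Matrix ι ι ℝ) *ᵥ y)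
      - B.trace = ∑ i, hB.eigenvalues i * (y i ^ 2 - 1) := by
  set U : Matrix ι ι ℝ := (hB.eigenvectorUnitary : Matrix ι ι ℝ) with hU
  have hUU : Uᵀ * U = 1 := by
    simpa [star_eq_conjTranspose] using Unitary.coe_star_mul_self hB.eigenvectorUnitary
  set D : Matrix ι ι ℝ := diagonal hB.eigenvalues with hD
  have hBe : B = U * D * Uᵀ := by
    conv_lhs => rw [hB.spectral_theorem, Unitary.conjStarAlgAut_apply]
    rfl
  have h1 : B *ᵥ (U *ᵥ y) = U *ᵥ (D *ᵥ y) := by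
    rw [hBe]
    simp only [mulVec_mulVec]
    rw [Matrix.mul_assoc, hUU, Matrix.mul_one]
  have h2 : U *ᵥ y ⬝ᵥ B *ᵥ (U *ᵥ y) = y ⬝ᵥ D *ᵥ y := by
    rw [h1, dotProduct_mulVec, ← mulVec_transpose, mulVec_mulVec, hUU, one_mulVec]
  have h3 : B.trace = ∑ i, hB.eigenvalues i := by
    conv_lhs => rw [hBe, trace_mul_comm, ← Matrix.mul_assoc, hUU, Matrix.one_mul]
    simp [hD, trace]
  rw [h2, h3]
  simp only [dotProduct, hD, mulVec_diagonal]
  rw [← Finset.sum_sub_distrib]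
  refine Finset.sum_congr rfl fun i _ => ?_
  ring

open Matrix in
lemma Matrix.IsHermitian.sum_sq_eigenvalues {ι : Type*} [Fintype ι] [DecidableEq ι]
    {B : Matrix ι ι ℝ} (hB : B.IsHermitian) :
    ∑ i, hB.eigenvalues i ^ 2 = ∑ i, ∑ j, B i j ^ 2 := by
  set U : Matrix ι ι ℝ := (hB.eigenvectorUnitary : Matrix ι ι ℝ) with hU
  have hUU : Uᵀ * U = 1 := by
    simpa [star_eq_conjTranspose] using Unitary.coe_star_mul_self hB.eigenvectorUnitary
  set D : Matrix ι ι ℝ := diagonal hB.eigenvalues with hD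
  have hBe : B = U * D * Uᵀ := by
    conv_lhs => rw [hB.spectral_theorem, Unitary.conjStarAlgAut_apply]
    rfl
  have h1 : (B * Bᵀ).trace = ∑ i, ∑ j, B i j ^ 2 := by
    simp [trace, mul_apply, sq]
  have h2 : B * Bᵀ = U * (D * D) * Uᵀ := by
    have hT : Bᵀ = B := by simpa [IsHermitian] using hB
    rw [hT]
    conv_lhs => rw [hBe]
    calc U * D * Uᵀ * (U * D * Uᵀ) = U * D * (Uᵀ * U) * D * Uᵀ := by
          simp only [Matrix.mul_assoc]
      _ = _ := by rw [hUU, Matrix.mul_one]; simp only [Matrix.mul_assoc]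
  rw [← h1, h2, trace_mul_comm, ← Matrix.mul_assoc, hUU, Matrix.one_mul]
  simp [hD, trace, sq]

/-- A finite jointly standard Gaussian family has the law of the standard Gaussian measure. -/
lemma IsStdGaussianFamily.map_eq_stdGaussian {Ω ι : Type*} [Fintype ι] [MeasurableSpace Ω]
    {μ : Measure Ω} [IsProbabilityMeasure μ] {g : ι → Ω → ℝ} (hg : IsStdGaussianFamily μ g) :
    μ.map (fun ω => WithLp.toLp 2 fun i => g i ω) = stdGaussian (EuclideanSpace ℝ ι) := by
  have hm : Measurable fun ω => WithLp.toLp 2 fun i => g i ω :=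
    (WithLp.measurable_toLp 2 _).comp (measurable_pi_lambda _ hg.measurable)
  have := Measure.isProbabilityMeasure_map (μ := μ) hm.aemeasurable
  apply Measure.ext_of_charFun (E := EuclideanSpace ℝ ι)
  ext t
  have hl := hg.hasLaw Finset.univ t
  have h1 : charFun (μ.map fun ω => ∑ i, t i * g i ω) 1 = charFun (μ.map
      fun ω => WithLp.toLp 2 fun i => g i ω) t := by
    rw [charFun_apply, charFun_apply, integral_map hl.aemeasurable (by fun_prop),
      integral_map hm.aemeasurable (by fun_prop)]
    refine integral_congr_ae (Eventually.of_forall fun ω => ?_)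
    simp [PiLp.inner_apply, mul_comm]
  rw [← h1, hl.map_eq, charFun_gaussianReal, charFun_stdGaussian]
  have h2 : 0 ≤ ∑ i, t i ^ 2 := Finset.sum_nonneg fun i _ => sq_nonneg _
  have h3 : (‖t‖ : ℂ) ^ 2 = ((∑ i, t i ^ 2 : ℝ) : ℂ) := by
    rw [← EuclideanSpace.real_norm_sq_eq]; push_cast; rfl
  rw [h3]
  simp [Real.coe_toNNReal _ h2, neg_div]

open Matrix in
/-- Equivalence of moments on the second Gaussian chaos, for real coefficients. Diagonalising the
quadratic form reduces to a weighted sum of independent centred squares, whose exponential moments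
factorise. -/
lemma IsStdGaussianFamily.lintegral_quadratic_le {Ω ι : Type*} [Fintype ι] [DecidableEq ι]
    [MeasurableSpace Ω] {μ : Measure Ω} [IsProbabilityMeasure μ] {g : ι → Ω → ℝ}
    (hg : IsStdGaussianFamily μ g) (B : ι → ι → ℝ) {m : ℕ} (hm : m ≠ 0) :
    ∫⁻ ω, ENNReal.ofReal
      ((∑ i, ∑ j, B i j * (g i ω * g j ω - if i = j then 1 else 0)) ^ (2 * m)) ∂μ ≤
      ENNReal.ofReal (chaosConst m * (∑ i, ∑ j, B i j ^ 2) ^ m) := by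
  let S : Matrix ι ι ℝ := Matrix.of fun i j => (B i j + B j i) / 2
  have hS : S.IsHermitian := by
    ext i j
    simp [S, add_comm]
  have hsum : ∑ i, ∑ j, S i j ^ 2 ≤ ∑ i, ∑ j, B i j ^ 2 := by
    have h : ∑ i, ∑ j, S i j ^ 2 ≤ ∑ i, ∑ j, (B i j ^ 2 + B j i ^ 2) / 2 :=
      Finset.sum_le_sum fun i _ => Finset.sum_le_sum fun j _ => by
        simp only [S, Matrix.of_apply]
        nlinarith [sq_nonneg (B i j - B j i)]
    refine h.trans (le_of_eq ?_)
    simp_rw [add_div, Finset.sum_add_distrib]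
    rw [Finset.sum_comm (f := fun i j => B j i ^ 2 / 2)]
    simp_rw [← Finset.sum_div]
    ring
  have hQ : ∀ x : ι → ℝ, ∑ i, ∑ j, B i j * (x i * x j - if i = j then 1 else 0) =
      x ⬝ᵥ S *ᵥ x - S.trace := fun x => by
    have h1 : x ⬝ᵥ S *ᵥ x = ∑ i, ∑ j, B i j * (x i * x j) := by
      have : x ⬝ᵥ S *ᵥ x = ∑ i, ∑ j, (B i j * (x i * x j) / 2 + B j i * (x j * x i) / 2) := by
        simp only [dotProduct, mulVec, Finset.mul_sum, S, Matrix.of_apply]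
        refine Finset.sum_congr rfl fun i _ => Finset.sum_congr rfl fun j _ => ?_
        ring
      rw [this]
      simp_rw [Finset.sum_add_distrib]
      rw [Finset.sum_comm (f := fun i j => B j i * (x j * x i) / 2)]
      simp_rw [← Finset.sum_div]
      ring
    have h2 : S.trace = ∑ i, B i i := by
      simp [trace, S]
    rw [h1, h2]
    simp [mul_sub, Finset.sum_sub_distrib]
  let F : EuclideanSpace ℝ ι → ℝ≥0∞ := fun x =>
    ENNReal.ofReal ((x.ofLp ⬝ᵥ S *ᵥ x.ofLp - S.trace) ^ (2 * m))
  have hF : Measurable F := by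
    have : Continuous fun x : EuclideanSpace ℝ ι =>
      (x.ofLp ⬝ᵥ S *ᵥ x.ofLp - S.trace) ^ (2 * m) := by fun_prop
    exact this.measurable.ennreal_ofReal
  have hgm : Measurable fun ω => WithLp.toLp 2 fun i => g i ω :=
    (WithLp.measurable_toLp 2 _).comp (measurable_pi_lambda _ hg.measurable)
  calc _ = ∫⁻ ω, F (WithLp.toLp 2 fun i => g i ω) ∂μ := by
        refine lintegral_congr fun ω => ?_
        rw [hQ]
    _ = ∫⁻ x, F x ∂(stdGaussian (EuclideanSpace ℝ ι)) := by
        rw [← hg.map_eq_stdGaussian, lintegral_map hF hgm]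
    _ = ∫⁻ y, F (∑ i, y i • hS.eigenvectorBasis i)
          ∂(Measure.pi fun _ : ι => gaussianReal 0 1) := by
        rw [stdGaussian_eq_map_pi_orthonormalBasis hS.eigenvectorBasis,
          lintegral_map hF (by fun_prop)]
    _ = ∫⁻ y, ENNReal.ofReal ((∑ i, hS.eigenvalues i * (y i ^ 2 - 1)) ^ (2 * m))
          ∂(Measure.pi fun _ : ι => gaussianReal 0 1) := by
        refine lintegral_congr fun y => ?_
        have hv : (∑ i, y i • hS.eigenvectorBasis i).ofLp =
            (hS.eigenvectorUnitary : Matrix ι ι ℝ) *ᵥ y := by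
          ext j
          simp [mulVec, dotProduct, mul_comm]
        simp only [F, hv, hS.quadratic_sub_trace]
    _ ≤ ENNReal.ofReal (chaosConst m * (∑ i, hS.eigenvalues i ^ 2) ^ m) :=
        lintegral_pi_diag_le _ hm
    _ ≤ _ := by
        rw [hS.sum_sq_eigenvalues]
        have := chaosConst_nonneg m
        refine ENNReal.ofReal_le_ofReal (mul_le_mul_of_nonneg_left (pow_le_pow_left₀ ?_ hsum m) this)
        positivity

/-! ### Sums over the frequency lattice -/

/-- The frequencies `k ∈ ℤ²` with `|k_i| ≤ N`. -/
def freqBox (N : ℕ) : Finset (Fin 2 → ℤ) := Fintype.piFinset fun _ => Finset.Icc (-(N : ℤ)) N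

lemma mem_freqBox_iff_abs {N : ℕ} {k : Fin 2 → ℤ} : k ∈ freqBox N ↔ ∀ i, |k i| ≤ N := by
  simp only [freqBox, Fintype.mem_piFinset, Finset.mem_Icc, abs_le]

lemma mem_freqBox {N : ℕ} {k : Fin 2 → ℤ} : k ∈ freqBox N ↔ ‖k‖ ≤ N := by
  rw [mem_freqBox_iff_abs, pi_norm_le_iff_of_nonneg (Nat.cast_nonneg N)]
  refine forall_congr' fun i => ?_
  rw [Int.norm_eq_abs]
  exact_mod_cast Iff.rfl

lemma freqBox_zero : freqBox 0 = {0} := by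
  ext k
  rw [mem_freqBox]
  simp

lemma neg_mem_freqBox {N : ℕ} {k : Fin 2 → ℤ} : -k ∈ freqBox N ↔ k ∈ freqBox N := by
  rw [mem_freqBox, mem_freqBox, norm_neg]

lemma card_freqBox (N : ℕ) : (freqBox N).card = (2 * N + 1) ^ 2 := by
  simp only [freqBox, Fintype.card_piFinset, Int.card_Icc, Finset.prod_const, Finset.card_univ,
    Fintype.card_fin]
  congr 1
  omega

lemma freqBox_mono : Monotone freqBox := fun M N h k hk => by
  rw [mem_freqBox] at hk ⊢
  exact hk.trans (by exact_mod_cast h)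

lemma tendsto_freqBox : Tendsto freqBox atTop atTop :=
  tendsto_atTop_finset_of_monotone freqBox_mono fun k =>
    ⟨⌈‖k‖⌉₊, mem_freqBox.2 (Nat.le_ceil _)⟩

lemma one_le_norm_of_ne_zero {k : Fin 2 → ℤ} (hk : k ≠ 0) : 1 ≤ ‖k‖ := by
  obtain ⟨i, hi⟩ := Function.ne_iff.1 hk
  refine le_trans ?_ (norm_le_pi_norm k i)
  rw [Int.norm_eq_abs]
  exact_mod_cast Int.one_le_abs hi

lemma sum_neg_eq_of_symm {T : Finset (Fin 2 → ℤ)} (hT : ∀ k, -k ∈ T ↔ k ∈ T) {E : Type*}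
    [AddCommMonoid E] (f : (Fin 2 → ℤ) → E) : ∑ k ∈ T, f (-k) = ∑ k ∈ T, f k :=
  Finset.sum_equiv (Equiv.neg _) (fun k => (hT k).symm) fun _ _ => rfl

lemma summable_norm_rpow {b : ℝ} (hb : b < -2) : Summable fun k : Fin 2 → ℤ => ‖k‖ ^ b := by
  simpa using EisensteinSeries.summable_one_div_norm_rpow (k := -b) (by linarith)

/-- The sum of `‖l‖^{-2+5κ}` over a ball of radius `R` with arbitrary centre. -/
lemma sum_ball_norm_rpow_le {κ : ℝ} (hκ : 0 < κ) (hκ' : κ ≤ 1 / 10) (T : Finset (Fin 2 → ℤ))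
    (k : Fin 2 → ℤ) {R : ℕ} (hR : 1 ≤ R) :
    ∑ l ∈ T, (if k + l ∈ freqBox R then ‖l‖ ^ (-2 + 5 * κ) else 0) ≤
      ((∑' l : Fin 2 → ℤ, ‖l‖ ^ (-2 - κ)) + 9) * (R : ℝ) ^ (6 * κ) := by
  have hR' : (1 : ℝ) ≤ R := by exact_mod_cast hR
  have hpt : ∀ l : Fin 2 → ℤ, ‖l‖ ^ (-2 + 5 * κ) ≤
      (R : ℝ) ^ (6 * κ) * ‖l‖ ^ (-2 - κ) + (R : ℝ) ^ (-2 + 5 * κ) := fun l => by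
    rcases eq_or_ne l 0 with rfl | hl
    · rw [norm_zero, Real.zero_rpow (by linarith), Real.zero_rpow (by linarith)]
      positivity
    · have h1 := one_le_norm_of_ne_zero hl
      rcases le_total ‖l‖ R with h | h
      · have : ‖l‖ ^ (-2 + 5 * κ) = ‖l‖ ^ (6 * κ) * ‖l‖ ^ (-2 - κ) := by
          rw [← Real.rpow_add (by linarith)]; congr 1; ring
        rw [this]
        have h2 : ‖l‖ ^ (6 * κ) ≤ (R : ℝ) ^ (6 * κ) :=
          Real.rpow_le_rpow (norm_nonneg _) h (by linarith)
        have h3 : 0 ≤ (R : ℝ) ^ (-2 + 5 * κ) := by positivity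
        have h4 := mul_le_mul_of_nonneg_right h2 (Real.rpow_nonneg (norm_nonneg l) (-2 - κ))
        linarith
      · have h2 : ‖l‖ ^ (-2 + 5 * κ) ≤ (R : ℝ) ^ (-2 + 5 * κ) :=
          Real.rpow_le_rpow_of_nonpos (by linarith) h (by linarith)
        have h3 : 0 ≤ (R : ℝ) ^ (6 * κ) * ‖l‖ ^ (-2 - κ) := by positivity
        linarith
  have hcard : ((T.filter fun l => k + l ∈ freqBox R).card : ℝ) ≤ 9 * (R : ℝ) ^ (2 : ℝ) := by
    have h1 : (T.filter fun l => k + l ∈ freqBox R).card ≤ (freqBox R).card :=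
      Finset.card_le_card_of_injOn (fun l => k + l) (fun l hl => (Finset.mem_filter.1 hl).2)
        fun _ _ _ _ h => add_left_cancel h
    rw [card_freqBox] at h1
    have h2 : ((T.filter fun l => k + l ∈ freqBox R).card : ℝ) ≤ (2 * R + 1) ^ 2 := by
      exact_mod_cast h1
    rw [Real.rpow_two]
    nlinarith
  rw [← Finset.sum_filter]
  calc _ ≤ ∑ l ∈ T.filter (fun l => k + l ∈ freqBox R),
        ((R : ℝ) ^ (6 * κ) * ‖l‖ ^ (-2 - κ) + (R : ℝ) ^ (-2 + 5 * κ)) :=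
        Finset.sum_le_sum fun l _ => hpt l
    _ = (R : ℝ) ^ (6 * κ) * ∑ l ∈ T.filter (fun l => k + l ∈ freqBox R), ‖l‖ ^ (-2 - κ) +
        (T.filter fun l => k + l ∈ freqBox R).card * (R : ℝ) ^ (-2 + 5 * κ) := by
        rw [Finset.sum_add_distrib, ← Finset.mul_sum, Finset.sum_const, nsmul_eq_mul]
    _ ≤ (R : ℝ) ^ (6 * κ) * (∑' l : Fin 2 → ℤ, ‖l‖ ^ (-2 - κ)) +
        9 * (R : ℝ) ^ (2 : ℝ) * (R : ℝ) ^ (-2 + 5 * κ) := by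
        gcongr
        exact (summable_norm_rpow (by linarith)).sum_le_tsum _ fun l _ =>
          Real.rpow_nonneg (norm_nonneg _) _
    _ ≤ (R : ℝ) ^ (6 * κ) * (∑' l : Fin 2 → ℤ, ‖l‖ ^ (-2 - κ)) + 9 * (R : ℝ) ^ (6 * κ) := by
        rw [mul_assoc, ← Real.rpow_add (by linarith)]
        have := Real.rpow_le_rpow_of_exponent_le hR' (show 2 + (-2 + 5 * κ) ≤ 6 * κ by linarith)
        linarith
    _ = _ := by ring

/-- The constant in `sum_pair_norm_rpow_le`. -/
def pairConst (κ : ℝ) : ℝ :=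
  2 ^ (3 * κ) * (∑' l : Fin 2 → ℤ, ‖l‖ ^ (-2 - κ)) * ((∑' l : Fin 2 → ℤ, ‖l‖ ^ (-2 - κ)) + 9)

lemma pairConst_nonneg (κ : ℝ) : 0 ≤ pairConst κ := by
  have : 0 ≤ ∑' l : Fin 2 → ℤ, ‖l‖ ^ (-2 - κ) :=
    tsum_nonneg fun l => Real.rpow_nonneg (norm_nonneg _) _
  unfold pairConst
  positivity

/-- The convolution of `‖k‖^{-2+2κ}` with itself, summed over a ball of radius `R`, grows like an
arbitrarily small power of `R`. -/
lemma sum_pair_norm_rpow_le {κ : ℝ} (hκ : 0 < κ) (hκ' : κ ≤ 1 / 10) (T : Finset (Fin 2 → ℤ))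
    {R : ℕ} (hR : 1 ≤ R) :
    ∑ k ∈ T, ∑ l ∈ T, (if k + l ∈ freqBox R then (‖k‖ ^ (κ - 1) * ‖l‖ ^ (κ - 1)) ^ 2 else 0) ≤
      pairConst κ * (R : ℝ) ^ (9 * κ) := by
  have hR' : (1 : ℝ) ≤ R := by exact_mod_cast hR
  set S := ∑' l : Fin 2 → ℤ, ‖l‖ ^ (-2 - κ) with hS
  have hS0 : 0 ≤ S := tsum_nonneg fun l => Real.rpow_nonneg (norm_nonneg _) _
  have hsq : ∀ k : Fin 2 → ℤ, (‖k‖ ^ (κ - 1)) ^ 2 = ‖k‖ ^ (2 * κ - 2) := fun k => by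
    rw [← Real.rpow_natCast, ← Real.rpow_mul (norm_nonneg _)]; congr 1; push_cast; ring
  have hpt : ∀ k l : Fin 2 → ℤ,
      (if k + l ∈ freqBox R then (‖k‖ ^ (κ - 1) * ‖l‖ ^ (κ - 1)) ^ 2 else 0) ≤
      (2 * R : ℝ) ^ (3 * κ) * ‖k‖ ^ (-2 - κ) *
        (if k + l ∈ freqBox R then ‖l‖ ^ (-2 + 5 * κ) else 0) := fun k l => by
    split_ifs with h
    · rw [mul_pow, hsq, hsq]
      rcases eq_or_ne k 0 with rfl | hk
      · rw [norm_zero, Real.zero_rpow (by linarith), zero_mul]; positivity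
      rcases eq_or_ne l 0 with rfl | hl
      · rw [norm_zero, Real.zero_rpow (x := 2 * κ - 2) (by linarith), mul_zero]; positivity
      have h1 := one_le_norm_of_ne_zero hk
      have h2 := one_le_norm_of_ne_zero hl
      rw [mem_freqBox] at h
      have h3 : ‖k‖ ≤ 2 * R * ‖l‖ := by
        have : ‖k‖ ≤ ‖k + l‖ + ‖l‖ := by simpa using norm_sub_le (k + l) l
        nlinarith
      have h4 : ‖k‖ ^ (3 * κ) ≤ (2 * R : ℝ) ^ (3 * κ) * ‖l‖ ^ (3 * κ) := by
        rw [← Real.mul_rpow (by positivity) (norm_nonneg _)]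
        exact Real.rpow_le_rpow (norm_nonneg _) h3 (by linarith)
      have h5 : ‖k‖ ^ (2 * κ - 2) = ‖k‖ ^ (-2 - κ) * ‖k‖ ^ (3 * κ) := by
        rw [← Real.rpow_add (by linarith)]; congr 1; ring
      have h6 : ‖l‖ ^ (-2 + 5 * κ) = ‖l‖ ^ (3 * κ) * ‖l‖ ^ (2 * κ - 2) := by
        rw [← Real.rpow_add (by linarith)]; congr 1; ring
      rw [h5, h6]
      calc _ ≤ ‖k‖ ^ (-2 - κ) * ((2 * R : ℝ) ^ (3 * κ) * ‖l‖ ^ (3 * κ)) * ‖l‖ ^ (2 * κ - 2) := by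
            gcongr
        _ = _ := by ring
    · simp
  calc _ ≤ ∑ k ∈ T, ∑ l ∈ T, (2 * R : ℝ) ^ (3 * κ) * ‖k‖ ^ (-2 - κ) *
        (if k + l ∈ freqBox R then ‖l‖ ^ (-2 + 5 * κ) else 0) :=
        Finset.sum_le_sum fun k _ => Finset.sum_le_sum fun l _ => hpt k l
    _ ≤ ∑ k ∈ T, (2 * R : ℝ) ^ (3 * κ) * ‖k‖ ^ (-2 - κ) * ((S + 9) * (R : ℝ) ^ (6 * κ)) := by
        refine Finset.sum_le_sum fun k _ => ?_
        rw [← Finset.mul_sum]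
        exact mul_le_mul_of_nonneg_left (sum_ball_norm_rpow_le hκ hκ' T k hR) (by positivity)
    _ = (2 * R : ℝ) ^ (3 * κ) * (∑ k ∈ T, ‖k‖ ^ (-2 - κ)) * ((S + 9) * (R : ℝ) ^ (6 * κ)) := by
        rw [← Finset.sum_mul, ← Finset.mul_sum]
    _ ≤ (2 * R : ℝ) ^ (3 * κ) * S * ((S + 9) * (R : ℝ) ^ (6 * κ)) := by
        gcongr
        exact (summable_norm_rpow (by linarith)).sum_le_tsum _ fun l _ =>
          Real.rpow_nonneg (norm_nonneg _) _
    _ = pairConst κ * (R : ℝ) ^ (9 * κ) := by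
        rw [Real.mul_rpow zero_le_two (by positivity), pairConst,
          show 9 * κ = 3 * κ + 6 * κ by ring, Real.rpow_add (by linarith)]
        ring

/-! ### The second chaos of a complex Gaussian family -/

section Chaos

variable {Ω κ : Type*} [MeasurableSpace Ω] {μ : Measure Ω}

lemma IsStdGaussianFamily.comp_injective {ι : Type*} {g : κ → Ω → ℝ}
    (hg : IsStdGaussianFamily μ g) {e : ι → κ} (he : Function.Injective e) :
    IsStdGaussianFamily μ (fun i => g (e i)) where
  measurable i := hg.measurable _
  hasLaw S c := by
    have h := hg.hasLaw (S.map ⟨e, he⟩) (Function.extend e c 0)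
    simpa [Finset.sum_map, he.extend_apply] using h

/-- Equivalence of moments on the second Gaussian chaos, for complex coefficients. -/
lemma IsStdGaussianFamily.lintegral_complex_quadratic_le [IsProbabilityMeasure μ] [DecidableEq κ]
    {g : κ → Ω → ℝ} (hg : IsStdGaussianFamily μ g) (T : Finset κ) (B : κ → κ → ℂ) {m : ℕ}
    (hm : m ≠ 0) :
    ∫⁻ ω, ‖∑ i ∈ T, ∑ j ∈ T, B i j * (g i ω * g j ω - if i = j then 1 else 0)‖ₑ ^ (2 * m) ∂μ ≤
      ENNReal.ofReal (2 ^ (m + 1) * chaosConst m * (∑ i ∈ T, ∑ j ∈ T, ‖B i j‖ ^ 2) ^ m) := by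
  have hg' := hg.comp_injective (e := ((↑) : T → κ)) Subtype.val_injective
  let X (C : κ → κ → ℝ) (ω : Ω) : ℝ :=
    ∑ i ∈ T, ∑ j ∈ T, C i j * (g i ω * g j ω - if i = j then 1 else 0)
  have hX : ∀ C : κ → κ → ℝ, ∫⁻ ω, ENNReal.ofReal (X C ω ^ (2 * m)) ∂μ ≤
      ENNReal.ofReal (chaosConst m * (∑ i ∈ T, ∑ j ∈ T, C i j ^ 2) ^ m) := fun C => by
    have h := hg'.lintegral_quadratic_le (fun i j => C i j) hm
    have h1 : ∀ F : κ → κ → ℝ, ∑ i : T, ∑ j : T, F i j = ∑ i ∈ T, ∑ j ∈ T, F i j := fun F => by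
      rw [← Finset.sum_coe_sort T]
      exact Finset.sum_congr rfl fun i _ => Finset.sum_coe_sort T (F i)
    simp only [← h1, X]
    simpa only [Subtype.ext_iff] using h
  have hXm : ∀ C, Measurable (X C) := fun C => by
    have := hg.measurable
    simp only [X]
    fun_prop
  have hre : ∀ ω, (∑ i ∈ T, ∑ j ∈ T,
      B i j * ((g i ω : ℂ) * g j ω - if i = j then 1 else 0)) =
      (X (fun i j => (B i j).re) ω : ℂ) + X (fun i j => (B i j).im) ω * Complex.I := fun ω => by
    simp only [X, Complex.ofReal_sum, Finset.sum_mul, ← Finset.sum_add_distrib]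
    refine Finset.sum_congr rfl fun i _ => Finset.sum_congr rfl fun j _ => ?_
    conv_lhs => rw [← Complex.re_add_im (B i j)]
    split_ifs <;> push_cast <;> ring
  have hsum : ∀ f : κ → κ → ℝ, (∀ i j, f i j ^ 2 ≤ ‖B i j‖ ^ 2) →
      ENNReal.ofReal (chaosConst m * (∑ i ∈ T, ∑ j ∈ T, f i j ^ 2) ^ m) ≤
      ENNReal.ofReal (chaosConst m * (∑ i ∈ T, ∑ j ∈ T, ‖B i j‖ ^ 2) ^ m) := fun f hf => by
    refine ENNReal.ofReal_le_ofReal (mul_le_mul_of_nonneg_left (pow_le_pow_left₀ (by positivity)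
      (Finset.sum_le_sum fun i _ => Finset.sum_le_sum fun j _ => hf i j) m) (chaosConst_nonneg m))
  calc _ ≤ ∫⁻ ω, ENNReal.ofReal (2 ^ m) *
        (ENNReal.ofReal (X (fun i j => (B i j).re) ω ^ (2 * m)) +
          ENNReal.ofReal (X (fun i j => (B i j).im) ω ^ (2 * m))) ∂μ := by
        refine lintegral_mono fun ω => ?_
        have hev : ∀ x : ℝ, 0 ≤ x ^ (2 * m) := (even_two_mul m).pow_nonneg
        rw [hre, ← ofReal_norm, ← ENNReal.ofReal_pow (norm_nonneg _),
          ← ENNReal.ofReal_add (hev _) (hev _), ← ENNReal.ofReal_mul (by positivity)]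
        refine ENNReal.ofReal_le_ofReal ?_
        rw [pow_mul, Complex.sq_norm, Complex.normSq_add_mul_I, pow_mul, pow_mul]
        refine (add_pow_le (sq_nonneg _) (sq_nonneg _) m).trans ?_
        gcongr
        · norm_num
        · omega
    _ ≤ ENNReal.ofReal (2 ^ m) *
        (ENNReal.ofReal (chaosConst m * (∑ i ∈ T, ∑ j ∈ T, ‖B i j‖ ^ 2) ^ m) +
          ENNReal.ofReal (chaosConst m * (∑ i ∈ T, ∑ j ∈ T, ‖B i j‖ ^ 2) ^ m)) := by
        have h1 := hXm (fun i j => (B i j).re)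
        have h2 := hXm (fun i j => (B i j).im)
        rw [lintegral_const_mul _ (by fun_prop), lintegral_add_left (by fun_prop)]
        gcongr
        · exact (hX _).trans (hsum _ fun i j => by
            rw [Complex.sq_norm, Complex.normSq_apply]; nlinarith [sq_nonneg (B i j).im])
        · exact (hX _).trans (hsum _ fun i j => by
            rw [Complex.sq_norm, Complex.normSq_apply]; nlinarith [sq_nonneg (B i j).re])
    _ = _ := by
        have := chaosConst_nonneg m
        rw [← ENNReal.ofReal_add (by positivity) (by positivity), ← ENNReal.ofReal_mul (by positivity)]
        congr 1
        rw [pow_succ]; ring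

end Chaos

/-- The complex Fourier modes `z_k` of white noise, in terms of its coordinates `g_k` in the real
orthonormal basis `cos (2π k·x) + sin (2π k·x)`, `k ∈ ℤ²`, of `L²(𝕋²)`. -/
def fourierMode {Ω : Type*} (g : (Fin 2 → ℤ) → Ω → ℝ) (k : Fin 2 → ℤ) (ω : Ω) : ℂ :=
  (1 - Complex.I) / 2 * g k ω + (1 + Complex.I) / 2 * g (-k) ω

/-- The Wick product `z_k z_l - 𝔼[z_k z_l]`. -/
def wickProd {Ω : Type*} (g : (Fin 2 → ℤ) → Ω → ℝ) (k l : Fin 2 → ℤ) (ω : Ω) : ℂ :=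
  fourierMode g k ω * fourierMode g l ω - if k + l = 0 then 1 else 0

lemma wickProd_eq {Ω : Type*} (g : (Fin 2 → ℤ) → Ω → ℝ) (k l : Fin 2 → ℤ) (ω : Ω) :
    wickProd g k l ω =
      -Complex.I / 2 * (g k ω * g l ω - if k = l then 1 else 0) +
      1 / 2 * (g k ω * g (-l) ω - if k = -l then 1 else 0) +
      1 / 2 * (g (-k) ω * g l ω - if -k = l then 1 else 0) +
      Complex.I / 2 * (g (-k) ω * g (-l) ω - if -k = -l then 1 else 0) := by
  have h1 : (k + l = 0) ↔ (k = -l) := add_eq_zero_iff_eq_neg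
  have h2 : (-k = l) ↔ (k = -l) := by rw [neg_eq_iff_eq_neg]
  have h3 : (-k = -l) ↔ k = l := neg_inj
  have hI : Complex.I ^ 2 = -1 := Complex.I_sq
  simp only [wickProd, fourierMode, h1, h2, h3]
  linear_combination (1 / 4 * (g k ω * g l ω + g (-k) ω * g (-l) ω - g k ω * g (-l) ω -
    g (-k) ω * g l ω : ℂ)) * hI

/-- Equivalence of moments on the second chaos in terms of the complex Fourier modes. -/
lemma IsStdGaussianFamily.lintegral_wick_le {Ω : Type*} [MeasurableSpace Ω] {μ : Measure Ω}
    [IsProbabilityMeasure μ] {g : (Fin 2 → ℤ) → Ω → ℝ} (hg : IsStdGaussianFamily μ g)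
    {T : Finset (Fin 2 → ℤ)} (hT : ∀ k, -k ∈ T ↔ k ∈ T) (b : (Fin 2 → ℤ) → (Fin 2 → ℤ) → ℂ)
    {m : ℕ} (hm : m ≠ 0) :
    ∫⁻ ω, ‖∑ k ∈ T, ∑ l ∈ T, b k l * wickProd g k l ω‖ₑ ^ (2 * m) ∂μ ≤
      ENNReal.ofReal (2 ^ (m + 1) * chaosConst m * (4 * ∑ k ∈ T, ∑ l ∈ T, ‖b k l‖ ^ 2) ^ m) := by
  let B : (Fin 2 → ℤ) → (Fin 2 → ℤ) → ℂ := fun k l =>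
    -Complex.I / 2 * b k l + 1 / 2 * b k (-l) + 1 / 2 * b (-k) l + Complex.I / 2 * b (-k) (-l)
  have hre : ∀ ω, ∑ k ∈ T, ∑ l ∈ T, b k l * wickProd g k l ω =
      ∑ k ∈ T, ∑ l ∈ T, B k l * (g k ω * g l ω - if k = l then 1 else 0) := fun ω => by
    let G : (Fin 2 → ℤ) → (Fin 2 → ℤ) → ℂ := fun k l => g k ω * g l ω - if k = l then 1 else 0
    have e1 : ∑ k ∈ T, ∑ l ∈ T, b k l * G k (-l) = ∑ k ∈ T, ∑ l ∈ T, b k (-l) * G k l :=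
      Finset.sum_congr rfl fun k _ => by
        simpa using sum_neg_eq_of_symm hT fun l => b k (-l) * G k l
    have e2 : ∑ k ∈ T, ∑ l ∈ T, b k l * G (-k) l = ∑ k ∈ T, ∑ l ∈ T, b (-k) l * G k l := by
      simpa using sum_neg_eq_of_symm hT fun k => ∑ l ∈ T, b (-k) l * G k l
    have e3 : ∑ k ∈ T, ∑ l ∈ T, b k l * G (-k) (-l) =
        ∑ k ∈ T, ∑ l ∈ T, b (-k) (-l) * G k l := by
      have e4 : ∑ k ∈ T, ∑ l ∈ T, b k l * G (-k) (-l) = ∑ k ∈ T, ∑ l ∈ T, b k (-l) * G (-k) l :=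
        Finset.sum_congr rfl fun k _ => by
          simpa using sum_neg_eq_of_symm hT fun l => b k (-l) * G (-k) l
      rw [e4]
      simpa using sum_neg_eq_of_symm hT fun k => ∑ l ∈ T, b (-k) (-l) * G k l
    have hl : ∑ k ∈ T, ∑ l ∈ T, b k l * wickProd g k l ω =
        -Complex.I / 2 * ∑ k ∈ T, ∑ l ∈ T, b k l * G k l +
        1 / 2 * ∑ k ∈ T, ∑ l ∈ T, b k l * G k (-l) +
        1 / 2 * ∑ k ∈ T, ∑ l ∈ T, b k l * G (-k) l +
        Complex.I / 2 * ∑ k ∈ T, ∑ l ∈ T, b k l * G (-k) (-l) := by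
      simp only [Finset.mul_sum, ← Finset.sum_add_distrib]
      refine Finset.sum_congr rfl fun k _ => Finset.sum_congr rfl fun l _ => ?_
      rw [wickProd_eq]
      simp only [G]
      ring
    rw [hl, e1, e2, e3]
    simp only [Finset.mul_sum, ← Finset.sum_add_distrib]
    refine Finset.sum_congr rfl fun k _ => Finset.sum_congr rfl fun l _ => ?_
    simp only [G, B]
    ring
  have hB : ∀ k l, ‖B k l‖ ^ 2 ≤
      ‖b k l‖ ^ 2 + ‖b k (-l)‖ ^ 2 + ‖b (-k) l‖ ^ 2 + ‖b (-k) (-l)‖ ^ 2 := fun k l => by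
    have h : ‖B k l‖ ≤ (‖b k l‖ + ‖b k (-l)‖ + ‖b (-k) l‖ + ‖b (-k) (-l)‖) / 2 := by
      refine (norm_add_le _ _).trans ?_
      refine (add_le_add_left ((norm_add_le _ _).trans
        (add_le_add_left (norm_add_le _ _) _)) _).trans (le_of_eq ?_)
      simp only [norm_mul, norm_div, norm_neg, Complex.norm_I, Complex.norm_ofNat, norm_one]
      ring
    refine (pow_le_pow_left₀ (norm_nonneg _) h 2).trans ?_
    nlinarith [sq_nonneg (‖b k l‖ - ‖b k (-l)‖), sq_nonneg (‖b k l‖ - ‖b (-k) l‖),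
      sq_nonneg (‖b k l‖ - ‖b (-k) (-l)‖), sq_nonneg (‖b k (-l)‖ - ‖b (-k) l‖),
      sq_nonneg (‖b k (-l)‖ - ‖b (-k) (-l)‖), sq_nonneg (‖b (-k) l‖ - ‖b (-k) (-l)‖)]
  have hBs : ∑ k ∈ T, ∑ l ∈ T, ‖B k l‖ ^ 2 ≤ 4 * ∑ k ∈ T, ∑ l ∈ T, ‖b k l‖ ^ 2 := by
    refine (Finset.sum_le_sum fun k _ => Finset.sum_le_sum fun l _ => hB k l).trans (le_of_eq ?_)
    simp only [Finset.sum_add_distrib]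
    have e1 : ∀ k, ∑ l ∈ T, ‖b k (-l)‖ ^ 2 = ∑ l ∈ T, ‖b k l‖ ^ 2 := fun k =>
      sum_neg_eq_of_symm hT fun l => ‖b k l‖ ^ 2
    simp only [e1]
    rw [sum_neg_eq_of_symm hT fun k => ∑ l ∈ T, ‖b k l‖ ^ 2]
    ring
  simp only [hre]
  refine (hg.lintegral_complex_quadratic_le T B hm).trans (ENNReal.ofReal_le_ofReal ?_)
  have := chaosConst_nonneg m
  refine mul_le_mul_of_nonneg_left (pow_le_pow_left₀ ?_ hBs m) (by positivity)
  positivity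

/-- The `n`-th Fourier coefficient of the renormalised quadratic field with kernel `a`, the
frequencies of the noise being truncated at `N`. -/
def chaosCoeff {Ω : Type*} (g : (Fin 2 → ℤ) → Ω → ℝ) (a : (Fin 2 → ℤ) → (Fin 2 → ℤ) → ℂ) (N : ℕ)
    (n : Fin 2 → ℤ) (ω : Ω) : ℂ :=
  ∑ k ∈ freqBox N, ∑ l ∈ freqBox N, if k + l = n then a k l * wickProd g k l ω else 0

lemma sum_mul_chaosCoeff {Ω : Type*} (g : (Fin 2 → ℤ) → Ω → ℝ)
    (a : (Fin 2 → ℤ) → (Fin 2 → ℤ) → ℂ) (N R : ℕ) (φ : (Fin 2 → ℤ) → ℂ) (ω : Ω) :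
    ∑ n ∈ freqBox R, φ n * chaosCoeff g a N n ω =
      ∑ k ∈ freqBox N, ∑ l ∈ freqBox N,
        (if k + l ∈ freqBox R then φ (k + l) * a k l else 0) * wickProd g k l ω := by
  simp only [chaosCoeff, Finset.mul_sum]
  rw [Finset.sum_comm]
  refine Finset.sum_congr rfl fun k _ => ?_
  rw [Finset.sum_comm]
  refine Finset.sum_congr rfl fun l _ => ?_
  simp only [mul_ite, mul_zero]
  rw [Finset.sum_ite_eq]
  split_ifs <;> ring

/-- The basic moment bound: a kernel of size `η ‖k‖^{κ-1} ‖l‖^{κ-1}` gives a field whose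
projection to frequencies at most `R` is almost of order one. -/
lemma IsStdGaussianFamily.lintegral_sum_chaosCoeff_le {Ω : Type*} [MeasurableSpace Ω]
    {μ : Measure Ω} [IsProbabilityMeasure μ] {g : (Fin 2 → ℤ) → Ω → ℝ}
    (hg : IsStdGaussianFamily μ g) {κ : ℝ} (hκ : 0 < κ) (hκ' : κ ≤ 1 / 10)
    {a : (Fin 2 → ℤ) → (Fin 2 → ℤ) → ℂ} {η : ℝ}
    (ha : ∀ k l, ‖a k l‖ ≤ η * (‖k‖ ^ (κ - 1) * ‖l‖ ^ (κ - 1))) {φ : (Fin 2 → ℤ) → ℂ}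
    (hφ : ∀ n, ‖φ n‖ ≤ 1) {m : ℕ} (hm : m ≠ 0) (N : ℕ) {R : ℕ} (hR : 1 ≤ R) :
    ∫⁻ ω, ‖∑ n ∈ freqBox R, φ n * chaosCoeff g a N n ω‖ₑ ^ (2 * m) ∂μ ≤
      ENNReal.ofReal (2 ^ (m + 1) * chaosConst m *
        (4 * (η ^ 2 * (pairConst κ * (R : ℝ) ^ (9 * κ)))) ^ m) := by
  simp only [sum_mul_chaosCoeff]
  refine (hg.lintegral_wick_le (fun k => neg_mem_freqBox) _ hm).trans
    (ENNReal.ofReal_le_ofReal ?_)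
  have := chaosConst_nonneg m
  refine mul_le_mul_of_nonneg_left (pow_le_pow_left₀ (by positivity) ?_ m) (by positivity)
  refine mul_le_mul_of_nonneg_left ?_ zero_le_four
  refine le_trans ?_ (mul_le_mul_of_nonneg_left
    (sum_pair_norm_rpow_le hκ hκ' (freqBox N) hR) (sq_nonneg η))
  rw [Finset.mul_sum]
  refine Finset.sum_le_sum fun k _ => ?_
  rw [Finset.mul_sum]
  refine Finset.sum_le_sum fun l _ => ?_
  split_ifs
  · rw [← mul_pow]
    refine pow_le_pow_left₀ (norm_nonneg _) ?_ 2
    rw [norm_mul]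
    calc _ ≤ 1 * ‖a k l‖ := by gcongr; exact hφ _
      _ ≤ _ := by rw [one_mul]; exact ha k l
  · simp

/-! ### Trigonometric polynomials and Littlewood–Paley blocks -/

instance : IsProbabilityMeasure torusMeasure := by unfold torusMeasure; infer_instance

instance : Measure.IsAddHaarMeasure torusMeasure := by unfold torusMeasure; infer_instance

lemma mFourierCoeff_eq (f : Torus2 → ℂ) (n : Fin 2 → ℤ) :
    UnitAddTorus.mFourierCoeff f n = ∫ x, UnitAddTorus.mFourier (-n) x * f x ∂torusMeasure := rfl

lemma norm_mFourier_apply (n : Fin 2 → ℤ) (x : Torus2) : ‖UnitAddTorus.mFourier n x‖ = 1 := by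
  simp only [UnitAddTorus.mFourier, ContinuousMap.coe_mk, norm_prod, fourier_apply,
    Circle.norm_coe, Finset.prod_const_one]

lemma Continuous.integrable_torus {E : Type*} [NormedAddCommGroup E]
    {f : Torus2 → E} (hf : Continuous f) : Integrable f torusMeasure :=
  hf.integrable_of_hasCompactSupport (HasCompactSupport.of_compactSpace f)

lemma integral_mFourier (n : Fin 2 → ℤ) :
    ∫ x, UnitAddTorus.mFourier n x ∂torusMeasure = if n = 0 then 1 else 0 := by
  split_ifs with h
  · subst h
    simp [UnitAddTorus.mFourier_zero]
  · have ho := (orthonormal_iff_ite.1 (UnitAddTorus.orthonormal_mFourier (d := Fin 2))) 0 n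
    rw [if_neg (Ne.symm h), ContinuousMap.inner_toLp] at ho
    simpa [UnitAddTorus.mFourier_zero] using! ho

lemma mFourier_mul_neg (m n : Fin 2 → ℤ) (x : Torus2) :
    UnitAddTorus.mFourier (-n) x * UnitAddTorus.mFourier m x = UnitAddTorus.mFourier (m - n) x := by
  rw [← UnitAddTorus.mFourier_add, sub_eq_neg_add]

/-- The trigonometric polynomials whose frequencies lie in `freqBox N`. -/
def trigPoly (N : ℕ) : Submodule ℂ C(Torus2, ℂ) :=
  Submodule.span ℂ (UnitAddTorus.mFourier '' (freqBox N : Set (Fin 2 → ℤ)))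

lemma mul_mem_trigPoly {M N : ℕ} {f g : C(Torus2, ℂ)} (hf : f ∈ trigPoly M) (hg : g ∈ trigPoly N) :
    f * g ∈ trigPoly (M + N) := by
  have h : trigPoly M * trigPoly N ≤ trigPoly (M + N) := by
    rw [trigPoly, trigPoly, Submodule.span_mul_span]
    refine Submodule.span_mono ?_
    rintro _ ⟨_, ⟨m, hm, rfl⟩, _, ⟨n, hn, rfl⟩, rfl⟩
    refine ⟨m + n, ?_, ?_⟩
    · rw [Finset.mem_coe, mem_freqBox] at *
      exact (norm_add_le _ _).trans (by push_cast; exact add_le_add hm hn)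
    · ext x
      simp [UnitAddTorus.mFourier_add]
  exact h (Submodule.mul_mem_mul hf hg)

lemma pow_mem_trigPoly {M : ℕ} {f : C(Torus2, ℂ)} (hf : f ∈ trigPoly M) (m : ℕ) :
    f ^ m ∈ trigPoly (m * M) := by
  induction m with
  | zero =>
    refine Submodule.subset_span ⟨0, by simp [mem_freqBox], ?_⟩
    simp [UnitAddTorus.mFourier_zero]
  | succ m ih =>
    rw [pow_succ, Nat.succ_mul]
    exact mul_mem_trigPoly ih hf

lemma exists_of_mem_trigPoly {N : ℕ} {f : C(Torus2, ℂ)} (hf : f ∈ trigPoly N) :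
    ∃ c : (Fin 2 → ℤ) → ℂ, ∀ x, f x = ∑ n ∈ freqBox N, c n * UnitAddTorus.mFourier n x := by
  obtain ⟨c, hc⟩ := Submodule.mem_span_image_finset_iff_exists_fun ℂ |>.1 hf
  refine ⟨fun n => if hn : n ∈ freqBox N then c ⟨n, hn⟩ else 0, fun x => ?_⟩
  rw [← hc, ContinuousMap.sum_apply, ← Finset.sum_coe_sort (freqBox N)]
  refine Finset.sum_congr rfl fun n _ => ?_
  simp

lemma integral_normSq_trigSum (N : ℕ) (c : (Fin 2 → ℤ) → ℂ) :
    ∫ x, ‖∑ n ∈ freqBox N, c n * UnitAddTorus.mFourier n x‖ ^ 2 ∂torusMeasure =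
      ∑ n ∈ freqBox N, ‖c n‖ ^ 2 := by
  have h : ∀ x, ((‖∑ n ∈ freqBox N, c n * UnitAddTorus.mFourier n x‖ ^ 2 : ℝ) : ℂ) =
      ∑ n ∈ freqBox N, ∑ k ∈ freqBox N,
        starRingEnd ℂ (c n) * c k * UnitAddTorus.mFourier (k - n) x := fun x => by
    rw [Complex.ofReal_pow, ← Complex.conj_mul', map_sum, Finset.sum_mul_sum]
    refine Finset.sum_congr rfl fun n _ => Finset.sum_congr rfl fun k _ => ?_
    rw [← mFourier_mul_neg, UnitAddTorus.mFourier_neg, map_mul]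
    ring
  have hi : ∀ n k, Integrable
      (fun x => starRingEnd ℂ (c n) * c k * UnitAddTorus.mFourier (k - n) x) torusMeasure :=
    fun n k => (continuous_const.mul (ContinuousMap.continuous _)).integrable_torus
  apply Complex.ofReal_injective
  rw [← integral_complex_ofReal]
  simp_rw [h]
  rw [integral_finsetSum _ fun n _ => integrable_finsetSum _ fun k _ => hi n k, Complex.ofReal_sum]
  refine Finset.sum_congr rfl fun n hn => ?_
  rw [integral_finsetSum _ fun k _ => hi n k]
  simp_rw [integral_const_mul, integral_mFourier, sub_eq_zero, mul_ite, mul_one, mul_zero]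
  rw [Finset.sum_ite_eq' _ n, if_pos hn, Complex.conj_mul', Complex.ofReal_pow]

lemma sq_norm_le_of_mem_trigPoly {N : ℕ} {f : C(Torus2, ℂ)} (hf : f ∈ trigPoly N) (x : Torus2) :
    ‖f x‖ ^ 2 ≤ (2 * N + 1) ^ 2 * ∫ y, ‖f y‖ ^ 2 ∂torusMeasure := by
  obtain ⟨c, hc⟩ := exists_of_mem_trigPoly hf
  simp_rw [hc]
  rw [integral_normSq_trigSum]
  have h1 : ‖∑ n ∈ freqBox N, c n * UnitAddTorus.mFourier n x‖ ≤ ∑ n ∈ freqBox N, ‖c n‖ :=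
    (norm_sum_le _ _).trans (le_of_eq (Finset.sum_congr rfl fun n _ => by
      rw [norm_mul, norm_mFourier_apply, mul_one]))
  refine (pow_le_pow_left₀ (norm_nonneg _) h1 2).trans ?_
  refine sq_sum_le_card_mul_sum_sq.trans (le_of_eq ?_)
  rw [card_freqBox]
  push_cast
  rfl

/-- Bernstein's inequality: the supremum of a trigonometric polynomial is controlled by its
`L^{2m}` norm. The Cauchy–Schwarz inequality is applied to the `m`-th power, which is again a
trigonometric polynomial. -/
lemma enorm_pow_le_lintegral_of_mem_trigPoly {N : ℕ} {f : C(Torus2, ℂ)} (hf : f ∈ trigPoly N)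
    (m : ℕ) (x : Torus2) :
    ‖f x‖ₑ ^ (2 * m) ≤ ENNReal.ofReal ((2 * (m * N : ℕ) + 1) ^ 2) *
      ∫⁻ y, ‖f y‖ₑ ^ (2 * m) ∂torusMeasure := by
  have h := sq_norm_le_of_mem_trigPoly (pow_mem_trigPoly hf m) x
  simp only [ContinuousMap.pow_apply, norm_pow, ← pow_mul] at h
  rw [mul_comm m 2] at h
  have he : ∀ y, ‖f y‖ₑ ^ (2 * m) = ENNReal.ofReal (‖f y‖ ^ (2 * m)) := fun y => by
    rw [← ofReal_norm, ENNReal.ofReal_pow (norm_nonneg _)]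
  simp_rw [he]
  rw [← ofReal_integral_eq_lintegral_ofReal (f := fun y => ‖f y‖ ^ (2 * m))
    (((ContinuousMap.continuous f).norm.pow _).integrable_torus)
    (Eventually.of_forall fun y => by positivity), ← ENNReal.ofReal_mul (by positivity)]
  exact ENNReal.ofReal_le_ofReal h

lemma cutoff_nonneg (r : ℝ) : 0 ≤ cutoff r := Real.smoothTransition.nonneg _

lemma cutoff_le_one (r : ℝ) : cutoff r ≤ 1 := Real.smoothTransition.le_one _

lemma cutoff_of_two_le {r : ℝ} (h : 2 ≤ r) : cutoff r = 0 :=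
  Real.smoothTransition.zero_of_nonpos (by linarith)

lemma abs_dyadic_le_one (j : ℕ) (r : ℝ) : |dyadic j r| ≤ 1 := by
  cases j with
  | zero => exact abs_le.2 ⟨by linarith [cutoff_nonneg r, show dyadic 0 r = cutoff r from rfl],
    cutoff_le_one r⟩
  | succ j =>
    have h1 := cutoff_nonneg (r / 2 ^ (j + 1))
    have h2 := cutoff_le_one (r / 2 ^ (j + 1))
    have h3 := cutoff_nonneg (r / 2 ^ j)
    have h4 := cutoff_le_one (r / 2 ^ j)
    exact abs_le.2 ⟨by simp only [dyadic]; linarith, by simp only [dyadic]; linarith⟩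

lemma dyadic_eq_zero {j : ℕ} {r : ℝ} (h : 2 ^ (j + 1) ≤ r) : dyadic j r = 0 := by
  cases j with
  | zero => exact cutoff_of_two_le (by simpa using h)
  | succ j =>
    have h1 : cutoff (r / 2 ^ (j + 1)) = 0 := by
      apply cutoff_of_two_le
      rw [le_div_iff₀ (by positivity), ← pow_succ']
      exact h
    have h2 : cutoff (r / 2 ^ j) = 0 := by
      apply cutoff_of_two_le
      rw [le_div_iff₀ (by positivity), ← pow_succ']
      exact le_trans (pow_le_pow_right₀ one_le_two (by omega)) h
    simp [dyadic, h1, h2]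

lemma norm_sq_le_freqSq (k : Fin 2 → ℤ) : ‖k‖ ^ 2 ≤ freqSq k := by
  have h0 : 0 ≤ freqSq k := Finset.sum_nonneg fun i _ => sq_nonneg _
  rw [← Real.le_sqrt (norm_nonneg _) h0, pi_norm_le_iff_of_nonneg (Real.sqrt_nonneg _)]
  intro i
  rw [Int.norm_eq_abs]
  exact Real.abs_le_sqrt (Finset.single_le_sum (f := fun i => (k i : ℝ) ^ 2)
    (fun i _ => sq_nonneg _) (Finset.mem_univ i))

lemma norm_le_sqrt_freqSq (k : Fin 2 → ℤ) : ‖k‖ ≤ Real.sqrt (freqSq k) :=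
  Real.le_sqrt_of_sq_le (norm_sq_le_freqSq k)

lemma dyadic_freq_eq_zero {j : ℕ} {k : Fin 2 → ℤ} (hk : k ∉ freqBox (2 ^ (j + 1))) :
    dyadic j (Real.sqrt (freqSq k)) = 0 := by
  rw [mem_freqBox, not_le] at hk
  push_cast at hk
  exact dyadic_eq_zero (hk.le.trans (norm_le_sqrt_freqSq k))

lemma block_eq_sum (u : TorusDistribution) (j : ℕ) (x : Torus2) :
    u.block j x = ∑ k ∈ freqBox (2 ^ (j + 1)),
      (dyadic j (Real.sqrt (freqSq k)) : ℂ) * UnitAddTorus.mFourier k x * u.coeff k := by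
  rw [TorusDistribution.block, tsum_eq_sum (s := freqBox (2 ^ (j + 1)))]
  · exact Finset.sum_congr rfl fun k _ => by ring
  · intro k hk
    rw [dyadic_freq_eq_zero hk]
    simp

lemma enorm_block_pow_le (u : TorusDistribution) (j m : ℕ) (x : Torus2) :
    ‖u.block j x‖ₑ ^ (2 * m) ≤ ENNReal.ofReal ((2 * (m * 2 ^ (j + 1) : ℕ) + 1) ^ 2) *
      ∫⁻ y, ‖u.block j y‖ₑ ^ (2 * m) ∂torusMeasure := by
  let f : C(Torus2, ℂ) := ∑ k ∈ freqBox (2 ^ (j + 1)),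
    ((dyadic j (Real.sqrt (freqSq k)) : ℂ) * u.coeff k) • UnitAddTorus.mFourier k
  have hf : f ∈ trigPoly (2 ^ (j + 1)) := Submodule.sum_mem _ fun k hk =>
    Submodule.smul_mem _ _ (Submodule.subset_span ⟨k, hk, rfl⟩)
  have h : ∀ y, u.block j y = f y := fun y => by
    rw [block_eq_sum, ContinuousMap.sum_apply]
    refine Finset.sum_congr rfl fun k _ => ?_
    simp only [ContinuousMap.smul_apply, smul_eq_mul]
    ring
  simp_rw [h]
  exact enorm_pow_le_lintegral_of_mem_trigPoly hf m x

/-- The Besov–Hölder norm is controlled by the `L^{2m}` norms of the blocks. -/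
lemma besovHolderNorm_pow_le (s : ℝ) (u : TorusDistribution) {m : ℕ} (hm : m ≠ 0) :
    besovHolderNorm s u ^ (2 * m) ≤ ∑' j : ℕ,
      ENNReal.ofReal ((2 : ℝ) ^ (((j : ℝ) - 1) * s)) ^ (2 * m) *
      (ENNReal.ofReal ((2 * (m * 2 ^ (j + 1) : ℕ) + 1) ^ 2) *
        ∫⁻ y, ‖u.block j y‖ₑ ^ (2 * m) ∂torusMeasure) := by
  have hm' : (0 : ℝ) < (2 * m : ℕ) := by positivity
  rw [← ENNReal.rpow_natCast, ← ENNReal.le_rpow_inv_iff hm', besovHolderNorm]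
  refine iSup₂_le fun j x => ?_
  rw [ENNReal.le_rpow_inv_iff hm', ENNReal.rpow_natCast, mul_pow]
  refine le_trans ?_ (ENNReal.le_tsum j)
  gcongr
  exact enorm_block_pow_le u j m x

/-! ### Moment bounds for the Besov–Hölder norm of a chaos -/

/-- The constant of the moment bound in the Besov–Hölder space of regularity `s`. -/
def besovConst (s κ : ℝ) (m : ℕ) : ℝ :=
  ∑' j : ℕ, ((2 : ℝ) ^ (((j : ℝ) - 1) * s)) ^ (2 * m) * (2 * (m * 2 ^ (j + 1) : ℕ) + 1) ^ 2 *
    (2 ^ (m + 1) * chaosConst m * (4 * (pairConst κ * ((2 ^ (j + 1) : ℕ) : ℝ) ^ (9 * κ))) ^ m)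

lemma besovConst_term_nonneg (s κ : ℝ) (m j : ℕ) :
    0 ≤ ((2 : ℝ) ^ (((j : ℝ) - 1) * s)) ^ (2 * m) * (2 * (m * 2 ^ (j + 1) : ℕ) + 1) ^ 2 *
    (2 ^ (m + 1) * chaosConst m *
      (4 * (pairConst κ * ((2 ^ (j + 1) : ℕ) : ℝ) ^ (9 * κ))) ^ m) := by
  have := chaosConst_nonneg m
  have := pairConst_nonneg κ
  positivity

lemma summable_besovConst {s κ : ℝ} {m : ℕ} (hκs : 9 * κ ≤ -s) (hm : 2 < m * -s) :
    Summable fun j : ℕ =>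
      ((2 : ℝ) ^ (((j : ℝ) - 1) * s)) ^ (2 * m) * (2 * (m * 2 ^ (j + 1) : ℕ) + 1) ^ 2 *
      (2 ^ (m + 1) * chaosConst m *
        (4 * (pairConst κ * ((2 ^ (j + 1) : ℕ) : ℝ) ^ (9 * κ))) ^ m) := by
  have hc := chaosConst_nonneg m
  have hp := pairConst_nonneg κ
  have hm1 : (1 : ℝ) ≤ m := by
    rcases Nat.eq_zero_or_pos m with rfl | h
    · norm_num at hm
    · exact_mod_cast h
  set q : ℝ := 2 ^ (2 * m * s + 2 + 9 * κ * m) with hq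
  have hq1 : q < 1 := Real.rpow_lt_one_of_one_lt_of_neg one_lt_two (by nlinarith)
  have hq0 : 0 ≤ q := by positivity
  refine Summable.of_nonneg_of_le (fun j => besovConst_term_nonneg s κ m j) (fun j => ?_)
    ((summable_geometric_of_lt_one hq0 hq1).mul_left
      (2 ^ (-(2 * m * s)) * (5 * m) ^ 2 * (2 ^ (m + 1) * chaosConst m *
        (4 * pairConst κ) ^ m) * 2 ^ (9 * κ * m)))
  have e1 : ((2 : ℝ) ^ (((j : ℝ) - 1) * s)) ^ (2 * m) = 2 ^ (-(2 * m * s)) * 2 ^ (j * (2 * m * s)) := by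
    rw [← Real.rpow_natCast, ← Real.rpow_mul zero_le_two, ← Real.rpow_add two_pos]
    congr 1; push_cast; ring
  have e2 : (((2 ^ (j + 1) : ℕ) : ℝ) ^ (9 * κ)) ^ m = 2 ^ (9 * κ * m) * 2 ^ (j * (9 * κ * m)) := by
    push_cast
    rw [← Real.rpow_natCast _ m, ← Real.rpow_natCast _ (j + 1), ← Real.rpow_mul zero_le_two,
      ← Real.rpow_mul zero_le_two, ← Real.rpow_add two_pos]
    congr 1; push_cast; ring
  have e3 : q ^ j = 2 ^ (j * (2 * m * s)) * (2 ^ j) ^ 2 * 2 ^ (j * (9 * κ * m)) := by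
    rw [hq, ← Real.rpow_natCast _ j, ← Real.rpow_mul zero_le_two, ← Real.rpow_natCast _ j,
      ← Real.rpow_natCast _ 2, ← Real.rpow_mul zero_le_two, ← Real.rpow_add two_pos,
      ← Real.rpow_add two_pos]
    congr 1; push_cast; ring
  have e4 : (2 * (m * 2 ^ (j + 1) : ℕ) + 1 : ℝ) ^ 2 ≤ (5 * m) ^ 2 * (2 ^ j) ^ 2 := by
    rw [← mul_pow]
    refine pow_le_pow_left₀ (by positivity) ?_ 2
    push_cast
    have : (1 : ℝ) ≤ m * 2 ^ j := one_le_mul_of_one_le_of_one_le hm1 (one_le_pow₀ one_le_two)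
    rw [pow_succ]
    linarith
  rw [e1, ← mul_assoc 4, mul_pow (4 * pairConst κ), e2, e3]
  calc _ ≤ 2 ^ (-(2 * m * s)) * 2 ^ (j * (2 * m * s)) * ((5 * m) ^ 2 * (2 ^ j) ^ 2) *
      (2 ^ (m + 1) * chaosConst m *
        ((4 * pairConst κ) ^ m * (2 ^ (9 * κ * m) * 2 ^ (j * (9 * κ * m))))) := by gcongr
    _ = _ := by ring

lemma measurable_wickProd {Ω : Type*} [MeasurableSpace Ω] {g : (Fin 2 → ℤ) → Ω → ℝ}
    (hg : ∀ k, Measurable (g k)) (k l : Fin 2 → ℤ) : Measurable (wickProd g k l) := by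
  unfold wickProd fourierMode
  have := hg
  fun_prop

lemma measurable_chaosCoeff {Ω : Type*} [MeasurableSpace Ω] {g : (Fin 2 → ℤ) → Ω → ℝ}
    (hg : ∀ k, Measurable (g k)) (a : (Fin 2 → ℤ) → (Fin 2 → ℤ) → ℂ) (N : ℕ) (n : Fin 2 → ℤ) :
    Measurable (chaosCoeff g a N n) := by
  unfold chaosCoeff
  refine Finset.measurable_fun_sum _ fun k _ => Finset.measurable_fun_sum _ fun l _ => ?_
  split_ifs
  · exact (measurable_wickProd hg k l).const_mul _
  · exact measurable_const

/-- If the Fourier coefficients of a random distribution are almost surely the limits of those of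
truncated quadratic fields with a kernel of size `η ‖k‖^{κ-1} ‖l‖^{κ-1}`, then the moments of its
Besov–Hölder norm of negative regularity are of order `η`. The norm, an uncountable supremum, is
not known to be measurable; the bound is therefore stated for a measurable majorant. -/
lemma IsStdGaussianFamily.exists_besovHolderNorm_le {Ω : Type*} [MeasurableSpace Ω]
    {μ : Measure Ω} [IsProbabilityMeasure μ] {g : (Fin 2 → ℤ) → Ω → ℝ}
    (hg : IsStdGaussianFamily μ g) {κ : ℝ} (hκ : 0 < κ) (hκ' : κ ≤ 1 / 10) {s : ℝ}
    (hκs : 9 * κ ≤ -s) {m : ℕ} (hm : 2 < m * -s) {a : (Fin 2 → ℤ) → (Fin 2 → ℤ) → ℂ} {η : ℝ}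
    (ha : ∀ k l, ‖a k l‖ ≤ η * (‖k‖ ^ (κ - 1) * ‖l‖ ^ (κ - 1))) (N : ℕ → ℕ)
    {u : Ω → TorusDistribution}
    (hu : ∀ᵐ ω ∂μ, ∀ n, Tendsto (fun i => chaosCoeff g a (N i) n ω) atTop (𝓝 ((u ω).coeff n))) :
    ∃ Y : Ω → ℝ≥0∞, Measurable Y ∧ (∀ᵐ ω ∂μ, besovHolderNorm s (u ω) ^ (2 * m) ≤ Y ω) ∧
      ∫⁻ ω, Y ω ∂μ ≤ ENNReal.ofReal (η ^ (2 * m) * besovConst s κ m) := by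
  have hm0 : m ≠ 0 := by
    rintro rfl
    norm_num at hm
  let V : ℕ → ℕ → Ω → Torus2 → ℝ≥0∞ := fun j i ω y =>
    ‖∑ n ∈ freqBox (2 ^ (j + 1)), ((dyadic j (Real.sqrt (freqSq n)) : ℂ) *
      UnitAddTorus.mFourier n y) * chaosCoeff g a (N i) n ω‖ₑ ^ (2 * m)
  have hVm : ∀ j i, Measurable fun p : Ω × Torus2 => V j i p.1 p.2 := fun j i => by
    refine Measurable.pow_const (Measurable.enorm (Finset.measurable_fun_sum _ fun n _ => ?_)) _
    have h1 : Measurable fun p : Ω × Torus2 => UnitAddTorus.mFourier n p.2 :=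
      (ContinuousMap.continuous _).measurable.comp measurable_snd
    have h2 : Measurable fun p : Ω × Torus2 => chaosCoeff g a (N i) n p.1 :=
      (measurable_chaosCoeff hg.measurable a (N i) n).comp measurable_fst
    exact (h1.const_mul _).mul h2
  have hLm : ∀ j, Measurable fun p : Ω × Torus2 => liminf (fun i => V j i p.1 p.2) atTop :=
    fun j => Measurable.liminf (hVm j)
  let D : ℕ → ℝ≥0∞ := fun j => ENNReal.ofReal ((2 : ℝ) ^ (((j : ℝ) - 1) * s)) ^ (2 * m)
  let K : ℕ → ℝ≥0∞ := fun j => ENNReal.ofReal ((2 * (m * 2 ^ (j + 1) : ℕ) + 1) ^ 2)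
  have hbound : ∀ j i y, ∫⁻ ω, V j i ω y ∂μ ≤ ENNReal.ofReal (2 ^ (m + 1) * chaosConst m *
      (4 * (η ^ 2 * (pairConst κ * ((2 ^ (j + 1) : ℕ) : ℝ) ^ (9 * κ)))) ^ m) := fun j i y => by
    refine hg.lintegral_sum_chaosCoeff_le hκ hκ' ha (fun n => ?_) hm0 (N i) Nat.one_le_two_pow
    rw [norm_mul, norm_mFourier_apply, mul_one, Complex.norm_real]
    exact abs_dyadic_le_one _ _
  have hae : ∀ᵐ ω ∂μ, besovHolderNorm s (u ω) ^ (2 * m) ≤ ∑' j : ℕ,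
      D j * (K j * ∫⁻ y, liminf (fun i => V j i ω y) atTop ∂torusMeasure) := by
    filter_upwards [hu] with ω hω
    refine (besovHolderNorm_pow_le s (u ω) hm0).trans (le_of_eq ?_)
    refine tsum_congr fun j => ?_
    congr 2
    refine lintegral_congr fun y => ?_
    refine (Tendsto.liminf_eq ?_).symm
    rw [block_eq_sum]
    refine ((ENNReal.continuous_pow (2 * m)).tendsto _).comp
      ((continuous_enorm.tendsto _).comp (tendsto_finsetSum _ fun n _ => ?_))
    exact (hω n).const_mul _
  refine ⟨_, Measurable.tsum fun j => ((Measurable.lintegral_prod_right' (hLm j)).const_mul _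
    |>.const_mul _), hae, ?_⟩
  rw [lintegral_tsum fun j => ((Measurable.lintegral_prod_right' (hLm j)).const_mul _
    |>.const_mul _).aemeasurable]
  rw [besovConst, ← tsum_mul_left, ENNReal.ofReal_tsum_of_nonneg
    (fun j => mul_nonneg ((even_two_mul m).pow_nonneg _) (besovConst_term_nonneg s κ m j))
    ((summable_besovConst hκs hm).mul_left _)]
  refine ENNReal.tsum_le_tsum fun j => ?_
  rw [lintegral_const_mul _ ((Measurable.lintegral_prod_right' (hLm j)).const_mul _),
    lintegral_const_mul _ (Measurable.lintegral_prod_right' (hLm j)),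
    lintegral_lintegral_swap (hLm j).aemeasurable]
  calc _ ≤ D j * (K j * ∫⁻ _y, ENNReal.ofReal (2 ^ (m + 1) * chaosConst m *
      (4 * (η ^ 2 * (pairConst κ * ((2 ^ (j + 1) : ℕ) : ℝ) ^ (9 * κ)))) ^ m) ∂torusMeasure) := by
        gcongr with y
        refine (lintegral_liminf_le fun i => (hVm j i).comp measurable_prodMk_right).trans ?_
        refine (liminf_le_liminf (Eventually.of_forall fun i => hbound j i y)).trans ?_
        simp
    _ = _ := by
        have := chaosConst_nonneg m
        have := pairConst_nonneg κ
        rw [lintegral_const, measure_univ, mul_one]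
        simp only [D, K]
        rw [← ENNReal.ofReal_pow (by positivity), ← ENNReal.ofReal_mul (by positivity),
          ← ENNReal.ofReal_mul (by positivity)]
        congr 1
        rw [show 4 * (η ^ 2 * (pairConst κ * ((2 ^ (j + 1) : ℕ) : ℝ) ^ (9 * κ))) =
          η ^ 2 * (4 * (pairConst κ * ((2 ^ (j + 1) : ℕ) : ℝ) ^ (9 * κ))) by ring,
          mul_pow (η ^ 2), ← pow_mul]
        ring

/-! ### Rapidly converging Fourier series -/

/-- The linear form `v ↦ 2π k·v`. -/
def freqForm (k : Fin 2 → ℤ) : (Fin 2 → ℝ) →L[ℝ] ℝ :=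
  ∑ i, (2 * Real.pi * k i) • ContinuousLinearMap.proj (R := ℝ) (φ := fun _ : Fin 2 => ℝ) i

lemma freqForm_apply (k : Fin 2 → ℤ) (v : Fin 2 → ℝ) :
    freqForm k v = ∑ i, 2 * Real.pi * k i * v i := by
  simp [freqForm]

lemma norm_freqForm_le (k : Fin 2 → ℤ) : ‖freqForm k‖ ≤ 4 * Real.pi * ‖k‖ := by
  refine ContinuousLinearMap.opNorm_le_bound _ (by positivity) fun v => ?_
  rw [freqForm_apply]
  refine (norm_sum_le _ _).trans ?_
  have h : ∀ i, ‖2 * Real.pi * k i * v i‖ ≤ 2 * Real.pi * ‖k‖ * ‖v‖ := fun i => by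
    rw [norm_mul, norm_mul, Real.norm_of_nonneg (by positivity : (0 : ℝ) ≤ 2 * Real.pi)]
    have h1 : ‖(k i : ℝ)‖ ≤ ‖k‖ := norm_le_pi_norm k i
    have h2 : ‖v i‖ ≤ ‖v‖ := norm_le_pi_norm v i
    gcongr
  refine (Finset.sum_le_sum fun i _ => h i).trans (le_of_eq ?_)
  simp
  ring

lemma mFourier_toTorus (k : Fin 2 → ℤ) (v : Fin 2 → ℝ) :
    UnitAddTorus.mFourier k (toTorus v) = Complex.exp (freqForm k v * Complex.I) := by
  simp only [UnitAddTorus.mFourier, toTorus, ContinuousMap.coe_mk, fourier_coe_apply,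
    freqForm_apply]
  rw [← Complex.exp_sum]
  congr 1
  push_cast
  rw [Finset.sum_mul]
  refine Finset.sum_congr rfl fun i _ => ?_
  ring

lemma iteratedDeriv_exp_mul_I (n : ℕ) : iteratedDeriv n (fun t : ℝ => Complex.exp (t * Complex.I)) =
    fun t : ℝ => Complex.I ^ n * Complex.exp (t * Complex.I) := by
  induction n with
  | zero => simp
  | succ n ih =>
    rw [iteratedDeriv_succ, ih]
    funext t
    have h : HasDerivAt (fun t : ℝ => Complex.exp (t * Complex.I))
        (Complex.exp (t * Complex.I) * (1 * Complex.I)) t :=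
      (((hasDerivAt_id t).ofReal_comp).mul_const Complex.I).cexp
    rw [(h.const_mul _).deriv, pow_succ]
    ring

lemma contDiff_exp_mul_I : ContDiff ℝ (⊤ : ℕ∞) fun t : ℝ => Complex.exp (t * Complex.I) :=
  (Complex.ofRealCLM.contDiff.mul contDiff_const).cexp

lemma norm_iteratedFDeriv_mFourier_le (k : Fin 2 → ℤ) (n : ℕ) (v : Fin 2 → ℝ) :
    ‖iteratedFDeriv ℝ n (fun w => UnitAddTorus.mFourier k (toTorus w)) v‖ ≤
      (4 * Real.pi * ‖k‖) ^ n := by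
  have h : (fun w => UnitAddTorus.mFourier k (toTorus w)) =
      (fun t : ℝ => Complex.exp (t * Complex.I)) ∘ freqForm k := funext (mFourier_toTorus k)
  rw [h, (freqForm k).iteratedFDeriv_comp_right contDiff_exp_mul_I v (i := n)
    (by exact_mod_cast le_top)]
  refine (ContinuousMultilinearMap.norm_compContinuousLinearMap_le _ _).trans ?_
  rw [norm_iteratedFDeriv_eq_norm_iteratedDeriv, iteratedDeriv_exp_mul_I, norm_mul,
    Complex.norm_exp_ofReal_mul_I, norm_pow, Complex.norm_I, one_pow, one_mul, one_mul,
    Finset.prod_const, Finset.card_univ, Fintype.card_fin]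
  exact pow_le_pow_left₀ (norm_nonneg _) (norm_freqForm_le k) n

/-- A family of Fourier coefficients decaying faster than any power of the frequency. -/
def IsRapid (c : (Fin 2 → ℤ) → ℂ) : Prop := ∀ N : ℕ, Summable fun k => (1 + ‖k‖) ^ N * ‖c k‖

/-- The symmetry of the Fourier coefficients of a real function. -/
def IsHermitianSeq (c : (Fin 2 → ℤ) → ℂ) : Prop := ∀ k, c (-k) = starRingEnd ℂ (c k)

/-- The sum of the Fourier series with coefficients `c`. -/
def fourierSum (c : (Fin 2 → ℤ) → ℂ) (x : Torus2) : ℂ := ∑' k, c k * UnitAddTorus.mFourier k x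

lemma IsRapid.summable_norm {c : (Fin 2 → ℤ) → ℂ} (hc : IsRapid c) : Summable fun k => ‖c k‖ := by
  simpa using hc 0

lemma IsRapid.of_norm_le {c d : (Fin 2 → ℤ) → ℂ} (hc : IsRapid c) {C : ℝ} {N : ℕ}
    (h : ∀ k, ‖d k‖ ≤ C * (1 + ‖k‖) ^ N * ‖c k‖) : IsRapid d := fun M => by
  refine Summable.of_nonneg_of_le (fun k => by positivity) (fun k => ?_)
    ((hc (M + N)).mul_left C)
  calc (1 + ‖k‖) ^ M * ‖d k‖ ≤ (1 + ‖k‖) ^ M * (C * (1 + ‖k‖) ^ N * ‖c k‖) := by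
        gcongr; exact h k
    _ = _ := by rw [pow_add]; ring

lemma summable_one_add_norm_pow : Summable fun k : Fin 2 → ℤ => ((1 + ‖k‖) ^ 3)⁻¹ := by
  have h : Summable fun k : Fin 2 → ℤ => ‖k‖ ^ (-3 : ℝ) := summable_norm_rpow (by norm_num)
  refine Summable.of_norm_bounded_eventually (g := fun k => ‖k‖ ^ (-3 : ℝ)) h ?_
  have h0 : ∀ᶠ k : Fin 2 → ℤ in cofinite, k ≠ 0 := by
    rw [eventually_cofinite]
    simp
  filter_upwards [h0] with k hk
  have hk1 := one_le_norm_of_ne_zero hk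
  rw [Real.rpow_neg (norm_nonneg _), norm_inv]
  apply inv_anti₀ (by positivity)
  rw [norm_pow, Real.norm_of_nonneg (by positivity)]
  rw [show (3 : ℝ) = (3 : ℕ) by norm_num, Real.rpow_natCast]
  gcongr
  linarith

lemma IsRapid.of_decay {c : (Fin 2 → ℤ) → ℂ}
    (h : ∀ N : ℕ, ∃ C : ℝ, ∀ k, (1 + ‖k‖) ^ N * ‖c k‖ ≤ C) : IsRapid c := fun N => by
  obtain ⟨C, hC⟩ := h (N + 3)
  refine Summable.of_nonneg_of_le (fun k => by positivity) (fun k => ?_)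
    (summable_one_add_norm_pow.mul_left C)
  rw [← div_eq_mul_inv, le_div_iff₀ (by positivity)]
  refine le_trans (le_of_eq ?_) (hC k)
  rw [pow_add]
  ring

lemma four_pi_norm_pow_le (k : Fin 2 → ℤ) {n N : ℕ} (hn : n ≤ N) :
    (4 * Real.pi * ‖k‖) ^ n ≤ (4 * Real.pi) ^ N * (1 + ‖k‖) ^ N := by
  have hpi := Real.pi_gt_three
  rw [← mul_pow]
  calc (4 * Real.pi * ‖k‖) ^ n ≤ (4 * Real.pi * (1 + ‖k‖)) ^ n := by gcongr; linarith
    _ ≤ _ := pow_le_pow_right₀ (by nlinarith [norm_nonneg k]) hn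

lemma hasSum_fourierSum {c : (Fin 2 → ℤ) → ℂ} (hc : Summable fun k => ‖c k‖) (x : Torus2) :
    HasSum (fun k => c k * UnitAddTorus.mFourier k x) (fourierSum c x) := by
  refine (Summable.of_norm ?_).hasSum
  simpa only [norm_mul, norm_mFourier_apply, mul_one] using hc

section Derivatives

variable {c : (Fin 2 → ℤ) → ℂ}

lemma contDiff_fourierTerm (c : (Fin 2 → ℤ) → ℂ) (k : Fin 2 → ℤ) : ContDiff ℝ (⊤ : ℕ∞)
    fun v => c k * UnitAddTorus.mFourier k (toTorus v) :=
  contDiff_const.mul (contDiff_mFourier k)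

lemma norm_iteratedFDeriv_fourierTerm_le (c : (Fin 2 → ℤ) → ℂ) (n : ℕ) (k : Fin 2 → ℤ)
    (v : Fin 2 → ℝ) :
    ‖iteratedFDeriv ℝ n (fun w => c k * UnitAddTorus.mFourier k (toTorus w)) v‖ ≤
      (4 * Real.pi * ‖k‖) ^ n * ‖c k‖ := by
  have h := iteratedFDeriv_const_smul_apply (a := c k) (i := n) (x := v)
    ((contDiff_mFourier k).contDiffAt.of_le (by exact_mod_cast le_top))
  have h2 : (fun w => c k * UnitAddTorus.mFourier k (toTorus w)) =
    c k • fun w => UnitAddTorus.mFourier k (toTorus w) := rfl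
  rw [h2, h, norm_smul, mul_comm]
  gcongr
  exact norm_iteratedFDeriv_mFourier_le k n v

lemma IsRapid.summable_pow_mul (hc : IsRapid c) (n : ℕ) :
    Summable fun k => (4 * Real.pi * ‖k‖) ^ n * ‖c k‖ := by
  refine Summable.of_nonneg_of_le (fun k => by positivity) (fun k => ?_)
    ((hc n).mul_left ((4 * Real.pi) ^ n))
  rw [← mul_assoc]
  gcongr
  exact four_pi_norm_pow_le k le_rfl

lemma IsRapid.contDiff_fourierSum (hc : IsRapid c) :
    ContDiff ℝ (⊤ : ℕ∞) fun v => fourierSum c (toTorus v) :=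
  contDiff_tsum (v := fun n k => (4 * Real.pi * ‖k‖) ^ n * ‖c k‖) (contDiff_fourierTerm c)
    (fun n _ => hc.summable_pow_mul n)
    fun n k v _ => norm_iteratedFDeriv_fourierTerm_le c n k v

lemma IsRapid.norm_iteratedFDeriv_fourierSum_le (hc : IsRapid c) (n : ℕ) (v : Fin 2 → ℝ) :
    ‖iteratedFDeriv ℝ n (fun v => fourierSum c (toTorus v)) v‖ ≤
      ∑' k, (4 * Real.pi * ‖k‖) ^ n * ‖c k‖ := by
  have h := iteratedFDeriv_tsum_apply (N := (⊤ : ℕ∞))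
    (v := fun n k => (4 * Real.pi * ‖k‖) ^ n * ‖c k‖) (contDiff_fourierTerm c)
    (fun n _ => hc.summable_pow_mul n)
    (fun n k v _ => norm_iteratedFDeriv_fourierTerm_le c n k v) (k := n) le_top v
  have h2 : (fun v => fourierSum c (toTorus v)) =
    fun v => ∑' k, c k * UnitAddTorus.mFourier k (toTorus v) := rfl
  rw [h2, h]
  exact tsum_of_norm_bounded (hc.summable_pow_mul n).hasSum fun k =>
    norm_iteratedFDeriv_fourierTerm_le c n k v

lemma IsRapid.isSmooth_re (hc : IsRapid c) : IsSmooth fun x => (fourierSum c x).re :=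
  Complex.reCLM.contDiff.comp hc.contDiff_fourierSum

lemma IsRapid.norm_iteratedFDeriv_re_fourierSum_le (hc : IsRapid c) (n : ℕ) (v : Fin 2 → ℝ) :
    ‖iteratedFDeriv ℝ n (fun v => (fourierSum c (toTorus v)).re) v‖ ≤
      ∑' k, (4 * Real.pi * ‖k‖) ^ n * ‖c k‖ := by
  refine (Complex.reCLM.norm_iteratedFDeriv_comp_left (N := (⊤ : ℕ∞))
    (hc.contDiff_fourierSum.contDiffAt) (by exact_mod_cast le_top)).trans ?_
  rw [Complex.reCLM_norm, one_mul]
  exact hc.norm_iteratedFDeriv_fourierSum_le n v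

lemma toTorus_add (v w : Fin 2 → ℝ) : toTorus (v + w) = toTorus v + toTorus w := by
  funext i
  simp [toTorus]

lemma mFourier_add_apply (k : Fin 2 → ℤ) (x y : Torus2) :
    UnitAddTorus.mFourier k (x + y) = UnitAddTorus.mFourier k x * UnitAddTorus.mFourier k y := by
  simp only [UnitAddTorus.mFourier, ContinuousMap.coe_mk, Pi.add_apply, fourier_apply, smul_add,
    AddCircle.toCircle_add, Circle.coe_mul, Finset.prod_mul_distrib]

lemma mFourier_neg_apply (k : Fin 2 → ℤ) (x : Torus2) :
    UnitAddTorus.mFourier k (-x) = UnitAddTorus.mFourier (-k) x := by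
  simp [UnitAddTorus.mFourier]

lemma mFourier_single_real (k : Fin 2 → ℤ) (i : Fin 2) (s : ℝ) :
    UnitAddTorus.mFourier k (toTorus (Pi.single i s)) =
      Complex.exp (s * (2 * Real.pi * Complex.I * k i)) := by
  rw [mFourier_toTorus, freqForm_apply, Finset.sum_eq_single i
    (fun j _ hj => by simp [Pi.single_eq_of_ne hj]) (by simp)]
  congr 1
  push_cast
  rw [Pi.single_eq_same]
  ring

lemma hasDerivAt_mFourier_single (k : Fin 2 → ℤ) (i : Fin 2) (s : ℝ) :
    HasDerivAt (fun s : ℝ => UnitAddTorus.mFourier k (toTorus (Pi.single i s)))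
      (2 * Real.pi * Complex.I * k i * UnitAddTorus.mFourier k (toTorus (Pi.single i s))) s := by
  simp_rw [mFourier_single_real]
  have := ((hasDerivAt_id s).ofReal_comp.mul_const (2 * Real.pi * Complex.I * k i)).cexp
  convert! this using 1
  simp
  ring

lemma norm_two_pi_I_mul_le (k : Fin 2 → ℤ) (i : Fin 2) :
    ‖(2 * Real.pi * Complex.I * k i : ℂ)‖ ≤ 2 * Real.pi * ‖k‖ := by
  have h1 : ‖(k i : ℂ)‖ ≤ ‖k‖ := by
    rw [Complex.norm_intCast, ← Int.norm_eq_abs]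
    exact norm_le_pi_norm k i
  rw [norm_mul, norm_mul, norm_mul, Complex.norm_I, Complex.norm_real,
    Real.norm_of_nonneg Real.pi_pos.le, Complex.norm_ofNat, mul_one]
  gcongr

lemma IsRapid.mul_deriv (hc : IsRapid c) (i : Fin 2) :
    IsRapid fun k => 2 * Real.pi * Complex.I * k i * c k :=
  hc.of_norm_le (C := 2 * Real.pi) (N := 1) fun k => by
    rw [norm_mul, pow_one]
    have := norm_two_pi_I_mul_le k i
    have hpi := Real.pi_pos
    gcongr
    linarith

lemma IsRapid.partialDeriv_fourierSum (hc : IsRapid c) (i : Fin 2) (x : Torus2) :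
    partialDeriv i (fun x => (fourierSum c x).re) x =
      (fourierSum (fun k => 2 * Real.pi * Complex.I * k i * c k) x).re := by
  have hterm : ∀ (k : Fin 2 → ℤ) (s : ℝ), HasDerivAt
      (fun s : ℝ => c k * UnitAddTorus.mFourier k (x + toTorus (Pi.single i s)))
      (2 * Real.pi * Complex.I * k i * c k *
        UnitAddTorus.mFourier k (x + toTorus (Pi.single i s))) s := fun k s => by
    simp_rw [mFourier_add_apply]
    convert! ((hasDerivAt_mFourier_single k i s).const_mul (UnitAddTorus.mFourier k x)).const_mul
      (c k) using 1
    ring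
  have hd := hasDerivAt_tsum (u := fun k => ‖2 * Real.pi * Complex.I * k i * c k‖)
    (hc.mul_deriv i).summable_norm hterm
    (fun k s => by rw [norm_mul, norm_mFourier_apply, mul_one]) (y₀ := 0)
    (hasSum_fourierSum hc.summable_norm _).summable 0
  have hr : HasDerivAt (fun s : ℝ => (fourierSum c (x + toTorus (Pi.single i s))).re) _ 0 :=
    Complex.reCLM.hasFDerivAt.comp_hasDerivAt (0 : ℝ) hd
  rw [partialDeriv, hr.deriv]
  have h0 : x + toTorus (Pi.single i (0 : ℝ)) = x := by
    funext j
    simp [toTorus]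
  rw [h0]
  rfl

end Derivatives

/-! ### Fourier coefficients of smooth functions -/

lemma IsHermitianSeq.fourierSum_re {c : (Fin 2 → ℤ) → ℂ} (hc : IsHermitianSeq c) (x : Torus2) :
    ((fourierSum c x).re : ℂ) = fourierSum c x := by
  rw [← Complex.conj_eq_iff_re, fourierSum, Complex.conj_tsum]
  rw [← (Equiv.neg (Fin 2 → ℤ)).tsum_eq]
  refine tsum_congr fun k => ?_
  rw [Equiv.neg_apply, map_mul, ← UnitAddTorus.mFourier_neg, neg_neg, hc k, Complex.conj_conj]

lemma mFourierCoeff_fourierSum {c : (Fin 2 → ℤ) → ℂ} (hc : Summable fun k => ‖c k‖)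
    (n : Fin 2 → ℤ) : UnitAddTorus.mFourierCoeff (fourierSum c) n = c n := by
  have h : ∀ k, Integrable (fun x => UnitAddTorus.mFourier (-n) x *
      (c k * UnitAddTorus.mFourier k x)) torusMeasure := fun k =>
    Continuous.integrable_torus (by fun_prop)
  have hs := hasSum_integral_of_summable_integral_norm h (by
    simpa only [norm_mul, norm_mFourier_apply, mul_one, one_mul, integral_const, probReal_univ,
      one_smul, smul_eq_mul] using hc)
  have h1 : ∀ k, ∫ x, UnitAddTorus.mFourier (-n) x * (c k * UnitAddTorus.mFourier k x)
      ∂torusMeasure = if k = n then c k else 0 := fun k => by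
    have : ∀ x, UnitAddTorus.mFourier (-n) x * (c k * UnitAddTorus.mFourier k x) =
        c k * UnitAddTorus.mFourier (k - n) x := fun x => by
      rw [← mFourier_mul_neg]; ring
    simp_rw [this]
    rw [integral_const_mul, integral_mFourier]
    simp [sub_eq_zero]
  simp_rw [h1] at hs
  have h2 := hs.unique (hasSum_ite_eq n (c n) |>.congr_fun fun k => by split_ifs with h <;> simp [h])
  rw [mFourierCoeff_eq, ← h2]
  refine integral_congr_ae (Eventually.of_forall fun x => ?_)
  simp only [fourierSum]
  rw [tsum_mul_left]

/-- The Fourier coefficients of a real function. -/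
def realCoeff (f : Torus2 → ℝ) (k : Fin 2 → ℤ) : ℂ :=
  UnitAddTorus.mFourierCoeff (fun y => (f y : ℂ)) k

lemma isHermitianSeq_realCoeff (f : Torus2 → ℝ) : IsHermitianSeq (realCoeff f) := fun k => by
  simp only [realCoeff, mFourierCoeff_eq]
  rw [← integral_conj]
  refine integral_congr_ae (Eventually.of_forall fun x => ?_)
  simp [UnitAddTorus.mFourier_neg]

lemma hasDerivAt_add_single (v : Fin 2 → ℝ) (i : Fin 2) (s : ℝ) :
    HasDerivAt (fun s : ℝ => v + Pi.single i s) (Pi.single i (1 : ℝ)) s := by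
  have h1 := ((hasDerivAt_id s).smul_const (Pi.single i (1 : ℝ) : Fin 2 → ℝ)).const_add v
  convert! h1 using 1
  · funext s
    rw [id, ← Pi.single_smul]
    simp
  · simp

lemma partialDeriv_toTorus {f : Torus2 → ℝ} (hf : IsSmooth f) (i : Fin 2) (v : Fin 2 → ℝ) :
    partialDeriv i f (toTorus v) =
      fderiv ℝ (fun w => f (toTorus w)) v (Pi.single i 1) := by
  have hd : HasFDerivAt (fun w => f (toTorus w)) (fderiv ℝ (fun w => f (toTorus w)) v) v :=
    (ContDiff.differentiable hf (by simp)).differentiableAt.hasFDerivAt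
  have h0 : v + Pi.single i (0 : ℝ) = v := by simp
  have h2 := HasFDerivAt.comp_hasDerivAt (0 : ℝ) (by rw [h0]; exact hd) (hasDerivAt_add_single v i 0)
  rw [partialDeriv, ← h2.deriv]
  congr 1

lemma IsSmooth.partialDeriv {f : Torus2 → ℝ} (hf : IsSmooth f) (i : Fin 2) :
    IsSmooth (partialDeriv i f) := by
  unfold IsSmooth
  simp_rw [partialDeriv_toTorus hf]
  exact (ContDiff.fderiv_right (m := (⊤ : ℕ∞)) hf (by simp)).clm_apply contDiff_const

lemma IsSmooth.iterate_partialDeriv {f : Torus2 → ℝ} (hf : IsSmooth f) (i : Fin 2) (n : ℕ) :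
    IsSmooth ((_root_.partialDeriv i)^[n] f) := by
  induction n with
  | zero => exact hf
  | succ n ih =>
    rw [Function.iterate_succ_apply']
    exact ih.partialDeriv i

lemma iterate_partialDeriv_toTorus {f : Torus2 → ℝ} (hf : IsSmooth f) (i : Fin 2) (n : ℕ)
    (v : Fin 2 → ℝ) : (partialDeriv i)^[n] f (toTorus v) =
      iteratedFDeriv ℝ n (fun w => f (toTorus w)) v fun _ => Pi.single i 1 := by
  induction n generalizing v with
  | zero => simp
  | succ n ih =>
    rw [Function.iterate_succ_apply', partialDeriv_toTorus (hf.iterate_partialDeriv i n),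
      iteratedFDeriv_succ_apply_left]
    simp_rw [ih]
    have hd : DifferentiableAt ℝ (iteratedFDeriv ℝ n fun w => f (toTorus w)) v :=
      (ContDiff.differentiable_iteratedFDeriv (n := (⊤ : ℕ∞))
        (by exact_mod_cast ENat.natCast_lt_top n) hf).differentiableAt
    rw [fderiv_continuousMultilinear_apply_const_apply hd]
    rfl

lemma abs_iterate_partialDeriv_le {f : Torus2 → ℝ} (hf : IsSmooth f) (i : Fin 2) (n : ℕ) {M : ℝ}
    (hM : ∀ v, ‖iteratedFDeriv ℝ n (fun w => f (toTorus w)) v‖ ≤ M) (x : Torus2) :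
    |(partialDeriv i)^[n] f x| ≤ M := by
  obtain ⟨v, rfl⟩ := toTorus_isOpenQuotientMap.surjective x
  rw [iterate_partialDeriv_toTorus hf, ← Real.norm_eq_abs]
  refine (ContinuousMultilinearMap.le_opNorm _ _).trans ?_
  simpa [Pi.norm_single] using hM v

lemma hasDerivAt_translate {f : Torus2 → ℝ} (hf : IsSmooth f) (i : Fin 2) (x : Torus2) (s : ℝ) :
    HasDerivAt (fun s : ℝ => f (x + toTorus (Pi.single i s)))
      (partialDeriv i f (x + toTorus (Pi.single i s))) s := by
  obtain ⟨v, rfl⟩ := toTorus_isOpenQuotientMap.surjective x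
  simp_rw [← toTorus_add]
  rw [partialDeriv_toTorus hf]
  exact (ContDiff.differentiable hf (by simp)).differentiableAt.hasFDerivAt.comp_hasDerivAt s
    (hasDerivAt_add_single v i s)

/-- Differentiation multiplies the Fourier coefficients by `2πi k_i`: the identity
`∫ f(x + s e_i) e^{-2πi k·x} dx = e^{2πi k_i s} f̂(k)` is differentiated at `s = 0`. -/
lemma realCoeff_partialDeriv {f : Torus2 → ℝ} (hf : IsSmooth f) (i : Fin 2) (k : Fin 2 → ℤ) :
    realCoeff (partialDeriv i f) k = 2 * Real.pi * Complex.I * k i * realCoeff f k := by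
  have hc := hf.continuous
  have hc' := (hf.partialDeriv i).continuous
  obtain ⟨B, hB⟩ := (isCompact_univ (X := Torus2)).exists_bound_of_continuousOn hc'.continuousOn
  let F : ℝ → Torus2 → ℂ := fun s x =>
    UnitAddTorus.mFourier (-k) x * (f (x + toTorus (Pi.single i s)) : ℂ)
  let F' : ℝ → Torus2 → ℂ := fun s x =>
    UnitAddTorus.mFourier (-k) x * (partialDeriv i f (x + toTorus (Pi.single i s)) : ℂ)
  have hFc : ∀ s, Continuous (F s) := fun s => by
    have : Continuous fun x => f (x + toTorus (Pi.single i s)) := by fun_prop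
    fun_prop
  have hF'c : ∀ s, Continuous (F' s) := fun s => by
    have : Continuous fun x => partialDeriv i f (x + toTorus (Pi.single i s)) := by fun_prop
    fun_prop
  have hd := (hasDerivAt_integral_of_dominated_loc_of_deriv_le (μ := torusMeasure) (F := F)
    (F' := F') (x₀ := (0 : ℝ)) (s := Set.univ) (bound := fun _ => B) univ_mem
    (Eventually.of_forall fun s => (hFc s).aestronglyMeasurable) (hFc 0).integrable_torus
    (hF'c 0).aestronglyMeasurable
    (Eventually.of_forall fun x s _ => by
      simp only [F']
      rw [norm_mul, norm_mFourier_apply, one_mul, Complex.norm_real]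
      exact hB _ (Set.mem_univ _))
    (integrable_const _)
    (Eventually.of_forall fun x s _ =>
      (hasDerivAt_translate hf i x s).ofReal_comp.const_mul _)).2
  have hFs : ∀ s, ∫ x, F s x ∂torusMeasure =
      UnitAddTorus.mFourier k (toTorus (Pi.single i s)) * realCoeff f k := fun s => by
    rw [realCoeff, mFourierCoeff_eq, ← integral_const_mul,
      ← integral_add_right_eq_self (fun x => UnitAddTorus.mFourier k (toTorus (Pi.single i s)) *
        (UnitAddTorus.mFourier (-k) x * (f x : ℂ))) (toTorus (Pi.single i s))]
    refine integral_congr_ae (Eventually.of_forall fun x => ?_)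
    simp only [F]
    rw [mFourier_add_apply, UnitAddTorus.mFourier_neg (n := k) (x := toTorus _)]
    have h1 : UnitAddTorus.mFourier k (toTorus (Pi.single i s)) *
        starRingEnd ℂ (UnitAddTorus.mFourier k (toTorus (Pi.single i s))) = 1 := by
      rw [Complex.mul_conj', norm_mFourier_apply]; simp
    linear_combination (-(UnitAddTorus.mFourier (-k) x) *
      (f (x + toTorus (Pi.single i s)) : ℂ)) * h1
  simp_rw [hFs] at hd
  have hd2 := (hasDerivAt_mFourier_single k i 0).mul_const (realCoeff f k)
  have h0 : toTorus (Pi.single i (0 : ℝ)) = 0 := by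
    funext j
    simp [toTorus]
  have h3 := hd.unique hd2
  simp only [F', h0, add_zero] at h3
  rw [realCoeff, mFourierCoeff_eq, h3]
  simp [UnitAddTorus.mFourier]

lemma realCoeff_iterate_partialDeriv {f : Torus2 → ℝ} (hf : IsSmooth f) (i : Fin 2)
    (k : Fin 2 → ℤ) (n : ℕ) : realCoeff ((partialDeriv i)^[n] f) k =
      (2 * Real.pi * Complex.I * k i) ^ n * realCoeff f k := by
  induction n with
  | zero => simp
  | succ n ih =>
    rw [Function.iterate_succ_apply', realCoeff_partialDeriv (hf.iterate_partialDeriv i n), ih,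
      pow_succ]
    ring

lemma norm_realCoeff_le {f : Torus2 → ℝ} {M : ℝ} (hM : ∀ x, |f x| ≤ M) (k : Fin 2 → ℤ) :
    ‖realCoeff f k‖ ≤ M := by
  rw [realCoeff, mFourierCoeff_eq]
  refine (norm_integral_le_of_norm_le_const (C := M) (Eventually.of_forall fun x => ?_)).trans
    (by simp)
  rw [norm_mul, norm_mFourier_apply, one_mul, Complex.norm_real]
  exact hM x

lemma norm_pow_mul_norm_realCoeff_le {f : Torus2 → ℝ} (hf : IsSmooth f) {n : ℕ} {M : ℝ}
    (hM : ∀ i x, |(partialDeriv i)^[n] f x| ≤ M) (k : Fin 2 → ℤ) :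
    ‖k‖ ^ n * ‖realCoeff f k‖ ≤ M := by
  obtain ⟨i, hi⟩ : ∃ i, ‖k i‖ = ‖k‖ := by
    obtain ⟨i, hi⟩ := Finite.exists_max fun i => ‖k i‖
    exact ⟨i, le_antisymm (norm_le_pi_norm k i)
      ((pi_norm_le_iff_of_nonneg (norm_nonneg _)).2 hi)⟩
  have h := norm_realCoeff_le (hM i) k
  rw [realCoeff_iterate_partialDeriv hf, norm_mul, norm_pow] at h
  refine le_trans ?_ h
  gcongr
  rw [norm_mul, norm_mul, norm_mul, Complex.norm_I, Complex.norm_real,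
    Real.norm_of_nonneg Real.pi_pos.le, Complex.norm_ofNat, mul_one, Complex.norm_intCast,
    ← Int.norm_eq_abs, hi]
  nlinarith [Real.pi_gt_three, norm_nonneg k]

lemma one_add_pow_le {x : ℝ} (hx : 0 ≤ x) (n : ℕ) : (1 + x) ^ n ≤ 2 ^ n * (1 + x ^ n) := by
  refine (add_pow_le zero_le_one hx n).trans ?_
  rw [one_pow]
  gcongr
  · norm_num
  · omega

/-- Quantitative decay of the Fourier coefficients of a smooth function. -/
lemma one_add_norm_pow_mul_norm_realCoeff_le {f : Torus2 → ℝ} (hf : IsSmooth f) (N : ℕ) {M : ℝ}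
    (hM : ∀ n ≤ N, ∀ v, ‖iteratedFDeriv ℝ n (fun w => f (toTorus w)) v‖ ≤ M) (k : Fin 2 → ℤ) :
    (1 + ‖k‖) ^ N * ‖realCoeff f k‖ ≤ 2 ^ N * (2 * M) := by
  have h0 : ‖realCoeff f k‖ ≤ M := norm_realCoeff_le (fun x =>
    abs_iterate_partialDeriv_le hf 0 0 (hM 0 (Nat.zero_le _)) x) k
  have h1 := norm_pow_mul_norm_realCoeff_le hf
    (fun i x => abs_iterate_partialDeriv_le hf i N (hM N le_rfl) x) k
  have h2 := mul_le_mul_of_nonneg_right (one_add_pow_le (norm_nonneg k) N)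
    (norm_nonneg (realCoeff f k))
  have h3 : (1 + ‖k‖ ^ N) * ‖realCoeff f k‖ ≤ 2 * M := by linarith
  refine h2.trans ?_
  rw [mul_assoc]
  gcongr

lemma IsSmooth.isRapid {f : Torus2 → ℝ} (hf : IsSmooth f) : IsRapid (realCoeff f) := by
  refine IsRapid.of_decay fun N => ?_
  have hb : ∀ n : ℕ, ∃ B : ℝ, ∀ i x, |(_root_.partialDeriv i)^[n] f x| ≤ B := fun n => by
    have h : ∀ i, ∃ B : ℝ, ∀ x, |(_root_.partialDeriv i)^[n] f x| ≤ B := fun i => by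
      obtain ⟨B, hB⟩ := (isCompact_univ (X := Torus2)).exists_bound_of_continuousOn
        (hf.iterate_partialDeriv i n).continuous.continuousOn
      exact ⟨B, fun x => hB x (Set.mem_univ x)⟩
    choose B hB using h
    exact ⟨max (B 0) (B 1), fun i x => by
      fin_cases i
      · exact (hB 0 x).trans (le_max_left _ _)
      · exact (hB 1 x).trans (le_max_right _ _)⟩
  obtain ⟨B₀, h₀⟩ := hb 0
  obtain ⟨B, hB⟩ := hb N
  refine ⟨2 ^ N * (B₀ + B), fun k => ?_⟩
  have h2 := mul_le_mul_of_nonneg_right (one_add_pow_le (norm_nonneg k) N)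
    (norm_nonneg (realCoeff f k))
  refine h2.trans ?_
  rw [mul_assoc]
  gcongr
  have h3 := norm_pow_mul_norm_realCoeff_le hf hB k
  have h4 := norm_realCoeff_le (h₀ 0) k
  simp only [Function.iterate_zero, id] at h4
  linarith

lemma IsSmooth.eq_fourierSum {f : Torus2 → ℝ} (hf : IsSmooth f) (x : Torus2) :
    (f x : ℂ) = fourierSum (realCoeff f) x := by
  have hc : Continuous fun y => (f y : ℂ) := Complex.continuous_ofReal.comp hf.continuous
  have h := UnitAddTorus.hasSum_mFourier_series_apply_of_summable
    (f := ⟨fun y => (f y : ℂ), hc⟩) (Summable.of_norm hf.isRapid.summable_norm) x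
  exact h.unique (hasSum_fourierSum hf.isRapid.summable_norm x)

/-! ### Fourier series of distributions -/

lemma IsHermitianSeq.mul {c d : (Fin 2 → ℤ) → ℂ} (hc : IsHermitianSeq c) (hd : IsHermitianSeq d) :
    IsHermitianSeq fun k => c k * d k := fun k => by
  simp only [map_mul, hc k, hd k]

lemma cosMode_neg (k : Fin 2 → ℤ) : cosMode (-k) = cosMode k :=
  Subtype.ext <| funext fun x => by simp [cosMode, UnitAddTorus.mFourier_neg]

lemma sinMode_neg (k : Fin 2 → ℤ) : sinMode (-k) = -sinMode k :=
  Subtype.ext <| funext fun x => by simp [sinMode, UnitAddTorus.mFourier_neg]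

lemma isHermitianSeq_coeff (u : TorusDistribution) : IsHermitianSeq u.coeff := fun k => by
  simp [TorusDistribution.coeff, TorusDistribution.pair, cosMode_neg, sinMode_neg]

lemma norm_iteratedFDeriv_cosMode_le (k : Fin 2 → ℤ) {n N : ℕ} (hn : n ≤ N) (v : Fin 2 → ℝ) :
    ‖iteratedFDeriv ℝ n (fun w => (cosMode k).1 (toTorus w)) v‖ ≤
      (4 * Real.pi) ^ N * (1 + ‖k‖) ^ N := by
  refine (Complex.reCLM.norm_iteratedFDeriv_comp_left (N := (⊤ : ℕ∞))
    (contDiff_mFourier k).contDiffAt (by exact_mod_cast le_top)).trans ?_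
  rw [Complex.reCLM_norm, one_mul]
  exact (norm_iteratedFDeriv_mFourier_le k n v).trans (four_pi_norm_pow_le k hn)

lemma norm_iteratedFDeriv_sinMode_le (k : Fin 2 → ℤ) {n N : ℕ} (hn : n ≤ N) (v : Fin 2 → ℝ) :
    ‖iteratedFDeriv ℝ n (fun w => (sinMode k).1 (toTorus w)) v‖ ≤
      (4 * Real.pi) ^ N * (1 + ‖k‖) ^ N := by
  refine (Complex.imCLM.norm_iteratedFDeriv_comp_left (N := (⊤ : ℕ∞))
    (contDiff_mFourier k).contDiffAt (by exact_mod_cast le_top)).trans ?_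
  rw [Complex.imCLM_norm, one_mul]
  exact (norm_iteratedFDeriv_mFourier_le k n v).trans (four_pi_norm_pow_le k hn)

/-- The Fourier coefficients of a distribution grow at most polynomially. -/
lemma exists_norm_coeff_le (u : TorusDistribution) :
    ∃ (C : ℝ) (N : ℕ), ∀ k, ‖u.coeff k‖ ≤ C * (1 + ‖k‖) ^ N := by
  obtain ⟨C, N, hC⟩ := u.2
  refine ⟨2 * (C * (4 * Real.pi) ^ N), N, fun k => ?_⟩
  have h1 := hC (cosMode k) _ fun n hn v => norm_iteratedFDeriv_cosMode_le k hn v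
  have h2 := hC (sinMode k) _ fun n hn v => norm_iteratedFDeriv_sinMode_le k hn v
  refine (norm_sub_le _ _).trans ?_
  rw [norm_mul, Complex.norm_I, one_mul, Complex.norm_real, Complex.norm_real]
  simp only [TorusDistribution.pair, Real.norm_eq_abs]
  linarith

lemma IsRapid.mul_coeff {c : (Fin 2 → ℤ) → ℂ} (hc : IsRapid c) (u : TorusDistribution) :
    IsRapid fun k => c k * u.coeff k := by
  obtain ⟨C, N, hC⟩ := exists_norm_coeff_le u
  refine hc.of_norm_le (C := C) (N := N) fun k => ?_
  rw [norm_mul, mul_comm]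
  gcongr
  exact hC k

lemma hasSum_ite_mem {κ E : Type*} [DecidableEq κ] [AddCommMonoid E] [TopologicalSpace E]
    (S : Finset κ) (f : κ → E) :
    HasSum (fun k => if k ∈ S then f k else 0) (∑ k ∈ S, f k) := by
  have h := hasSum_sum_of_ne_finset_zero (L := .unconditional κ)
    (f := fun k => if k ∈ S then f k else 0) (s := S) fun k hk => if_neg hk
  rwa [Finset.sum_congr rfl fun k hk => if_pos hk] at h

/-- Parseval's identity for the pairing of a distribution with a test function, whose Fourier
series converges in every `C^N` norm. -/
lemma hasSum_pair (u : TorusDistribution) (h : TestFunctions) :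
    HasSum (fun k => (realCoeff h.1 k * starRingEnd ℂ (u.coeff k)).re) (u.pair h) := by
  obtain ⟨C, N, hC⟩ := u.2
  set c := realCoeff h.1 with hcdef
  have hs : IsSmooth h.1 := h.2
  have hc : IsRapid c := hs.isRapid
  let hS : Finset (Fin 2 → ℤ) → TestFunctions := fun S =>
    ∑ k ∈ S, ((c k).re • cosMode k - (c k).im • sinMode k)
  have hpair : ∀ S, ∑ k ∈ S, (c k * starRingEnd ℂ (u.coeff k)).re = u.pair (hS S) := fun S => by
    simp only [hS, TorusDistribution.pair, map_sum, map_sub, map_smul, smul_eq_mul]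
    refine Finset.sum_congr rfl fun k _ => ?_
    simp [TorusDistribution.coeff, TorusDistribution.pair]
  let cS : Finset (Fin 2 → ℤ) → (Fin 2 → ℤ) → ℂ := fun S k => if k ∈ S then 0 else c k
  have hcS : ∀ S, IsRapid (cS S) := fun S =>
    hc.of_norm_le (C := 1) (N := 0) fun k => by
      simp only [cS]
      split_ifs <;> simp
  have hval : ∀ S x, (h - hS S).1 x = (fourierSum (cS S) x).re := fun S x => by
    have h1 : fourierSum (cS S) x =
        fourierSum c x - ∑ k ∈ S, c k * UnitAddTorus.mFourier k x := by
      have e1 := hasSum_fourierSum hc.summable_norm x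
      have e2 : HasSum (fun k => if k ∈ S then c k * UnitAddTorus.mFourier k x else 0)
          (∑ k ∈ S, c k * UnitAddTorus.mFourier k x) :=
        hasSum_ite_mem S fun k => c k * UnitAddTorus.mFourier k x
      have e3 := (hasSum_fourierSum (hcS S).summable_norm x).unique
        ((e1.sub e2).congr_fun fun k => by simp only [cS]; split_ifs <;> simp)
      exact e3
    rw [h1, ← hs.eq_fourierSum x]
    have h2 : (hS S).1 x = (∑ k ∈ S, c k * UnitAddTorus.mFourier k x).re := by
      simp only [hS, Submodule.coe_sum, Finset.sum_apply, Complex.re_sum]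
      refine Finset.sum_congr rfl fun k _ => ?_
      simp [cosMode, sinMode]
    rw [Complex.sub_re, ← h2]
    rfl
  let w : (Fin 2 → ℤ) → ℝ := fun k => (4 * Real.pi) ^ N * ((1 + ‖k‖) ^ N * ‖c k‖)
  have hw : Summable w := (hc N).mul_left _
  have hbound : ∀ S, |u.pair h - u.pair (hS S)| ≤ C * (∑' k, w k - ∑ k ∈ S, w k) := fun S => by
    have e2 : HasSum (fun k => if k ∈ S then w k else 0) (∑ k ∈ S, w k) :=
      hasSum_ite_mem S w
    have e3 : HasSum (fun k => (4 * Real.pi) ^ N * ((1 + ‖k‖) ^ N * ‖cS S k‖))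
        (∑' k, w k - ∑ k ∈ S, w k) := (hw.hasSum.sub e2).congr_fun fun k => by
      simp only [cS, w]
      split_ifs <;> simp
    have h1 : u.pair h - u.pair (hS S) = u.1 (h - hS S) := (map_sub u.1 h (hS S)).symm
    rw [h1]
    refine hC _ _ fun n hn v => ?_
    simp_rw [hval]
    refine ((hcS S).norm_iteratedFDeriv_re_fourierSum_le n v).trans ?_
    refine hasSum_le (fun k => ?_) ((hcS S).summable_pow_mul n).hasSum e3
    rw [← mul_assoc]
    gcongr
    exact four_pi_norm_pow_le k hn
  have hlim : Tendsto (fun S => C * (∑' k, w k - ∑ k ∈ S, w k)) atTop (𝓝 0) := by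
    have := (hw.hasSum.const_sub (∑' k, w k)).const_mul C
    simpa using this
  rw [HasSum]
  simp_rw [hpair]
  rw [tendsto_iff_dist_tendsto_zero]
  refine squeeze_zero (fun _ => dist_nonneg) (fun S => ?_) hlim
  rw [dist_comm, Real.dist_eq]
  exact hbound S

instance : Measure.IsNegInvariant torusMeasure := by
  have h : Measure.Regular (AddCircle.haarAddCircle : Measure UnitAddCircle) := inferInstance
  have : Measure.IsNegInvariant (AddCircle.haarAddCircle : Measure UnitAddCircle) := inferInstance
  unfold torusMeasure
  infer_instance

lemma realCoeff_reflect (f : TestFunctions) (x : Torus2) (k : Fin 2 → ℤ) :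
    realCoeff (TestFunctions.reflect f x).1 k =
      starRingEnd ℂ (realCoeff f.1 k * UnitAddTorus.mFourier k x) := by
  have h := isHermitianSeq_realCoeff f.1 k
  rw [map_mul, ← h, ← UnitAddTorus.mFourier_neg]
  simp only [realCoeff, mFourierCoeff_eq, TestFunctions.reflect, neg_neg]
  rw [← integral_mul_const, ← integral_sub_left_eq_self (fun y => UnitAddTorus.mFourier k y *
    (f.1 y : ℂ) * UnitAddTorus.mFourier (-k) x) torusMeasure x]
  refine integral_congr_ae (Eventually.of_forall fun y => ?_)
  simp only []
  rw [sub_eq_add_neg x y, mFourier_add_apply, mFourier_neg_apply]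
  have h1 : UnitAddTorus.mFourier k x * UnitAddTorus.mFourier (-k) x = 1 := by
    rw [UnitAddTorus.mFourier_neg, Complex.mul_conj', norm_mFourier_apply]; simp
  linear_combination (-(UnitAddTorus.mFourier (-k) y * (f.1 (x + -y) : ℂ))) * h1

/-- The convolution of a distribution with a test function as a Fourier series. -/
lemma conv_eq_fourierSum (u : TorusDistribution) (f : TestFunctions) (x : Torus2) :
    u.conv f x = (fourierSum (fun k => realCoeff f.1 k * u.coeff k) x).re := by
  have hf : IsSmooth f.1 := f.2
  have h1 := hasSum_pair u (TestFunctions.reflect f x)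
  have h2 := Complex.hasSum_re (hasSum_fourierSum (hf.isRapid.mul_coeff u).summable_norm x)
  refine h1.unique (h2.congr_fun fun k => ?_)
  rw [realCoeff_reflect, ← map_mul, Complex.conj_re]
  congr 1
  ring

lemma coeff_distOfFun {g : Torus2 → ℝ} (hg : Continuous g) (n : Fin 2 → ℤ) :
    (distOfFun g).coeff n = realCoeff g n := by
  have hp : ∀ f : TestFunctions, (distOfFun g).pair f = ∫ x, g x * f.1 x ∂torusMeasure := fun f => by
    simp only [distOfFun, TorusDistribution.pair, dif_pos hg.integrable_torus]
    rfl
  have hc : Continuous fun x => g x * (cosMode n).1 x := hg.mul (IsSmooth.continuous (cosMode n).2)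
  have hs : Continuous fun x => g x * (sinMode n).1 x := hg.mul (IsSmooth.continuous (sinMode n).2)
  rw [TorusDistribution.coeff, hp, hp, ← integral_complex_ofReal, ← integral_complex_ofReal,
    ← integral_const_mul, realCoeff, mFourierCoeff_eq,
    ← integral_sub (f := fun x => ((g x * (cosMode n).1 x : ℝ) : ℂ))
      (g := fun x => Complex.I * ((g x * (sinMode n).1 x : ℝ) : ℂ))
      (Complex.continuous_ofReal.comp hc).integrable_torus
      (continuous_const.mul (Complex.continuous_ofReal.comp hs)).integrable_torus]
  refine integral_congr_ae (Eventually.of_forall fun x => ?_)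
  simp only [cosMode, sinMode, UnitAddTorus.mFourier_neg]
  apply Complex.ext <;> simp [mul_comm]

/-! ### The regularised potential -/

lemma realCoeff_re_fourierSum {c : (Fin 2 → ℤ) → ℂ} (hc : Summable fun k => ‖c k‖)
    (hh : IsHermitianSeq c) (n : Fin 2 → ℤ) :
    realCoeff (fun x => (fourierSum c x).re) n = c n := by
  rw [realCoeff]
  simp_rw [hh.fourierSum_re]
  exact mFourierCoeff_fourierSum hc n

/-- The Fourier multiplier `∫₀¹ e^{-4π²|k|²t} dt` of `-Δ⁻¹`. -/
def heatMult (k : Fin 2 → ℤ) : ℝ := ∫ t in (0 : ℝ)..1, Real.exp (-(4 * Real.pi ^ 2 * freqSq k * t))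

lemma freqSq_nonneg (k : Fin 2 → ℤ) : 0 ≤ freqSq k := Finset.sum_nonneg fun _ _ => sq_nonneg _

lemma freqSq_neg (k : Fin 2 → ℤ) : freqSq (-k) = freqSq k := by
  simp [freqSq]

lemma heatMult_neg (k : Fin 2 → ℤ) : heatMult (-k) = heatMult k := by
  simp only [heatMult, freqSq_neg]

lemma heatMult_nonneg (k : Fin 2 → ℤ) : 0 ≤ heatMult k :=
  intervalIntegral.integral_nonneg zero_le_one fun _ _ => (Real.exp_pos _).le

lemma freqSq_pos {k : Fin 2 → ℤ} (hk : k ≠ 0) : 0 < freqSq k := by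
  have h1 := one_le_norm_of_ne_zero hk
  have h2 := norm_sq_le_freqSq k
  nlinarith

lemma heatMult_of_ne_zero {k : Fin 2 → ℤ} (hk : k ≠ 0) :
    heatMult k = (1 - Real.exp (-(4 * Real.pi ^ 2 * freqSq k))) / (4 * Real.pi ^ 2 * freqSq k) := by
  have h0 : 0 < 4 * Real.pi ^ 2 * freqSq k := by
    have := freqSq_pos hk
    positivity
  rw [heatMult]
  have h1 : ∀ t, Real.exp (-(4 * Real.pi ^ 2 * freqSq k * t)) =
      Real.exp (-(4 * Real.pi ^ 2 * freqSq k) * t) := fun t => by rw [neg_mul]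
  simp_rw [h1]
  rw [intervalIntegral.integral_comp_mul_left (fun t => Real.exp t) (neg_ne_zero.2 h0.ne'),
    integral_exp]
  simp only [mul_one, mul_zero, Real.exp_zero, smul_eq_mul]
  field_simp
  ring

lemma heatMult_le {k : Fin 2 → ℤ} (hk : k ≠ 0) : heatMult k ≤ 1 / (4 * Real.pi ^ 2 * ‖k‖ ^ 2) := by
  have h1 := one_le_norm_of_ne_zero hk
  rw [heatMult_of_ne_zero hk]
  have h2 := norm_sq_le_freqSq k
  gcongr
  linarith [Real.exp_pos (-(4 * Real.pi ^ 2 * freqSq k))]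

lemma heatMult_le_one (k : Fin 2 → ℤ) : heatMult k ≤ 1 := by
  have h := intervalIntegral.integral_mono_on (μ := volume)
    (f := fun t => Real.exp (-(4 * Real.pi ^ 2 * freqSq k * t)))
    (g := fun _ => (1 : ℝ)) zero_le_one (Continuous.intervalIntegrable (by fun_prop) _ _)
    (Continuous.intervalIntegrable (by fun_prop) _ _) fun t ht => by
      have := freqSq_nonneg k
      have := ht.1
      exact Real.exp_le_one_iff.2 (neg_nonpos.2 (by positivity))
  simpa [heatMult] using h

lemma heat_re_fourierSum {c : (Fin 2 → ℤ) → ℂ} (hc : Summable fun k => ‖c k‖)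
    (hh : IsHermitianSeq c) (t : ℝ) (x : Torus2) :
    heat t (fun x => (fourierSum c x).re) x =
      (∑' k, (Real.exp (-(4 * Real.pi ^ 2 * freqSq k * t)) : ℂ) * c k *
        UnitAddTorus.mFourier k x).re := by
  rw [heat]
  congr 1
  refine tsum_congr fun k => ?_
  congr 2
  exact realCoeff_re_fourierSum hc hh k

lemma invLaplacian_re_fourierSum {c : (Fin 2 → ℤ) → ℂ} (hc : Summable fun k => ‖c k‖)
    (hh : IsHermitianSeq c) (x : Torus2) :
    invLaplacian (fun x => (fourierSum c x).re) x =
      (fourierSum (fun k => -(heatMult k : ℂ) * c k) x).re := by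
  let F : (Fin 2 → ℤ) → ℝ → ℝ := fun k t =>
    (c k * UnitAddTorus.mFourier k x).re * Real.exp (-(4 * Real.pi ^ 2 * freqSq k * t))
  have hexp : ∀ (k : Fin 2 → ℤ) (t : ℝ), 0 ≤ t →
      |Real.exp (-(4 * Real.pi ^ 2 * freqSq k * t))| ≤ 1 := fun k t ht => by
    rw [abs_of_pos (Real.exp_pos _), Real.exp_le_one_iff]
    have := freqSq_nonneg k
    exact neg_nonpos.2 (by positivity)
  have hre : ∀ k, |(c k * UnitAddTorus.mFourier k x).re| ≤ ‖c k‖ := fun k => by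
    refine (Complex.abs_re_le_norm _).trans ?_
    rw [norm_mul, norm_mFourier_apply, mul_one]
  have hF : ∀ k t, 0 ≤ t → ‖F k t‖ ≤ ‖c k‖ := fun k t ht => by
    simp only [F, Real.norm_eq_abs, abs_mul]
    calc _ ≤ ‖c k‖ * 1 := by
          gcongr
          · exact hre k
          · exact hexp k t ht
      _ = _ := mul_one _
  have hsum : ∀ t, 0 ≤ t → HasSum (fun k => F k t) (heat t (fun x => (fourierSum c x).re) x) :=
    fun t ht => by
      rw [heat_re_fourierSum hc hh]
      have hs : Summable fun k => (Real.exp (-(4 * Real.pi ^ 2 * freqSq k * t)) : ℂ) * c k *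
          UnitAddTorus.mFourier k x := by
        refine Summable.of_norm_bounded hc fun k => ?_
        rw [norm_mul, norm_mul, norm_mFourier_apply, mul_one, Complex.norm_real, Real.norm_eq_abs]
        exact mul_le_of_le_one_left (norm_nonneg _) (hexp k t ht)
      refine (Complex.hasSum_re hs.hasSum).congr_fun fun k => ?_
      rw [mul_assoc, Complex.re_ofReal_mul, mul_comm]
  have hint := intervalIntegral.hasSum_integral_of_dominated_convergence (μ := volume) (a := 0)
    (b := 1) (F := F) (f := fun t => heat t (fun x => (fourierSum c x).re) x)
    (fun k _ => ‖c k‖) (fun k => (Continuous.aestronglyMeasurable (by fun_prop)))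
    (fun k => Eventually.of_forall fun t ht => hF k t (by
      rw [Set.uIoc_of_le zero_le_one] at ht; exact ht.1.le))
    (Eventually.of_forall fun t _ => hc) (by simp)
    (Eventually.of_forall fun t ht => hsum t (by
      rw [Set.uIoc_of_le zero_le_one] at ht; exact ht.1.le))
  have hs2 : Summable fun k => ‖-(heatMult k : ℂ) * c k‖ := by
    refine Summable.of_nonneg_of_le (fun _ => norm_nonneg _) (fun k => ?_) hc
    rw [norm_mul, norm_neg, Complex.norm_real, Real.norm_of_nonneg (heatMult_nonneg k)]
    exact mul_le_of_le_one_left (norm_nonneg _) (heatMult_le_one k)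
  have h2 := Complex.hasSum_re (hasSum_fourierSum hs2 x)
  rw [invLaplacian]
  refine (hint.neg.unique (h2.congr_fun fun k => ?_))
  simp only [F]
  rw [intervalIntegral.integral_const_mul, ← heatMult, mul_assoc, neg_mul, Complex.neg_re,
    Complex.re_ofReal_mul, mul_comm]

/-- The Fourier multiplier of the `i`-th component of `∇^⊥ Δ⁻¹`. -/
def potMult (i : Fin 2) (k : Fin 2 → ℤ) : ℂ :=
  ![2 * Real.pi * Complex.I * k 1 * heatMult k, -(2 * Real.pi * Complex.I * k 0 * heatMult k)] i

lemma isHermitianSeq_potMult (i : Fin 2) : IsHermitianSeq (potMult i) := fun k => by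
  have h2 : (starRingEnd ℂ) 2 = 2 := Complex.conj_ofNat 2
  fin_cases i <;> simp [potMult, heatMult_neg, h2]

lemma norm_potMult_le_aux (i : Fin 2) (k : Fin 2 → ℤ) :
    ‖potMult i k‖ ≤ 2 * Real.pi * ‖k‖ * heatMult k := by
  have h : ∀ j : Fin 2, ‖2 * Real.pi * Complex.I * k j * heatMult k‖ ≤
      2 * Real.pi * ‖k‖ * heatMult k := fun j => by
    rw [norm_mul, Complex.norm_real, Real.norm_of_nonneg (heatMult_nonneg k)]
    exact mul_le_mul_of_nonneg_right (norm_two_pi_I_mul_le k j) (heatMult_nonneg k)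
  fin_cases i
  · exact h 1
  · have := h 0
    rw [← norm_neg] at this
    exact this

/-- The Fourier coefficients of the mollifier on the torus. -/
def mollCoeff (ρ : Mollifier) (ε : ℝ) : (Fin 2 → ℤ) → ℂ := realCoeff (ρ.onTorus ε).1

lemma isRapid_mollCoeff (ρ : Mollifier) (ε : ℝ) : IsRapid (mollCoeff ρ ε) :=
  IsSmooth.isRapid (ρ.onTorus ε).2

lemma isHermitianSeq_mollCoeff (ρ : Mollifier) (ε : ℝ) : IsHermitianSeq (mollCoeff ρ ε) :=
  isHermitianSeq_realCoeff _

/-- The Fourier coefficients of the `i`-th component of the regularised potential. -/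
def potCoeff (ρ : Mollifier) (ε : ℝ) (u : TorusDistribution) (i : Fin 2) (k : Fin 2 → ℤ) : ℂ :=
  potMult i k * mollCoeff ρ ε k * u.coeff k

lemma isHermitianSeq_potCoeff (ρ : Mollifier) (ε : ℝ) (u : TorusDistribution) (i : Fin 2) :
    IsHermitianSeq (potCoeff ρ ε u i) :=
  ((isHermitianSeq_potMult i).mul (isHermitianSeq_mollCoeff ρ ε)).mul (isHermitianSeq_coeff u)

lemma IsRapid.potMult_mul {c : (Fin 2 → ℤ) → ℂ} (hc : IsRapid c) (i : Fin 2) :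
    IsRapid fun k => potMult i k * c k :=
  hc.of_norm_le (C := 2 * Real.pi) (N := 1) fun k => by
    rw [norm_mul, pow_one]
    have h := norm_potMult_le_aux i k
    have h1 := heatMult_le_one k
    have h2 := heatMult_nonneg k
    have hpi := Real.pi_pos
    gcongr
    refine h.trans ?_
    calc _ ≤ 2 * Real.pi * ‖k‖ * 1 := by gcongr
      _ ≤ _ := by rw [mul_one]; gcongr; linarith

lemma isRapid_potCoeff (ρ : Mollifier) (ε : ℝ) (u : TorusDistribution) (i : Fin 2) :
    IsRapid (potCoeff ρ ε u i) :=
  ((isRapid_mollCoeff ρ ε).potMult_mul i).mul_coeff u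

lemma potential_eq (ρ : Mollifier) (ε : ℝ) (u : TorusDistribution) (i : Fin 2) (x : Torus2) :
    potential ρ ε u i x = (fourierSum (potCoeff ρ ε u i) x).re := by
  set c : (Fin 2 → ℤ) → ℂ := fun k => mollCoeff ρ ε k * u.coeff k with hcdef
  have hc : IsRapid c := (isRapid_mollCoeff ρ ε).mul_coeff u
  have hh : IsHermitianSeq c := (isHermitianSeq_mollCoeff ρ ε).mul (isHermitianSeq_coeff u)
  have h1 : u.conv (ρ.onTorus ε) = fun x => (fourierSum c x).re :=
    funext fun x => conv_eq_fourierSum u _ x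
  have h2 : invLaplacian (u.conv (ρ.onTorus ε)) =
      fun x => (fourierSum (fun k => -(heatMult k : ℂ) * c k) x).re := by
    rw [h1]
    exact funext fun x => invLaplacian_re_fourierSum hc.summable_norm hh x
  have hc2 : IsRapid fun k => -(heatMult k : ℂ) * c k :=
    hc.of_norm_le (C := 1) (N := 0) fun k => by
      rw [norm_mul, norm_neg, Complex.norm_real, Real.norm_of_nonneg (heatMult_nonneg k), pow_zero,
        mul_one]
      exact mul_le_mul_of_nonneg_right (heatMult_le_one k) (norm_nonneg _)
  rw [potential, gradPerp, h2]
  fin_cases i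
  · have h3 : -(fourierSum (fun k => 2 * Real.pi * Complex.I * k 1 * (-(heatMult k : ℂ) * c k)) x) =
        fourierSum (potCoeff ρ ε u 0) x := by
      rw [fourierSum, ← tsum_neg]
      refine tsum_congr fun k => ?_
      simp only [potCoeff, potMult, hcdef, Matrix.cons_val_zero]
      ring
    simp only [Fin.zero_eta, Matrix.cons_val_zero, Pi.neg_apply]
    rw [hc2.partialDeriv_fourierSum, ← Complex.neg_re, h3]
  · have h3 : fourierSum (fun k => 2 * Real.pi * Complex.I * k 0 * (-(heatMult k : ℂ) * c k)) x =
        fourierSum (potCoeff ρ ε u 1) x := by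
      refine tsum_congr fun k => ?_
      simp only [potCoeff, potMult, hcdef, Matrix.cons_val_one, Matrix.cons_val_fin_one]
      ring
    simp only [Fin.mk_one, Matrix.cons_val_one, Matrix.cons_val_fin_one]
    rw [hc2.partialDeriv_fourierSum, h3]

lemma isSmooth_potential (ρ : Mollifier) (ε : ℝ) (u : TorusDistribution) (i : Fin 2) :
    IsSmooth (potential ρ ε u i) := by
  rw [funext (potential_eq ρ ε u i)]
  exact (isRapid_potCoeff ρ ε u i).isSmooth_re

lemma tendsto_freqBox_product :
    Tendsto (fun N => freqBox N ×ˢ freqBox N) atTop atTop :=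
  tendsto_atTop_finset_of_monotone
    (fun _ _ h => Finset.product_subset_product (freqBox_mono h) (freqBox_mono h)) fun p =>
    ⟨⌈max ‖p.1‖ ‖p.2‖⌉₊, Finset.mem_product.2
      ⟨mem_freqBox.2 ((le_max_left _ _).trans (Nat.le_ceil _)),
        mem_freqBox.2 ((le_max_right _ _).trans (Nat.le_ceil _))⟩⟩

/-- The Fourier coefficients of a product are the convolution of the Fourier coefficients. -/
lemma tendsto_realCoeff_mul {c d : (Fin 2 → ℤ) → ℂ} (hc : Summable fun k => ‖c k‖)
    (hd : Summable fun k => ‖d k‖) (hch : IsHermitianSeq c) (hdh : IsHermitianSeq d)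
    (n : Fin 2 → ℤ) :
    Tendsto (fun N => ∑ k ∈ freqBox N, ∑ l ∈ freqBox N, if k + l = n then c k * d l else 0) atTop
      (𝓝 (realCoeff (fun x => (fourierSum c x).re * (fourierSum d x).re) n)) := by
  let F : (Fin 2 → ℤ) × (Fin 2 → ℤ) → Torus2 → ℂ := fun p x =>
    UnitAddTorus.mFourier (-n) x *
      (c p.1 * UnitAddTorus.mFourier p.1 x * (d p.2 * UnitAddTorus.mFourier p.2 x))
  have hF : ∀ p, Integrable (F p) torusMeasure := fun p =>
    Continuous.integrable_torus (by fun_prop)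
  have hs := hasSum_integral_of_summable_integral_norm hF (by
    simp only [F, norm_mul, norm_mFourier_apply, mul_one, one_mul, integral_const, probReal_univ,
      smul_eq_mul]
    exact hc.mul_of_nonneg hd (fun _ => norm_nonneg _) fun _ => norm_nonneg _)
  have h1 : ∀ p, ∫ x, F p x ∂torusMeasure = if p.1 + p.2 = n then c p.1 * d p.2 else 0 :=
    fun p => by
      have : ∀ x, F p x = c p.1 * d p.2 * UnitAddTorus.mFourier (p.1 + p.2 - n) x := fun x => by
        simp only [F]
        rw [← mFourier_mul_neg, UnitAddTorus.mFourier_add]; ring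
      simp_rw [this]
      rw [integral_const_mul, integral_mFourier]
      simp [sub_eq_zero]
  have h2 : ∫ x, ∑' p, F p x ∂torusMeasure =
      realCoeff (fun x => (fourierSum c x).re * (fourierSum d x).re) n := by
    rw [realCoeff, mFourierCoeff_eq]
    refine integral_congr_ae (Eventually.of_forall fun x => ?_)
    simp only [F, Complex.ofReal_mul]
    rw [tsum_mul_left, hch.fourierSum_re, hdh.fourierSum_re]
    congr 1
    refine (tsum_mul_tsum_of_summable_norm (f := fun k => c k * UnitAddTorus.mFourier k x)
      (g := fun k => d k * UnitAddTorus.mFourier k x) ?_ ?_).symm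
    · simpa only [norm_mul, norm_mFourier_apply, mul_one] using hc
    · simpa only [norm_mul, norm_mFourier_apply, mul_one] using hd
  rw [h2] at hs
  simp_rw [h1] at hs
  refine (hs.comp tendsto_freqBox_product).congr fun N => ?_
  rw [Function.comp_apply, Finset.sum_product]

/-- The kernel of the quadratic form `A ↦ A·A` in terms of the modes of the noise. -/
def potKernel (k l : Fin 2 → ℤ) : ℂ := ∑ i, potMult i k * potMult i l

lemma realCoeff_sum_sub_const {f : Fin 2 → Torus2 → ℝ} (hf : ∀ i, Continuous (f i)) (c : ℝ)
    (n : Fin 2 → ℤ) : realCoeff (fun x => ∑ i, f i x - c) n =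
      ∑ i, realCoeff (f i) n - if n = 0 then (c : ℂ) else 0 := by
  simp only [realCoeff, mFourierCoeff_eq, Complex.ofReal_sub, Complex.ofReal_sum, mul_sub,
    Finset.mul_sum]
  have h : ∀ i, Continuous fun x => UnitAddTorus.mFourier (-n) x * (f i x : ℂ) := fun i => by
    have := hf i
    fun_prop
  rw [integral_sub (integrable_finsetSum _ fun i _ => (h i).integrable_torus)
    (Continuous.integrable_torus (by fun_prop)),
    integral_finsetSum _ fun i _ => (h i).integrable_torus, integral_mul_const, integral_mFourier]
  simp

/-- The Fourier coefficients of `A_ε · A_ε - c` as limits of truncated quadratic forms in the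
modes of the noise. -/
lemma tendsto_coeff_potentialSq (ρ : Mollifier) (ε : ℝ) (u : TorusDistribution) (c : ℝ)
    (n : Fin 2 → ℤ) :
    Tendsto (fun N => (∑ k ∈ freqBox N, ∑ l ∈ freqBox N, if k + l = n then
      potKernel k l * (mollCoeff ρ ε k * mollCoeff ρ ε l) * (u.coeff k * u.coeff l) else 0) -
        if n = 0 then (c : ℂ) else 0) atTop
      (𝓝 ((distOfFun fun x => potentialSq ρ ε u x - c).coeff n)) := by
  have hcont : ∀ i, Continuous (potential ρ ε u i) := fun i => (isSmooth_potential ρ ε u i).continuous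
  have hcsq : Continuous fun x => potentialSq ρ ε u x - c := by
    unfold potentialSq
    fun_prop
  rw [coeff_distOfFun hcsq]
  have h0 : realCoeff (fun x => potentialSq ρ ε u x - c) n = _ :=
    realCoeff_sum_sub_const (f := fun i x => potential ρ ε u i x * potential ρ ε u i x)
      (fun i => (hcont i).mul (hcont i)) c n
  rw [h0]
  refine Tendsto.sub_const ?_ _
  have h1 : ∀ i, Tendsto (fun N => ∑ k ∈ freqBox N, ∑ l ∈ freqBox N,
      if k + l = n then potCoeff ρ ε u i k * potCoeff ρ ε u i l else 0) atTop
      (𝓝 (realCoeff (fun x => potential ρ ε u i x * potential ρ ε u i x) n)) := fun i => by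
    simp_rw [potential_eq]
    exact tendsto_realCoeff_mul (isRapid_potCoeff ρ ε u i).summable_norm
      (isRapid_potCoeff ρ ε u i).summable_norm (isHermitianSeq_potCoeff ρ ε u i)
      (isHermitianSeq_potCoeff ρ ε u i) n
  refine (tendsto_finsetSum Finset.univ fun i _ => h1 i).congr fun N => ?_
  rw [Finset.sum_comm]
  refine Finset.sum_congr rfl fun k _ => ?_
  rw [Finset.sum_comm]
  refine Finset.sum_congr rfl fun l _ => ?_
  split_ifs
  · simp only [potKernel, Finset.sum_mul, potCoeff]
    exact Finset.sum_congr rfl fun i _ => by ring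
  · simp

/-! ### The Gaussian coordinates of white noise -/

/-- The test functions `cos (2π k·x) + sin (2π k·x)`, `k ∈ ℤ²`: a real orthonormal basis of
`L²(𝕋²)`. -/
def casMode (k : Fin 2 → ℤ) : TestFunctions := cosMode k + sinMode k

lemma casMode_mul (k l : Fin 2 → ℤ) (x : Torus2) : (casMode k).1 x * (casMode l).1 x =
    (UnitAddTorus.mFourier (k - l) x).re + (UnitAddTorus.mFourier (k + l) x).im := by
  rw [UnitAddTorus.mFourier_add, sub_eq_add_neg, UnitAddTorus.mFourier_add,
    UnitAddTorus.mFourier_neg]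
  simp only [casMode, cosMode, sinMode, Submodule.coe_add, Pi.add_apply, Complex.mul_re,
    Complex.mul_im, Complex.conj_re, Complex.conj_im]
  ring

lemma integrable_testFunction (f : TestFunctions) : Integrable f.1 torusMeasure :=
  (IsSmooth.continuous f.2).integrable_torus

lemma integral_casMode_mul (k l : Fin 2 → ℤ) :
    ∫ x, (casMode k).1 x * (casMode l).1 x ∂torusMeasure = if k = l then 1 else 0 := by
  have h (n : Fin 2 → ℤ) : Integrable (fun x => UnitAddTorus.mFourier n x) torusMeasure :=
    (ContinuousMap.continuous _).integrable_torus
  simp only [casMode_mul]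
  refine (integral_add (h (k - l)).re (h (k + l)).im).trans ?_
  have h1 := integral_re (h (k - l))
  have h2 := integral_im (h (k + l))
  rw [h1, h2, integral_mFourier, integral_mFourier]
  simp only [sub_eq_zero]
  split_ifs <;> simp

lemma integral_sq_sum_casMode (S : Finset (Fin 2 → ℤ)) (c : (Fin 2 → ℤ) → ℝ) :
    ∫ x, (∑ k ∈ S, c k • casMode k : TestFunctions).1 x ^ 2 ∂torusMeasure = ∑ k ∈ S, c k ^ 2 := by
  have h1 : ∀ x, (∑ k ∈ S, c k • casMode k : TestFunctions).1 x ^ 2 =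
      ∑ k ∈ S, ∑ l ∈ S, c k * c l * ((casMode k).1 x * (casMode l).1 x) := fun x => by
    simp only [Submodule.coe_sum, Finset.sum_apply, Submodule.coe_smul, Pi.smul_apply, smul_eq_mul]
    rw [sq, Finset.sum_mul_sum]
    refine Finset.sum_congr rfl fun k _ => Finset.sum_congr rfl fun l _ => ?_
    ring
  have hi : ∀ k l, Integrable (fun x => c k * c l * ((casMode k).1 x * (casMode l).1 x))
      torusMeasure := fun k l =>
    (integrable_mul_testFunction (integrable_testFunction (casMode k)) (casMode l)).const_mul _
  simp only [h1]
  rw [integral_finsetSum _ fun k _ => integrable_finsetSum _ fun l _ => hi k l]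
  refine Finset.sum_congr rfl fun k hk => ?_
  rw [integral_finsetSum _ fun l _ => hi k l]
  simp only [integral_const_mul, integral_casMode_mul, mul_ite, mul_one, mul_zero,
    Finset.sum_ite_eq, if_pos hk]
  ring

section WhiteNoise

variable {Ω : Type*} [MeasurableSpace Ω] {μ : Measure Ω} {ξ : Ω → TorusDistribution}

/-- The coordinates of white noise in the basis `casMode`, modified on a null set so as to be
measurable. -/
def IsWhiteNoise.coord (hξ : IsWhiteNoise μ ξ) (k : Fin 2 → ℤ) : Ω → ℝ :=
  (hξ (casMode k)).aemeasurable.mk _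

lemma IsWhiteNoise.ae_coord_eq (hξ : IsWhiteNoise μ ξ) :
    ∀ᵐ ω ∂μ, ∀ k, hξ.coord k ω = (ξ ω).pair (casMode k) :=
  ae_all_iff.2 fun k => (hξ (casMode k)).aemeasurable.ae_eq_mk.symm

lemma IsWhiteNoise.isStdGaussianFamily (hξ : IsWhiteNoise μ ξ) :
    IsStdGaussianFamily μ hξ.coord where
  measurable k := (hξ (casMode k)).aemeasurable.measurable_mk
  hasLaw S c := by
    have h := hξ (∑ k ∈ S, c k • casMode k)
    rw [integral_sq_sum_casMode] at h
    refine h.congr ?_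
    filter_upwards [hξ.ae_coord_eq] with ω hω
    simp [hω, TorusDistribution.pair]

lemma IsWhiteNoise.ae_fourierMode_eq (hξ : IsWhiteNoise μ ξ) :
    ∀ᵐ ω ∂μ, ∀ k, fourierMode hξ.coord k ω = (ξ ω).coeff k := by
  filter_upwards [hξ.ae_coord_eq] with ω hω k
  rw [fourierMode, hω, hω]
  simp only [casMode, cosMode_neg, sinMode_neg, TorusDistribution.coeff, TorusDistribution.pair,
    map_add, map_neg]
  push_cast
  ring

end WhiteNoise

/-! ### Second moments of the Fourier modes -/

lemma conj_fourierMode {Ω : Type*} (g : (Fin 2 → ℤ) → Ω → ℝ) (k : Fin 2 → ℤ) (ω : Ω) :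
    starRingEnd ℂ (fourierMode g k ω) = fourierMode g (-k) ω := by
  simp only [fourierMode, map_add, map_mul, map_div₀, map_sub, map_one, Complex.conj_I,
    Complex.conj_ofReal, Complex.conj_ofNat, neg_neg]
  ring

section Moments

variable {Ω κ : Type*} [MeasurableSpace Ω] {μ : Measure Ω} {g : κ → Ω → ℝ}

lemma IsStdGaussianFamily.hasLaw_single (hg : IsStdGaussianFamily μ g) (k : κ) :
    HasLaw (g k) (gaussianReal 0 1) μ := by
  simpa using hg.hasLaw {k} fun _ => 1

lemma IsStdGaussianFamily.memLp (hg : IsStdGaussianFamily μ g) (k : κ) : MemLp (g k) 2 μ := by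
  have h := memLp_id_gaussianReal (μ := 0) (v := 1) 2
  rw [← (hg.hasLaw_single k).map_eq] at h
  exact (memLp_map_measure_iff aestronglyMeasurable_id (hg.measurable k).aemeasurable).1 h

lemma IsStdGaussianFamily.integrable_mul (hg : IsStdGaussianFamily μ g) (k l : κ) :
    Integrable (fun ω => g k ω * g l ω) μ := (hg.memLp k).integrable_mul (hg.memLp l)

lemma integral_sq_of_hasLaw {X : Ω → ℝ} {v : NNReal} (hX : HasLaw X (gaussianReal 0 v) μ) :
    ∫ ω, X ω ^ 2 ∂μ = v := by
  have h1 : ∫ x, x ^ 2 ∂(gaussianReal 0 v) = v := by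
    have h := variance_of_integral_eq_zero (μ := gaussianReal 0 v) (X := id) aemeasurable_id
      integral_id_gaussianReal
    rw [variance_id_gaussianReal] at h
    exact h.symm
  rw [← h1, ← hX.map_eq, integral_map hX.aemeasurable (by fun_prop)]

lemma IsStdGaussianFamily.integral_mul [DecidableEq κ] (hg : IsStdGaussianFamily μ g) (k l : κ) :
    ∫ ω, g k ω * g l ω ∂μ = if k = l then 1 else 0 := by
  have hsq (j : κ) : ∫ ω, g j ω ^ 2 ∂μ = 1 := by
    simpa using integral_sq_of_hasLaw (hg.hasLaw_single j)
  split_ifs with h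
  · subst h
    simpa [sq] using hsq k
  · have h2 := integral_sq_of_hasLaw (hg.hasLaw {k, l} fun _ => 1)
    simp only [Finset.sum_pair h, one_mul, one_pow] at h2
    have e : ∀ ω, (g k ω + g l ω) ^ 2 = g k ω ^ 2 + 2 * (g k ω * g l ω) + g l ω ^ 2 :=
      fun ω => by ring
    have i1 (j : κ) : Integrable (fun ω => g j ω ^ 2) μ := by
      simpa [sq] using hg.integrable_mul j j
    have i2 := (hg.integrable_mul k l).const_mul 2
    simp only [e] at h2
    have h3 := (integral_add ((i1 k).add i2) (i1 l)).symm.trans h2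
    have h4 := integral_add (i1 k) i2
    rw [integral_const_mul, hsq] at h4
    simp only [Pi.add_apply] at h3
    rw [h4, hsq] at h3
    norm_num at h3
    linarith

end Moments

section Moments

variable {Ω : Type*} [MeasurableSpace Ω] {μ : Measure Ω} [IsProbabilityMeasure μ]
  {g : (Fin 2 → ℤ) → Ω → ℝ}

lemma IsStdGaussianFamily.integral_wickProd (hg : IsStdGaussianFamily μ g) (k l : Fin 2 → ℤ) :
    Integrable (wickProd g k l) μ ∧ ∫ ω, wickProd g k l ω ∂μ = 0 := by
  have hi (k l : Fin 2 → ℤ) :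
      Integrable (fun ω => (g k ω * g l ω - if k = l then 1 else 0 : ℂ)) μ := by
    refine Integrable.sub ?_ (integrable_const _)
    simpa using (hg.integrable_mul k l).ofReal (𝕜 := ℂ)
  have h0 (k l : Fin 2 → ℤ) : ∫ ω, (g k ω * g l ω - if k = l then 1 else 0 : ℂ) ∂μ = 0 := by
    have h1 : Integrable (fun ω => (g k ω * g l ω : ℂ)) μ := by
      simpa using (hg.integrable_mul k l).ofReal (𝕜 := ℂ)
    rw [integral_sub h1 (integrable_const _), integral_const]
    have h2 := hg.integral_mul k l
    have h3 : ∫ ω, (g k ω * g l ω : ℂ) ∂μ = ((∫ ω, g k ω * g l ω ∂μ : ℝ) : ℂ) := by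
      rw [← integral_complex_ofReal]; simp
    rw [h3, h2]
    split_ifs <;> simp
  have e : wickProd g k l = fun ω => _ := funext fun ω => wickProd_eq g k l ω
  rw [e]
  have i1 := (hi k l).const_mul (-Complex.I / 2)
  have i2 := (hi k (-l)).const_mul (1 / 2)
  have i3 := (hi (-k) l).const_mul (1 / 2)
  have i4 := (hi (-k) (-l)).const_mul (Complex.I / 2)
  refine ⟨((i1.add i2).add i3).add i4, (integral_add ((i1.add i2).add i3) i4).trans ?_⟩
  have e1 := integral_add (i1.add i2) i3
  have e2 := integral_add i1 i2
  simp only [integral_const_mul, h0, mul_zero, add_zero] at e1 e2 ⊢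
  exact e1.trans e2

lemma IsStdGaussianFamily.integral_fourierMode_mul (hg : IsStdGaussianFamily μ g)
    (k l : Fin 2 → ℤ) : Integrable (fun ω => fourierMode g k ω * fourierMode g l ω) μ ∧
      ∫ ω, fourierMode g k ω * fourierMode g l ω ∂μ = if k + l = 0 then 1 else 0 := by
  obtain ⟨h1, h2⟩ := hg.integral_wickProd k l
  have e : (fun ω => fourierMode g k ω * fourierMode g l ω) =
      fun ω => wickProd g k l ω + if k + l = 0 then 1 else 0 :=
    funext fun ω => (sub_add_cancel _ _).symm
  rw [e]
  exact ⟨h1.add (integrable_const _), by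
    rw [integral_add h1 (integrable_const _), h2, integral_const]; simp⟩

lemma IsStdGaussianFamily.integral_norm_fourierMode_mul_le (hg : IsStdGaussianFamily μ g)
    (k l : Fin 2 → ℤ) : ∫ ω, ‖fourierMode g k ω * fourierMode g l ω‖ ∂μ ≤ 1 := by
  have hsq (k : Fin 2 → ℤ) : Integrable (fun ω => ‖fourierMode g k ω‖ ^ 2) μ ∧
      ∫ ω, ‖fourierMode g k ω‖ ^ 2 ∂μ = 1 := by
    obtain ⟨h1, h2⟩ := hg.integral_fourierMode_mul k (-k)
    simp only [← conj_fourierMode, Complex.mul_conj', add_neg_cancel, if_true] at h1 h2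
    have h3 : Integrable (fun ω => ‖fourierMode g k ω‖ ^ 2) μ := by
      simpa [← Complex.ofReal_pow] using h1.re
    refine ⟨h3, ?_⟩
    rw [← Complex.ofReal_inj, ← integral_complex_ofReal]
    simpa using h2
  have h := integral_mono (hg.integral_fourierMode_mul k l).1.norm
    (((hsq k).1.add (hsq l).1).div_const 2) fun ω => by
      change ‖fourierMode g k ω * fourierMode g l ω‖ ≤
        (‖fourierMode g k ω‖ ^ 2 + ‖fourierMode g l ω‖ ^ 2) / 2
      rw [norm_mul]
      linarith [two_mul_le_add_sq ‖fourierMode g k ω‖ ‖fourierMode g l ω‖]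
  refine h.trans (le_of_eq ?_)
  simp only [Pi.add_apply]
  rw [integral_div, integral_add (hsq k).1 (hsq l).1, (hsq k).2, (hsq l).2]
  norm_num

end Moments

/-! ### Distributions with prescribed Fourier coefficients -/

/-- Polynomial growth, the condition for a sequence to be the Fourier coefficients of a
distribution. -/
def IsTempered (c : (Fin 2 → ℤ) → ℂ) : Prop := ∃ (C : ℝ) (N : ℕ), ∀ k, ‖c k‖ ≤ C * (1 + ‖k‖) ^ N

lemma IsTempered.summable {c : (Fin 2 → ℤ) → ℂ} (hc : IsTempered c) (f : TestFunctions) :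
    Summable fun k => ‖(realCoeff f.1 k * starRingEnd ℂ (c k)).re‖ := by
  obtain ⟨C, N, hC⟩ := hc
  have h : IsRapid fun k => realCoeff f.1 k * starRingEnd ℂ (c k) :=
    (IsSmooth.isRapid f.2).of_norm_le (C := C) (N := N) fun k => by
      rw [norm_mul, RCLike.norm_conj, mul_comm]
      gcongr
      exact hC k
  exact h.summable_norm.of_nonneg_of_le (fun _ => norm_nonneg _) fun k => Complex.abs_re_le_norm _

lemma realCoeff_add {f g : Torus2 → ℝ} (hf : Continuous f) (hg : Continuous g) (k : Fin 2 → ℤ) :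
    realCoeff (f + g) k = realCoeff f k + realCoeff g k := by
  have h {f : Torus2 → ℝ} (hf : Continuous f) : Integrable
      (fun x => UnitAddTorus.mFourier (-k) x * (f x : ℂ)) torusMeasure :=
    Continuous.integrable_torus (by fun_prop)
  simp only [realCoeff, mFourierCoeff_eq]
  rw [← integral_add (h hf) (h hg)]
  simp [mul_add]

lemma realCoeff_smul (a : ℝ) (f : Torus2 → ℝ) (k : Fin 2 → ℤ) :
    realCoeff (a • f) k = a * realCoeff f k := by
  simp only [realCoeff, mFourierCoeff_eq]
  rw [← integral_const_mul]
  refine integral_congr_ae (Eventually.of_forall fun x => ?_)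
  simp only [Pi.smul_apply, smul_eq_mul, Complex.ofReal_mul]
  ring

open Classical in
/-- The distribution with Fourier coefficients `c`, for a Hermitian sequence `c` of polynomial
growth (by convention `0` if `c` does not grow polynomially). -/
def distOfCoeff (c : (Fin 2 → ℤ) → ℂ) : TorusDistribution :=
  if hc : IsTempered c then
    ⟨{ toFun := fun f => ∑' k, (realCoeff f.1 k * starRingEnd ℂ (c k)).re
       map_add' := fun f g => by
        rw [← (hc.summable f).of_norm.tsum_add (hc.summable g).of_norm]
        refine tsum_congr fun k => ?_
        rw [Submodule.coe_add, realCoeff_add (IsSmooth.continuous f.2) (IsSmooth.continuous g.2),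
          add_mul, Complex.add_re]
       map_smul' := fun a f => by
        rw [RingHom.id_apply, smul_eq_mul, ← tsum_mul_left]
        refine tsum_congr fun k => ?_
        rw [Submodule.coe_smul, realCoeff_smul, mul_assoc, Complex.re_ofReal_mul] }, by
      obtain ⟨C, N, hC⟩ := id hc
      refine ⟨C * 2 ^ (N + 4) * ∑' k : Fin 2 → ℤ, ((1 + ‖k‖) ^ 3)⁻¹, N + 3, fun f M hM => ?_⟩
      have hb := one_add_norm_pow_mul_norm_realCoeff_le (f := f.1) f.2 (N + 3) hM
      change |∑' k, (realCoeff f.1 k * starRingEnd ℂ (c k)).re| ≤ _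
      rw [mul_right_comm, ← tsum_mul_left]
      refine (norm_tsum_le_tsum_norm (hc.summable f)).trans ((hc.summable f).tsum_le_tsum
        (fun k => ?_) (summable_one_add_norm_pow.mul_left _))
      refine (Complex.abs_re_le_norm _).trans ?_
      rw [norm_mul, RCLike.norm_conj, ← div_eq_mul_inv, le_div_iff₀ (by positivity)]
      have hp : 0 ≤ C * (1 + ‖k‖) ^ N := (norm_nonneg _).trans (hC k)
      have hC0 : 0 ≤ C := nonneg_of_mul_nonneg_left hp (by positivity)
      calc ‖realCoeff f.1 k‖ * ‖c k‖ * (1 + ‖k‖) ^ 3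
          ≤ ‖realCoeff f.1 k‖ * (C * (1 + ‖k‖) ^ N) * (1 + ‖k‖) ^ 3 := by gcongr; exact hC k
        _ = C * ((1 + ‖k‖) ^ (N + 3) * ‖realCoeff f.1 k‖) := by ring
        _ ≤ C * (2 ^ (N + 3) * (2 * M)) := mul_le_mul_of_nonneg_left (hb k) hC0
        _ = _ := by ring⟩
  else 0

lemma IsTempered.pair_distOfCoeff {c : (Fin 2 → ℤ) → ℂ} (hc : IsTempered c) (f : TestFunctions) :
    (distOfCoeff c).pair f = ∑' k, (realCoeff f.1 k * starRingEnd ℂ (c k)).re := by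
  rw [distOfCoeff, dif_pos hc]
  rfl

lemma realCoeff_cosMode (n k : Fin 2 → ℤ) : realCoeff (cosMode n).1 k =
    (if k = n then 1 / 2 else 0) + if k = -n then 1 / 2 else 0 := by
  have h (m : Fin 2 → ℤ) : Integrable
      (fun x => 1 / 2 * UnitAddTorus.mFourier m x) torusMeasure :=
    Continuous.integrable_torus (by fun_prop)
  have e : ∀ x, UnitAddTorus.mFourier (-k) x * ((cosMode n).1 x : ℂ) =
      1 / 2 * UnitAddTorus.mFourier (n - k) x + 1 / 2 * UnitAddTorus.mFourier (-n - k) x :=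
    fun x => by
      rw [← mFourier_mul_neg, ← mFourier_mul_neg, cosMode, Complex.re_eq_add_conj,
        UnitAddTorus.mFourier_neg (n := n)]
      ring
  rw [realCoeff, mFourierCoeff_eq]
  simp only [e]
  rw [integral_add (h _) (h _), integral_const_mul, integral_const_mul, integral_mFourier,
    integral_mFourier]
  simp only [sub_eq_zero, eq_comm (b := k), mul_ite, mul_one, mul_zero]

lemma realCoeff_sinMode (n k : Fin 2 → ℤ) : realCoeff (sinMode n).1 k =
    (if k = n then -Complex.I / 2 else 0) + if k = -n then Complex.I / 2 else 0 := by
  have h (a : ℂ) (m : Fin 2 → ℤ) : Integrable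
      (fun x => a * UnitAddTorus.mFourier m x) torusMeasure :=
    Continuous.integrable_torus (by fun_prop)
  have e : ∀ x, UnitAddTorus.mFourier (-k) x * ((sinMode n).1 x : ℂ) =
      -Complex.I / 2 * UnitAddTorus.mFourier (n - k) x +
        Complex.I / 2 * UnitAddTorus.mFourier (-n - k) x :=
    fun x => by
      rw [← mFourier_mul_neg, ← mFourier_mul_neg, sinMode, Complex.im_eq_sub_conj,
        UnitAddTorus.mFourier_neg (n := n)]
      field_simp
      rw [Complex.I_sq]
      ring
  rw [realCoeff, mFourierCoeff_eq]
  simp only [e]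
  rw [integral_add (h _ _) (h _ _), integral_const_mul, integral_const_mul, integral_mFourier,
    integral_mFourier]
  simp only [sub_eq_zero, eq_comm (b := k), mul_ite, mul_one, mul_zero]

lemma IsTempered.coeff_distOfCoeff {c : (Fin 2 → ℤ) → ℂ} (hc : IsTempered c)
    (hh : IsHermitianSeq c) (n : Fin 2 → ℤ) : (distOfCoeff c).coeff n = c n := by
  have key (f : TestFunctions) (a b : ℂ) (h : ∀ k, realCoeff f.1 k =
      (if k = n then a else 0) + if k = -n then b else 0) :
      (distOfCoeff c).pair f = (a * starRingEnd ℂ (c n) + b * c n).re := by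
    rw [hc.pair_distOfCoeff]
    have h1 : HasSum (fun k => (if k = n then a * starRingEnd ℂ (c n) else 0) +
        if k = -n then b * c n else 0) (a * starRingEnd ℂ (c n) + b * c n) :=
      (hasSum_ite_eq n _).add (hasSum_ite_eq (-n) _)
    refine (HasSum.congr_fun (Complex.hasSum_re h1) fun k => ?_).tsum_eq
    rw [h k]
    congr 1
    split_ifs with h2 h3 h3
    · rw [← h2, add_mul]
      congr 2
      have h4 : -k = k := by rw [← h2] at h3; exact h3.symm
      rw [← hh k, h4]
    · simp [h2]
    · have := hh n
      rw [h3, this]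
      simp
    · simp
  rw [TorusDistribution.coeff, key _ _ _ (realCoeff_cosMode n), key _ _ _ (realCoeff_sinMode n)]
  apply Complex.ext <;> simp <;> ring

/-! ### Kernels of the potential -/

lemma norm_potMult_le (i : Fin 2) (k : Fin 2 → ℤ) : ‖potMult i k‖ ≤ ‖k‖⁻¹ := by
  rcases eq_or_ne k 0 with rfl | hk
  · simpa using norm_potMult_le_aux i 0
  · have h1 := one_le_norm_of_ne_zero hk
    refine (norm_potMult_le_aux i k).trans
      ((mul_le_mul_of_nonneg_left (heatMult_le hk) (by positivity)).trans ?_)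
    have e : 2 * Real.pi * ‖k‖ * (1 / (4 * Real.pi ^ 2 * ‖k‖ ^ 2)) =
        1 / (2 * Real.pi) * ‖k‖⁻¹ := by
      field_simp
      ring
    rw [e]
    refine mul_le_of_le_one_left (by positivity) ?_
    rw [div_le_one (by positivity)]
    linarith [Real.pi_gt_three]

lemma norm_potKernel_le (k l : Fin 2 → ℤ) : ‖potKernel k l‖ ≤ 2 * (‖k‖⁻¹ * ‖l‖⁻¹) := by
  rw [potKernel]
  refine (norm_sum_le _ _).trans ?_
  rw [Fin.sum_univ_two, norm_mul, norm_mul, two_mul]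
  gcongr <;> exact norm_potMult_le _ _

lemma inv_norm_le_rpow {κ : ℝ} (hκ : 0 ≤ κ) (k : Fin 2 → ℤ) :
    ‖k‖⁻¹ ≤ ‖k‖ ^ (κ - 1) := by
  rcases eq_or_ne k 0 with rfl | hk
  · simp only [norm_zero, inv_zero]
    exact Real.rpow_nonneg le_rfl _
  · rw [← Real.rpow_neg_one]
    exact Real.rpow_le_rpow_of_exponent_le (one_le_norm_of_ne_zero hk) (by linarith)

lemma norm_potKernel_le_rpow {κ : ℝ} (hκ : 0 ≤ κ) (k l : Fin 2 → ℤ) :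
    ‖potKernel k l‖ ≤ 2 * (‖k‖ ^ (κ - 1) * ‖l‖ ^ (κ - 1)) := by
  refine (norm_potKernel_le k l).trans ?_
  gcongr <;> exact inv_norm_le_rpow hκ _

/-! ### The renormalised square of the potential -/

lemma le_norm_of_notMem_freqBox {i : ℕ} {k : Fin 2 → ℤ} (hk : k ∉ freqBox (2 ^ i - 1)) :
    (2 : ℝ) ^ i ≤ ‖k‖ := by
  rw [mem_freqBox_iff_abs] at hk
  push Not at hk
  obtain ⟨j, hj⟩ := hk
  have h1 : ((2 ^ i : ℕ) : ℤ) ≤ |k j| := by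
    have := Nat.one_le_two_pow (n := i)
    omega
  have h2 : ((2 ^ i : ℕ) : ℝ) ≤ ‖k j‖ := by
    rw [Int.norm_eq_abs]
    exact_mod_cast h1
  push_cast at h2
  exact h2.trans (norm_le_pi_norm k j)

lemma inv_norm_le_of_notMem_freqBox {κ : ℝ} (hκ : 0 ≤ κ) {i : ℕ} {k : Fin 2 → ℤ}
    (hk : k ∉ freqBox (2 ^ i - 1)) : ‖k‖⁻¹ ≤ ((2 : ℝ) ^ (-κ)) ^ i * ‖k‖ ^ (κ - 1) := by
  have h1 := le_norm_of_notMem_freqBox hk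
  have h0 : 0 < ‖k‖ := lt_of_lt_of_le (by positivity) h1
  have h2 : 1 ≤ ((2 : ℝ) ^ (-κ)) ^ i * ‖k‖ ^ κ := by
    have h3 : ((2 : ℝ) ^ i) ^ κ ≤ ‖k‖ ^ κ := Real.rpow_le_rpow (by positivity) h1 hκ
    have h4 : ((2 : ℝ) ^ (-κ)) ^ i * ((2 : ℝ) ^ i) ^ κ = 1 := by
      rw [← Real.rpow_natCast, ← Real.rpow_natCast, ← Real.rpow_mul zero_le_two,
        ← Real.rpow_mul zero_le_two, ← Real.rpow_add two_pos]
      simp [mul_comm]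
    rw [← h4]
    gcongr
  rw [sub_eq_add_neg, Real.rpow_add h0, Real.rpow_neg_one, ← mul_assoc]
  exact le_mul_of_one_le_left (by positivity) h2

open Classical in
/-- The increment of the truncated quadratic field between two dyadic truncation levels is again a
quadratic field. -/
def incrKernel (a : (Fin 2 → ℤ) → (Fin 2 → ℤ) → ℂ) (i : ℕ) (k l : Fin 2 → ℤ) : ℂ :=
  if k ∈ freqBox (2 ^ i - 1) ∧ l ∈ freqBox (2 ^ i - 1) then 0 else a k l

lemma chaosCoeff_incrKernel {Ω : Type*} (g : (Fin 2 → ℤ) → Ω → ℝ)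
    (a : (Fin 2 → ℤ) → (Fin 2 → ℤ) → ℂ) (i : ℕ) (n : Fin 2 → ℤ) (ω : Ω) :
    chaosCoeff g (incrKernel a i) (2 ^ (i + 1) - 1) n ω =
      chaosCoeff g a (2 ^ (i + 1) - 1) n ω - chaosCoeff g a (2 ^ i - 1) n ω := by
  classical
  have hsub : freqBox (2 ^ i - 1) ⊆ freqBox (2 ^ (i + 1) - 1) :=
    freqBox_mono (Nat.sub_le_sub_right (Nat.pow_le_pow_right two_pos i.le_succ) 1)
  have h : chaosCoeff g a (2 ^ i - 1) n ω = ∑ k ∈ freqBox (2 ^ (i + 1) - 1),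
      ∑ l ∈ freqBox (2 ^ (i + 1) - 1), if k ∈ freqBox (2 ^ i - 1) ∧ l ∈ freqBox (2 ^ i - 1) then
        (if k + l = n then a k l * wickProd g k l ω else 0) else 0 := by
    rw [chaosCoeff, ← Finset.sum_subset hsub fun k _ hk => ?_]
    · refine Finset.sum_congr rfl fun k hk => ?_
      rw [← Finset.sum_subset hsub fun l _ hl => ?_]
      · exact Finset.sum_congr rfl fun l hl => (if_pos ⟨hk, hl⟩).symm
      · rw [if_neg fun h => hl h.2]
    · exact Finset.sum_eq_zero fun l _ => by rw [if_neg fun h => hk h.1]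
  rw [h, chaosCoeff, chaosCoeff, ← Finset.sum_sub_distrib]
  refine Finset.sum_congr rfl fun k _ => ?_
  rw [← Finset.sum_sub_distrib]
  refine Finset.sum_congr rfl fun l _ => ?_
  simp only [incrKernel]
  split_ifs <;> simp

lemma norm_incrKernel_potKernel_le {κ : ℝ} (hκ : 0 ≤ κ) (i : ℕ)
    (k l : Fin 2 → ℤ) : ‖incrKernel potKernel i k l‖ ≤
      2 * ((2 : ℝ) ^ (-κ)) ^ i * (‖k‖ ^ (κ - 1) * ‖l‖ ^ (κ - 1)) := by
  rw [incrKernel]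
  split_ifs with h
  · rw [norm_zero]; positivity
  · refine (norm_potKernel_le k l).trans ?_
    rw [mul_assoc]
    refine mul_le_mul_of_nonneg_left ?_ zero_le_two
    by_cases hk : k ∈ freqBox (2 ^ i - 1)
    · have hl : l ∉ freqBox (2 ^ i - 1) := fun hl => h ⟨hk, hl⟩
      rw [mul_left_comm]
      have := inv_norm_le_rpow hκ k
      have := inv_norm_le_of_notMem_freqBox hκ hl
      gcongr
    · rw [← mul_assoc]
      have := inv_norm_le_rpow hκ l
      have := inv_norm_le_of_notMem_freqBox hκ hk
      gcongr

section Construction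

variable {Ω : Type*} {g : (Fin 2 → ℤ) → Ω → ℝ}

/-- The increment of the `n`-th Fourier coefficient between the truncation levels `2 ^ i - 1` and
`2 ^ (i + 1) - 1`. -/
def chaosIncr (g : (Fin 2 → ℤ) → Ω → ℝ) (i : ℕ) (n : Fin 2 → ℤ) (ω : Ω) : ℂ :=
  chaosCoeff g (incrKernel potKernel i) (2 ^ (i + 1) - 1) n ω

/-- A weighted sum of all increments; where it is finite, the truncated fields converge to a
distribution. -/
def chaosIncrSum (g : (Fin 2 → ℤ) → Ω → ℝ) (ω : Ω) : ℝ≥0∞ :=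
  ∑' n : Fin 2 → ℤ, ∑' i, ENNReal.ofReal (((1 + ‖n‖) ^ 4)⁻¹) * ‖chaosIncr g i n ω‖ₑ

/-- The Fourier coefficients of the renormalised square of the potential, set to `0` on the null set
where the truncated fields are not known to converge. -/
def squareCoeff (g : (Fin 2 → ℤ) → Ω → ℝ) (ω : Ω) (n : Fin 2 → ℤ) : ℂ :=
  if chaosIncrSum g ω < ∞ then ∑' i, chaosIncr g i n ω else 0

lemma sum_chaosIncr (g : (Fin 2 → ℤ) → Ω → ℝ) (n : Fin 2 → ℤ) (ω : Ω) (i : ℕ) :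
    ∑ j ∈ Finset.range i, chaosIncr g j n ω = chaosCoeff g potKernel (2 ^ i - 1) n ω := by
  induction i with
  | zero =>
    have hk : potKernel 0 0 = 0 := by
      simpa using norm_potKernel_le 0 0
    simp only [Finset.range_zero, Finset.sum_empty, pow_zero, Nat.sub_self, chaosCoeff, freqBox_zero,
      Finset.sum_singleton, hk, zero_mul, ite_self]
  | succ i ih =>
    rw [Finset.sum_range_succ, ih, chaosIncr, chaosCoeff_incrKernel]
    ring

lemma summable_norm_chaosIncr {ω : Ω} (h : chaosIncrSum g ω < ∞) (n : Fin 2 → ℤ) :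
    Summable (fun i => ‖chaosIncr g i n ω‖) ∧
      ∑' i, ‖chaosIncr g i n ω‖ ≤ (chaosIncrSum g ω).toReal * (1 + ‖n‖) ^ 4 := by
  have hw : 0 < ((1 + ‖n‖) ^ 4)⁻¹ := by positivity
  have h1 : ENNReal.ofReal (((1 + ‖n‖) ^ 4)⁻¹) * ∑' i, ‖chaosIncr g i n ω‖ₑ ≤ chaosIncrSum g ω := by
    rw [← ENNReal.tsum_mul_left]
    exact ENNReal.le_tsum n
  have h2 : ∑' i, ‖chaosIncr g i n ω‖ₑ ≠ ∞ := fun h2 => by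
    rw [h2, ENNReal.mul_top (by simpa using hw)] at h1
    exact h.ne (top_le_iff.1 h1)
  have h3 : Summable fun i => ‖chaosIncr g i n ω‖ := by
    have := ENNReal.summable_toReal h2
    simpa using this
  refine ⟨h3, ?_⟩
  have h4 := ENNReal.toReal_mono h.ne h1
  rw [ENNReal.toReal_mul, ENNReal.toReal_ofReal hw.le,
    ENNReal.tsum_toReal_eq fun i => enorm_ne_top] at h4
  simp only [toReal_enorm] at h4
  rwa [inv_mul_le_iff₀ (by positivity), mul_comm] at h4

lemma isTempered_squareCoeff (g : (Fin 2 → ℤ) → Ω → ℝ) (ω : Ω) : IsTempered (squareCoeff g ω) := by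
  refine ⟨(chaosIncrSum g ω).toReal, 4, fun n => ?_⟩
  rw [squareCoeff]
  split_ifs with h
  · obtain ⟨h1, h2⟩ := summable_norm_chaosIncr h n
    exact (norm_tsum_le_tsum_norm h1).trans h2
  · rw [norm_zero]
    positivity

lemma conj_potKernel (k l : Fin 2 → ℤ) :
    starRingEnd ℂ (potKernel k l) = potKernel (-k) (-l) := by
  simp only [potKernel, map_sum, map_mul, isHermitianSeq_potMult _ k, isHermitianSeq_potMult _ l]

lemma isHermitianSeq_chaosCoeff (g : (Fin 2 → ℤ) → Ω → ℝ) {a : (Fin 2 → ℤ) → (Fin 2 → ℤ) → ℂ}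
    (ha : ∀ k l, starRingEnd ℂ (a k l) = a (-k) (-l)) (N : ℕ) (ω : Ω) :
    IsHermitianSeq fun n => chaosCoeff g a N n ω := fun n => by
  have hw : ∀ k l, starRingEnd ℂ (wickProd g k l ω) = wickProd g (-k) (-l) ω := fun k l => by
    have : -k + -l = 0 ↔ k + l = 0 := by rw [← neg_add, neg_eq_zero]
    simp only [wickProd, map_sub, map_mul, conj_fourierMode, apply_ite (starRingEnd ℂ), map_one,
      map_zero, this]
  simp only [chaosCoeff, map_sum]
  have hs : ∀ k, -k ∈ freqBox N ↔ k ∈ freqBox N := fun k => neg_mem_freqBox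
  rw [← sum_neg_eq_of_symm hs]
  refine Finset.sum_congr rfl fun k _ => ?_
  rw [← sum_neg_eq_of_symm hs]
  refine Finset.sum_congr rfl fun l _ => ?_
  have : -k + -l = -n ↔ k + l = n := by rw [← neg_add, neg_inj]
  simp only [this, apply_ite (starRingEnd ℂ), map_mul, ha, hw, map_zero]

lemma isHermitianSeq_squareCoeff (g : (Fin 2 → ℤ) → Ω → ℝ) (ω : Ω) :
    IsHermitianSeq (squareCoeff g ω) := fun n => by
  simp only [squareCoeff]
  split_ifs
  · rw [Complex.conj_tsum]
    refine tsum_congr fun i => ?_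
    refine isHermitianSeq_chaosCoeff g (fun k l => ?_) _ ω n
    simp only [incrKernel, neg_mem_freqBox, apply_ite (starRingEnd ℂ), map_zero, conj_potKernel]
  · simp

/-- The renormalised square of the potential, the limit of truncated quadratic fields. -/
def renormSquare (g : (Fin 2 → ℤ) → Ω → ℝ) (ω : Ω) : TorusDistribution :=
  distOfCoeff (squareCoeff g ω)

variable [MeasurableSpace Ω] {μ : Measure Ω} [IsProbabilityMeasure μ]

/-- First moments of a single Fourier coefficient of a quadratic field. -/
lemma IsStdGaussianFamily.lintegral_chaosCoeff_le (hg : IsStdGaussianFamily μ g)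
    {a : (Fin 2 → ℤ) → (Fin 2 → ℤ) → ℂ} {η : ℝ} (hη : 0 < η)
    (ha : ∀ k l, ‖a k l‖ ≤ η * (‖k‖ ^ ((1 / 10 : ℝ) - 1) * ‖l‖ ^ ((1 / 10 : ℝ) - 1)))
    (N : ℕ) (n : Fin 2 → ℤ) :
    ∫⁻ ω, ‖chaosCoeff g a N n ω‖ₑ ∂μ ≤
      ENNReal.ofReal (η * (1 + 32 * chaosConst 1 * pairConst (1 / 10)) * (1 + ‖n‖)) := by
  classical
  set R : ℕ := ⌈‖n‖⌉₊ + 1 with hR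
  have hnR : n ∈ freqBox R := mem_freqBox.2 ((Nat.le_ceil _).trans (by rw [hR]; push_cast; linarith))
  have hR2 : (R : ℝ) ≤ 2 * (1 + ‖n‖) := by
    have := (Nat.ceil_lt_add_one (norm_nonneg n)).le
    rw [hR]
    push_cast
    linarith [norm_nonneg n]
  have hR1 : (1 : ℝ) ≤ R := by rw [hR]; push_cast; linarith [Nat.cast_nonneg (α := ℝ) ⌈‖n‖⌉₊]
  have h := hg.lintegral_sum_chaosCoeff_le (κ := 1 / 10) (by norm_num) le_rfl ha
    (φ := fun m => if m = n then 1 else 0) (fun m => by split_ifs <;> simp) one_ne_zero N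
    (R := R) (by omega)
  simp only [ite_mul, one_mul, zero_mul, Finset.sum_ite_eq', if_pos hnR] at h
  have hc := chaosConst_nonneg 1
  have hp := pairConst_nonneg (1 / 10)
  have hpt : ∀ ω, ‖chaosCoeff g a N n ω‖ₑ ≤ ENNReal.ofReal η +
      ENNReal.ofReal η⁻¹ * ‖chaosCoeff g a N n ω‖ₑ ^ (2 * 1) := fun ω => by
    rw [← ofReal_norm, ← ENNReal.ofReal_pow (norm_nonneg _),
      ← ENNReal.ofReal_mul (by positivity), ← ENNReal.ofReal_add hη.le (by positivity)]
    refine ENNReal.ofReal_le_ofReal ?_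
    set x := ‖chaosCoeff g a N n ω‖
    have e : η + η⁻¹ * x ^ (2 * 1) - x = η⁻¹ * ((x - η / 2) ^ 2 + 3 / 4 * η ^ 2) := by
      field_simp
      ring
    have : 0 ≤ η⁻¹ * ((x - η / 2) ^ 2 + 3 / 4 * η ^ 2) := by positivity
    linarith
  refine (lintegral_mono hpt).trans ?_
  rw [lintegral_add_left measurable_const, lintegral_const, measure_univ, mul_one,
    lintegral_const_mul _ ((measurable_chaosCoeff hg.measurable a N n).enorm.pow_const _)]
  refine (add_le_add_right (mul_le_mul_right h _) _).trans ?_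
  rw [← ENNReal.ofReal_mul (by positivity), ← ENNReal.ofReal_add hη.le (by positivity)]
  refine ENNReal.ofReal_le_ofReal ?_
  have hRp : (R : ℝ) ^ (9 * (1 / 10 : ℝ)) ≤ 2 * (1 + ‖n‖) := by
    refine le_trans ?_ hR2
    conv_rhs => rw [← Real.rpow_one (R : ℝ)]
    exact Real.rpow_le_rpow_of_exponent_le hR1 (by norm_num)
  have hn := norm_nonneg n
  calc η + η⁻¹ * (2 ^ (1 + 1) * chaosConst 1 *
        (4 * (η ^ 2 * (pairConst (1 / 10) * (R : ℝ) ^ (9 * (1 / 10 : ℝ))))) ^ 1)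
      = η * (1 + 16 * chaosConst 1 * pairConst (1 / 10) * (R : ℝ) ^ (9 * (1 / 10 : ℝ))) := by
        field_simp
        ring
    _ ≤ η * ((1 + ‖n‖) + 16 * chaosConst 1 * pairConst (1 / 10) * (2 * (1 + ‖n‖))) := by
        gcongr
        linarith
    _ = _ := by ring

lemma IsStdGaussianFamily.ae_chaosIncrSum_lt_top (hg : IsStdGaussianFamily μ g) :
    ∀ᵐ ω ∂μ, chaosIncrSum g ω < ∞ := by
  have hmeas : ∀ n i, Measurable fun ω =>
      ENNReal.ofReal (((1 + ‖n‖) ^ 4)⁻¹) * ‖chaosIncr g i n ω‖ₑ := fun n i =>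
    (measurable_chaosCoeff hg.measurable _ _ n).enorm.const_mul _
  refine ae_lt_top (Measurable.tsum fun n => Measurable.tsum fun i => hmeas n i) (ne_of_lt ?_)
  simp only [chaosIncrSum]
  rw [lintegral_tsum fun n => (Measurable.tsum fun i => hmeas n i).aemeasurable]
  simp only [lintegral_tsum fun i => (hmeas _ i).aemeasurable]
  set q : ℝ := 2 ^ (-(1 / 10) : ℝ) with hq
  have hq0 : 0 < q := by positivity
  have hq1 : q < 1 := Real.rpow_lt_one_of_one_lt_of_neg one_lt_two (by norm_num)
  set C : ℝ := 1 + 32 * chaosConst 1 * pairConst (1 / 10)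
  have hC : 0 ≤ C := by
    have := chaosConst_nonneg 1
    have := pairConst_nonneg (1 / 10)
    positivity
  have hb : ∀ n i, ∫⁻ ω, ENNReal.ofReal (((1 + ‖n‖) ^ 4)⁻¹) * ‖chaosIncr g i n ω‖ₑ ∂μ ≤
      ENNReal.ofReal (((1 + ‖n‖) ^ 3)⁻¹) * ENNReal.ofReal (2 * C * q ^ i) := fun n i => by
    have hm : Measurable (chaosIncr g i n) := measurable_chaosCoeff hg.measurable _ _ n
    rw [lintegral_const_mul _ hm.enorm]
    refine (mul_le_mul_right (hg.lintegral_chaosCoeff_le (η := 2 * q ^ i) (by positivity)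
      (norm_incrKernel_potKernel_le (by norm_num) i) _ n) _).trans (le_of_eq ?_)
    rw [← ENNReal.ofReal_mul (by positivity), ← ENNReal.ofReal_mul (by positivity)]
    congr 1
    have : 1 + ‖n‖ ≠ 0 := by positivity
    field_simp
    rfl
  refine (ENNReal.tsum_le_tsum fun n => ENNReal.tsum_le_tsum fun i => hb n i).trans_lt ?_
  simp only [ENNReal.tsum_mul_left, ENNReal.tsum_mul_right]
  rw [← ENNReal.ofReal_tsum_of_nonneg (fun i => by positivity)
    ((summable_geometric_of_lt_one hq0.le hq1).mul_left _),
    ← ENNReal.ofReal_tsum_of_nonneg (fun n => by positivity) summable_one_add_norm_pow]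
  exact ENNReal.mul_lt_top ENNReal.ofReal_lt_top ENNReal.ofReal_lt_top

lemma measurable_squareCoeff (hg : ∀ k, Measurable (g k)) (n : Fin 2 → ℤ) :
    Measurable fun ω => squareCoeff g ω n := by
  have h1 : ∀ n i, Measurable (chaosIncr g i n) := fun n i => measurable_chaosCoeff hg _ _ n
  have h2 : Measurable (chaosIncrSum g) :=
    Measurable.tsum fun n => Measurable.tsum fun i => (h1 n i).enorm.const_mul _
  refine Measurable.ite (measurableSet_lt h2 measurable_const) ?_ measurable_const
  exact Measurable.tsum fun i => h1 n i

lemma measurable_pair_renormSquare (hg : ∀ k, Measurable (g k)) (f : TestFunctions) :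
    Measurable fun ω => (renormSquare g ω).pair f := by
  simp only [renormSquare, (isTempered_squareCoeff g _).pair_distOfCoeff]
  refine Measurable.tsum fun k => Complex.measurable_re.comp (Measurable.const_mul ?_ _)
  exact Complex.continuous_conj.measurable.comp (measurable_squareCoeff hg k)

lemma IsStdGaussianFamily.ae_tendsto_coeff_renormSquare (hg : IsStdGaussianFamily μ g) :
    ∀ᵐ ω ∂μ, ∀ n, Tendsto (fun i => chaosCoeff g potKernel (2 ^ i - 1) n ω) atTop
      (𝓝 ((renormSquare g ω).coeff n)) := by
  filter_upwards [hg.ae_chaosIncrSum_lt_top] with ω hω n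
  rw [renormSquare, (isTempered_squareCoeff g ω).coeff_distOfCoeff (isHermitianSeq_squareCoeff g ω),
    squareCoeff, if_pos hω]
  have h := (summable_norm_chaosIncr hω n).1.of_norm.hasSum.tendsto_sum_nat
  simpa only [sum_chaosIncr] using h

end Construction

/-! ### Fourier coefficients of the mollifier -/

/-- The fundamental domain `(0, 1]²` of `ℤ²`, translated by `n`. -/
def unitCell (n : Fin 2 → ℤ) : Set (Fin 2 → ℝ) := {v | ∀ i, v i ∈ Set.Ioc (n i : ℝ) (n i + 1)}

lemma measurableSet_unitCell (n : Fin 2 → ℤ) : MeasurableSet (unitCell n) :=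
  MeasurableSet.congr (MeasurableSet.univ_pi fun i => measurableSet_Ioc (a := (n i : ℝ))
    (b := (n i : ℝ) + 1)) (by ext v; simp [unitCell])

lemma mem_unitCell {n : Fin 2 → ℤ} {v : Fin 2 → ℝ} :
    v ∈ unitCell n ↔ n = fun i => ⌈v i⌉ - 1 := by
  simp only [unitCell, Set.mem_ofPred_eq, Set.mem_Ioc, funext_iff]
  refine forall_congr' fun i => ?_
  rw [eq_sub_iff_add_eq, eq_comm, Int.ceil_eq_iff]
  push_cast
  simp

lemma iUnion_unitCell : ⋃ n, unitCell n = Set.univ :=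
  Set.eq_univ_of_forall fun _ => Set.mem_iUnion.2 ⟨_, mem_unitCell.2 rfl⟩

lemma pairwise_disjoint_unitCell : Pairwise (Function.onFun Disjoint unitCell) := fun _ _ hmn =>
  Set.disjoint_left.2 fun _ hm hn => hmn ((mem_unitCell.1 hm).trans (mem_unitCell.1 hn).symm)

lemma setIntegral_unitCell {E : Type*} [NormedAddCommGroup E] [NormedSpace ℝ E]
    (F : (Fin 2 → ℝ) → E) (n : Fin 2 → ℤ) :
    ∫ v in unitCell n, F v = ∫ v in unitCell 0, F (v + fun i => (n i : ℝ)) := by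
  have h := (measurePreserving_add_right (volume : Measure (Fin 2 → ℝ))
    fun i => (n i : ℝ)).setIntegral_preimage_emb (MeasurableEquiv.addRight _).measurableEmbedding
    F (unitCell n)
  rw [← h]
  congr 2
  ext v
  simp [unitCell, add_comm]

/-- Unfolding: the integral over a unit cell of a sum over lattice translates is the integral over
the whole plane. -/
lemma integral_unitCell_tsum {F : (Fin 2 → ℝ) → ℂ} (hF : Integrable F) :
    ∫ v in unitCell 0, ∑' n : Fin 2 → ℤ, F (v + fun i => (n i : ℝ)) = ∫ v, F v := by
  have h1 : HasSum (fun n => ∫ v in unitCell n, ‖F v‖) (∫ v in ⋃ n, unitCell n, ‖F v‖) :=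
    hasSum_integral_iUnion measurableSet_unitCell pairwise_disjoint_unitCell hF.norm.integrableOn
  have h2 : HasSum (fun n => ∫ v in unitCell n, F v) (∫ v in ⋃ n, unitCell n, F v) :=
    hasSum_integral_iUnion measurableSet_unitCell pairwise_disjoint_unitCell hF.integrableOn
  rw [iUnion_unitCell, setIntegral_univ] at h2
  simp_rw [setIntegral_unitCell F] at h2
  have h1' : Summable fun n : Fin 2 → ℤ => ∫ v in unitCell 0, ‖F (v + fun i => (n i : ℝ))‖ :=
    h1.summable.congr fun n => setIntegral_unitCell (fun v => ‖F v‖) n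
  have h3 := hasSum_integral_of_summable_integral_norm (μ := volume.restrict (unitCell 0))
    (F := fun (n : Fin 2 → ℤ) v => F (v + fun i => (n i : ℝ)))
    (fun n => (hF.comp_add_right _).integrableOn) h1'
  exact h3.unique h2

lemma Mollifier.continuous (ρ : Mollifier) : Continuous ρ.toFun := ρ.contDiff.continuous

lemma Mollifier.integrable_mul (ρ : Mollifier) {f : (Fin 2 → ℝ) → ℂ} (hf : Continuous f) :
    Integrable fun v => f v * (ρ.toFun v : ℂ) := by
  refine Continuous.integrable_of_hasCompactSupport
    (hf.mul (Complex.continuous_ofReal.comp ρ.continuous)) ?_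
  exact (ρ.hasCompactSupport.comp_left (g := fun t : ℝ => (t : ℂ)) Complex.ofReal_zero).mul_left

/-- The Fourier coefficients of `ρ_ε` are samples of the Fourier transform of `ρ`. -/
lemma mollCoeff_eq_integral (ρ : Mollifier) {ε : ℝ} (hε : 0 < ε) (k : Fin 2 → ℤ) :
    mollCoeff ρ ε k =
      ∫ v, UnitAddTorus.mFourier (-k) (toTorus (ε • v)) * (ρ.toFun v : ℂ) := by
  let F : (Fin 2 → ℝ) → ℂ := fun v =>
    UnitAddTorus.mFourier (-k) (toTorus v) * (ρ.rescale ε v : ℂ)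
  have hcomp : ∀ v, F (ε • v) =
      (ε⁻¹ ^ 2 : ℝ) • (UnitAddTorus.mFourier (-k) (toTorus (ε • v)) * (ρ.toFun v : ℂ)) := fun v => by
    simp only [F, Mollifier.rescale, smul_smul, inv_mul_cancel₀ hε.ne', one_smul,
      Complex.real_smul]
    push_cast
    ring
  have hcont : Continuous fun v => UnitAddTorus.mFourier (-k) (toTorus (ε • v)) :=
    (ContinuousMap.continuous _).comp
      (toTorus_isOpenQuotientMap.continuous.comp (continuous_const_smul ε))
  have hF : Integrable F := by
    rw [← integrable_comp_smul_iff (μ := volume) F hε.ne']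
    simp only [hcomp]
    exact (ρ.integrable_mul hcont).smul (ε⁻¹ ^ 2 : ℝ)
  have h1 : mollCoeff ρ ε k = ∫ v in unitCell 0, ∑' n : Fin 2 → ℤ, F (v + fun i => (n i : ℝ)) := by
    rw [mollCoeff, realCoeff, UnitAddTorus.mFourierCoeff_eq_integral _ _ 0]
    have hs : {x : Fin 2 → ℝ | ∀ i, x i ∈ Set.Ioc ((0 : Fin 2 → ℝ) i) ((0 : Fin 2 → ℝ) i + 1)} =
        unitCell 0 := by
      simp [unitCell]
    rw [hs]
    refine setIntegral_congr_fun (measurableSet_unitCell 0) fun v _ => ?_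
    change UnitAddTorus.mFourier (-k) (toTorus v) * ((periodize (ρ.rescale ε) (toTorus v) : ℝ) : ℂ)
      = _
    rw [periodize_toTorus, Complex.ofReal_tsum, ← tsum_mul_left]
    refine tsum_congr fun n => ?_
    simp only [F]
    rw [(toTorus_eq_iff v _).2 ⟨n, rfl⟩]
  rw [h1, integral_unitCell_tsum hF]
  have h2 := Measure.integral_comp_smul (volume : Measure (Fin 2 → ℝ)) F ε
  simp only [hcomp] at h2
  rw [integral_smul, Module.finrank_fin_fun, abs_of_pos (by positivity)] at h2
  have h3 : (ε⁻¹ ^ 2 : ℝ) ≠ 0 := by positivity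
  rw [← inv_pow] at h2
  exact (smul_right_injective ℂ h3 h2).symm

/-- The `L¹` norms entering the bounds on the Fourier transform of the mollifier. -/
def mollConst (ρ : Mollifier) : ℝ :=
  1 + (∫ v, |ρ.toFun v|) + (∫ v, 4 * Real.pi * ‖v‖ * |ρ.toFun v|) +
    ∑ i : Fin 2, ∫ v, ‖fderiv ℝ ρ.toFun v (Pi.single i 1)‖

lemma mollConst_summands (ρ : Mollifier) : 1 ≤ mollConst ρ ∧ (∫ v, |ρ.toFun v|) + 1 ≤ mollConst ρ ∧
    (∫ v, 4 * Real.pi * ‖v‖ * |ρ.toFun v|) ≤ mollConst ρ ∧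
    ∀ i : Fin 2, ∫ v, ‖fderiv ℝ ρ.toFun v (Pi.single i 1)‖ ≤ mollConst ρ := by
  have h1 : 0 ≤ ∫ v, |ρ.toFun v| := integral_nonneg fun _ => abs_nonneg _
  have h2 : 0 ≤ ∫ v, 4 * Real.pi * ‖v‖ * |ρ.toFun v| := integral_nonneg fun _ => by positivity
  have h3 : ∀ i : Fin 2, 0 ≤ ∫ v, ‖fderiv ℝ ρ.toFun v (Pi.single i 1)‖ := fun i =>
    integral_nonneg fun _ => norm_nonneg _
  have h4 := Finset.sum_nonneg (s := Finset.univ) fun i _ => h3 i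
  rw [mollConst]
  refine ⟨by linarith, by linarith, by linarith, fun i => ?_⟩
  have h5 := Finset.single_le_sum (fun i _ => h3 i) (Finset.mem_univ i)
  linarith

lemma norm_mollCoeff_le (ρ : Mollifier) {ε : ℝ} (hε : 0 < ε) (k : Fin 2 → ℤ) :
    ‖mollCoeff ρ ε k‖ ≤ mollConst ρ := by
  rw [mollCoeff_eq_integral ρ hε]
  refine (norm_integral_le_integral_norm _).trans ?_
  simp only [norm_mul, norm_mFourier_apply, one_mul, Complex.norm_real, Real.norm_eq_abs]
  linarith [(mollConst_summands ρ).2.1]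

lemma norm_one_sub_mollCoeff_le (ρ : Mollifier) {ε : ℝ} (hε : 0 < ε) (k : Fin 2 → ℤ) :
    ‖1 - mollCoeff ρ ε k‖ ≤ mollConst ρ * (ε * ‖k‖) := by
  have hcont : Continuous fun v => UnitAddTorus.mFourier (-k) (toTorus (ε • v)) :=
    (ContinuousMap.continuous _).comp
      (toTorus_isOpenQuotientMap.continuous.comp (continuous_const_smul ε))
  have h1 : (1 : ℂ) = ∫ v, 1 * (ρ.toFun v : ℂ) := by
    simp only [one_mul]
    rw [integral_complex_ofReal, ρ.integral_eq_one, Complex.ofReal_one]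
  rw [mollCoeff_eq_integral ρ hε, h1, ← integral_sub (ρ.integrable_mul continuous_const)
    (ρ.integrable_mul hcont)]
  have hint : Integrable fun v : Fin 2 → ℝ => 4 * Real.pi * ‖v‖ * |ρ.toFun v| :=
    Continuous.integrable_of_hasCompactSupport
      ((continuous_const.mul continuous_norm).mul ρ.continuous.abs)
      ((ρ.hasCompactSupport.comp_left (g := fun t : ℝ => |t|) abs_zero).mul_left)
  refine (norm_integral_le_of_norm_le (hint.const_mul (ε * ‖k‖))
    (Eventually.of_forall fun v => ?_)).trans ?_
  · rw [← sub_mul, norm_mul, Complex.norm_real, Real.norm_eq_abs, ← mul_assoc]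
    refine mul_le_mul_of_nonneg_right ?_ (abs_nonneg _)
    rw [mFourier_toTorus, norm_sub_rev, mul_comm _ Complex.I]
    refine (Real.norm_exp_I_mul_ofReal_sub_one_le).trans ?_
    refine ((freqForm (-k)).le_opNorm _).trans ?_
    have := norm_freqForm_le (-k)
    rw [norm_neg] at this
    rw [norm_smul, Real.norm_of_nonneg hε.le]
    calc ‖freqForm (-k)‖ * (ε * ‖v‖) ≤ 4 * Real.pi * ‖k‖ * (ε * ‖v‖) := by gcongr
      _ = _ := by ring
  · rw [integral_const_mul, mul_comm]
    have := (mollConst_summands ρ).2.2.1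
    gcongr

/-- Integration by parts: the Fourier transform of the mollifier decays. -/
lemma mul_norm_mollCoeff_le (ρ : Mollifier) {ε : ℝ} (hε : 0 < ε) (k : Fin 2 → ℤ) :
    ε * ‖k‖ * ‖mollCoeff ρ ε k‖ ≤ mollConst ρ := by
  have hd : Differentiable ℝ ρ.toFun := ρ.contDiff.differentiable (by simp)
  have hcoord : ∀ i, ε * |(k i : ℝ)| * ‖mollCoeff ρ ε k‖ ≤ mollConst ρ := fun i => by
    let e : (Fin 2 → ℝ) → ℂ := fun v => UnitAddTorus.mFourier (-k) (toTorus (ε • v))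
    let r : (Fin 2 → ℝ) → ℂ := fun v => (ρ.toFun v : ℂ)
    have he : ∀ v, HasFDerivAt e ((Complex.exp (freqForm (-k) (ε • v) * Complex.I) •
        ((ε • freqForm (-k)).smulRight Complex.I)) : (Fin 2 → ℝ) →L[ℝ] ℂ) v := fun v => by
      have h1 : HasFDerivAt (fun v => ((freqForm (-k) (ε • v) : ℝ) : ℂ) * Complex.I)
          ((ε • freqForm (-k)).smulRight Complex.I : (Fin 2 → ℝ) →L[ℝ] ℂ) v := by
        have h2 := ((ε • freqForm (-k)).smulRight Complex.I : (Fin 2 → ℝ) →L[ℝ] ℂ).hasFDerivAt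
          (x := v)
        refine h2.congr_of_eventuallyEq (Eventually.of_forall fun w => ?_)
        simp
      have h3 := h1.cexp
      refine h3.congr_of_eventuallyEq (Eventually.of_forall fun w => ?_)
      simp only [e, mFourier_toTorus]
    have hr : ∀ v, HasFDerivAt r (Complex.ofRealCLM.comp (fderiv ℝ ρ.toFun v)) v := fun v =>
      Complex.ofRealCLM.hasFDerivAt.comp v (hd v).hasFDerivAt
    have hec : Continuous e := continuous_iff_continuousAt.2 fun v => (he v).continuousAt
    have hed : ∀ v, fderiv ℝ e v (Pi.single i 1) =
        (-(2 * Real.pi * ε * k i) * Complex.I : ℂ) * e v := fun v => by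
      rw [(he v).fderiv]
      simp only [smul_apply, ContinuousLinearMap.smulRight_apply, e,
        mFourier_toTorus, freqForm_apply]
      simp [Pi.single_apply]
      ring
    have hrd : ∀ v, fderiv ℝ r v (Pi.single i 1) =
        ((fderiv ℝ ρ.toFun v (Pi.single i 1) : ℝ) : ℂ) := fun v => by
      rw [(hr v).fderiv]
      rfl
    have hdc : Continuous fun v => fderiv ℝ ρ.toFun v (Pi.single i 1) :=
      (ρ.contDiff.continuous_fderiv (by simp)).clm_apply continuous_const
    have hds : HasCompactSupport fun v => fderiv ℝ ρ.toFun v (Pi.single i 1) :=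
      ρ.hasCompactSupport.fderiv_apply (𝕜 := ℝ) _
    have hparts := integral_mul_fderiv_eq_neg_fderiv_mul_of_integrable (μ := volume)
      (f := r) (g := e) (v := Pi.single i (1 : ℝ)) ?_ ?_ ?_
      (fun v _ => (hr v).differentiableAt) (fun v _ => (he v).differentiableAt)
    · simp only [hed, hrd] at hparts
      have h5 : ∫ v, r v * ((-(2 * Real.pi * ε * k i) * Complex.I : ℂ) * e v) =
          (-(2 * Real.pi * ε * k i) * Complex.I : ℂ) * mollCoeff ρ ε k := by
        rw [mollCoeff_eq_integral ρ hε, ← integral_const_mul]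
        refine integral_congr_ae (Eventually.of_forall fun v => ?_)
        simp only [r, e]
        ring
      rw [h5] at hparts
      have h6 := congrArg norm hparts
      rw [norm_neg] at h6
      have h7 : ‖∫ v, ((fderiv ℝ ρ.toFun v (Pi.single i 1) : ℝ) : ℂ) * e v‖ ≤ mollConst ρ := by
        refine (norm_integral_le_integral_norm _).trans (le_trans (le_of_eq ?_)
          ((mollConst_summands ρ).2.2.2 i))
        refine integral_congr_ae (Eventually.of_forall fun v => ?_)
        simp only [e, norm_mul, norm_mFourier_apply, mul_one, Complex.norm_real]
      rw [← h6] at h7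
      have h8 : ‖(-(2 * Real.pi * ε * k i) * Complex.I : ℂ)‖ = 2 * Real.pi * (ε * |(k i : ℝ)|) := by
        simp [abs_of_pos Real.pi_pos, abs_of_pos hε]
        ring
      rw [norm_mul, h8] at h7
      refine le_trans ?_ h7
      have h9 : 1 ≤ 2 * Real.pi := by linarith [Real.pi_gt_three]
      have h10 : 0 ≤ ε * |(k i : ℝ)| := by positivity
      exact mul_le_mul_of_nonneg_right (le_mul_of_one_le_left h10 h9) (norm_nonneg _)
    · simp only [hrd]
      have hds' : HasCompactSupport fun v => ((fderiv ℝ ρ.toFun v (Pi.single i 1) : ℝ) : ℂ) :=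
        hds.comp_left Complex.ofReal_zero
      exact Continuous.integrable_of_hasCompactSupport
        ((Complex.continuous_ofReal.comp hdc).mul hec) hds'.mul_right
    · simp only [hed]
      refine ((ρ.integrable_mul (hec.const_smul
        (-(2 * Real.pi * ε * k i) * Complex.I : ℂ)))).congr (Eventually.of_forall fun v => ?_)
      simp only [r, Pi.smul_apply, smul_eq_mul]
      ring
    · refine (ρ.integrable_mul hec).congr (Eventually.of_forall fun v => ?_)
      simp only [r]
      ring
  obtain ⟨i, hi⟩ : ∃ i, ‖k‖ = |(k i : ℝ)| := by
    obtain ⟨i, hi⟩ := Finite.exists_max fun i => ‖k i‖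
    refine ⟨i, le_antisymm ((pi_norm_le_iff_of_nonneg (norm_nonneg _)).2 hi)
      (norm_le_pi_norm k i)⟩
  rw [hi]
  exact hcoord i

lemma norm_one_sub_mollCoeff_le_rpow (ρ : Mollifier) {ε : ℝ} (hε : 0 < ε) {κ : ℝ} (hκ : 0 ≤ κ)
    (hκ' : κ ≤ 1) (k : Fin 2 → ℤ) :
    ‖1 - mollCoeff ρ ε k‖ ≤ 2 * mollConst ρ * (ε * ‖k‖) ^ κ := by
  have hC := (mollConst_summands ρ).1
  have hx : 0 ≤ ε * ‖k‖ := by positivity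
  rcases le_total (ε * ‖k‖) 1 with h | h
  · refine (norm_one_sub_mollCoeff_le ρ hε k).trans ?_
    have h2 : ε * ‖k‖ ≤ (ε * ‖k‖) ^ κ := Real.self_le_rpow_of_le_one hx h hκ'
    have : 0 ≤ (ε * ‖k‖) ^ κ := by positivity
    nlinarith
  · have h1 : ‖1 - mollCoeff ρ ε k‖ ≤ 2 * mollConst ρ := by
      refine (norm_sub_le _ _).trans ?_
      rw [norm_one]
      linarith [norm_mollCoeff_le ρ hε k]
    exact h1.trans (le_mul_of_one_le_right (by positivity) (Real.one_le_rpow h hκ))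

/-- The kernel of the difference between the renormalised square and its regularisation is small,
at the price of a small power of the frequencies. -/
lemma norm_potKernel_mul_one_sub_le (ρ : Mollifier) {ε : ℝ} (hε : 0 < ε) {κ : ℝ} (hκ : 0 ≤ κ)
    (hκ' : κ ≤ 1) (k l : Fin 2 → ℤ) :
    ‖potKernel k l * (1 - mollCoeff ρ ε k * mollCoeff ρ ε l)‖ ≤
      8 * mollConst ρ ^ 2 * ε ^ κ * (‖k‖ ^ (κ - 1) * ‖l‖ ^ (κ - 1)) := by
  have hC := (mollConst_summands ρ).1
  rcases eq_or_ne k 0 with rfl | hk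
  · have h0 : potKernel 0 l = 0 := by simpa using norm_potKernel_le 0 l
    rw [h0, zero_mul, norm_zero]
    positivity
  rcases eq_or_ne l 0 with rfl | hl
  · have h0 : potKernel k 0 = 0 := by simpa using norm_potKernel_le k 0
    rw [h0, zero_mul, norm_zero]
    positivity
  have hk1 := one_le_norm_of_ne_zero hk
  have hl1 := one_le_norm_of_ne_zero hl
  have hk2 : (ε * ‖k‖) ^ κ ≤ ε ^ κ * (‖k‖ ^ κ * ‖l‖ ^ κ) := by
    rw [Real.mul_rpow hε.le (norm_nonneg _)]
    gcongr
    exact le_mul_of_one_le_right (by positivity) (Real.one_le_rpow hl1 hκ)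
  have hl2 : (ε * ‖l‖) ^ κ ≤ ε ^ κ * (‖k‖ ^ κ * ‖l‖ ^ κ) := by
    rw [Real.mul_rpow hε.le (norm_nonneg _)]
    gcongr
    exact le_mul_of_one_le_left (by positivity) (Real.one_le_rpow hk1 hκ)
  set X := ε ^ κ * (‖k‖ ^ κ * ‖l‖ ^ κ)
  have hX : 0 ≤ X := by positivity
  have hrr : ‖1 - mollCoeff ρ ε k * mollCoeff ρ ε l‖ ≤ 4 * mollConst ρ ^ 2 * X := by
    have e : 1 - mollCoeff ρ ε k * mollCoeff ρ ε l =
        (1 - mollCoeff ρ ε k) + mollCoeff ρ ε k * (1 - mollCoeff ρ ε l) := by ring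
    rw [e]
    refine (norm_add_le _ _).trans ?_
    rw [norm_mul]
    calc _ ≤ 2 * mollConst ρ * X + mollConst ρ * (2 * mollConst ρ * X) := by
          have h1 := (norm_one_sub_mollCoeff_le_rpow ρ hε hκ hκ' k)
          have h2 := (norm_one_sub_mollCoeff_le_rpow ρ hε hκ hκ' l)
          have h3 := norm_mollCoeff_le ρ hε k
          refine add_le_add (h1.trans ?_) (mul_le_mul h3 (h2.trans ?_) (norm_nonneg _)
            (by positivity)) <;> gcongr
      _ ≤ _ := by nlinarith [mul_nonneg (mul_nonneg (sub_nonneg.2 hC)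
            (zero_le_one.trans hC)) hX]
  rw [norm_mul]
  have hp : ∀ m : Fin 2 → ℤ, 1 ≤ ‖m‖ → ‖m‖ ^ (κ - 1) = ‖m‖ ^ κ * ‖m‖⁻¹ := fun m hm => by
    rw [sub_eq_add_neg, Real.rpow_add (by linarith), Real.rpow_neg_one]
  calc _ ≤ 2 * (‖k‖⁻¹ * ‖l‖⁻¹) * (4 * mollConst ρ ^ 2 * X) :=
        mul_le_mul (norm_potKernel_le k l) hrr (norm_nonneg _) (by positivity)
    _ = _ := by
        rw [hp k hk1, hp l hl1]
        ring

/-! ### The renormalisation constant as a lattice sum -/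

lemma potKernel_neg_self (k : Fin 2 → ℤ) :
    potKernel k (-k) = ((4 * Real.pi ^ 2 * freqSq k * heatMult k ^ 2 : ℝ) : ℂ) := by
  simp only [potKernel, isHermitianSeq_potMult _ k, Fin.sum_univ_two, Complex.mul_conj']
  have h (j : Fin 2) : ‖2 * Real.pi * Complex.I * k j * heatMult k‖ ^ 2 =
      4 * Real.pi ^ 2 * (k j : ℝ) ^ 2 * heatMult k ^ 2 := by
    simp only [norm_mul, Complex.norm_ofNat, Complex.norm_real, Complex.norm_I, mul_one, mul_pow,
      Real.norm_eq_abs, sq_abs, Complex.norm_intCast]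
    ring
  have h0 : ‖potMult 0 k‖ ^ 2 = _ := h 1
  have h1 : ‖potMult 1 k‖ ^ 2 = 4 * Real.pi ^ 2 * (k 0 : ℝ) ^ 2 * heatMult k ^ 2 := by
    rw [← norm_neg, show -potMult 1 k = 2 * Real.pi * Complex.I * k 0 * heatMult k by
      simp [potMult]]
    exact h 0
  rw [← Complex.ofReal_pow, ← Complex.ofReal_pow, h0, h1, ← Complex.ofReal_add]
  congr 1
  simp only [freqSq, Fin.sum_univ_two]
  ring

lemma norm_potMult_le_one (i : Fin 2) (k : Fin 2 → ℤ) : ‖potMult i k‖ ≤ 1 := by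
  refine (norm_potMult_le i k).trans ?_
  rcases eq_or_ne k 0 with rfl | hk
  · simp
  · exact inv_le_one_of_one_le₀ (one_le_norm_of_ne_zero hk)

/-- The value of `A_ε · A_ε` at the origin as an absolutely convergent double series. -/
lemma hasSum_potentialSq_zero (ρ : Mollifier) (ε : ℝ) (u : TorusDistribution) :
    HasSum (fun p : (Fin 2 → ℤ) × (Fin 2 → ℤ) => potKernel p.1 p.2 *
      (mollCoeff ρ ε p.1 * mollCoeff ρ ε p.2) * (u.coeff p.1 * u.coeff p.2))
      (potentialSq ρ ε u 0 : ℂ) := by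
  have h0 : ∀ k : Fin 2 → ℤ, UnitAddTorus.mFourier k (0 : Torus2) = 1 := fun k => by
    simp [UnitAddTorus.mFourier]
  have h1 : ∀ i, (potential ρ ε u i 0 : ℂ) = ∑' k, potCoeff ρ ε u i k := fun i => by
    rw [potential_eq, (isHermitianSeq_potCoeff ρ ε u i).fourierSum_re, fourierSum]
    simp [h0]
  have h2 : ∀ i, HasSum (fun p : (Fin 2 → ℤ) × (Fin 2 → ℤ) =>
      potCoeff ρ ε u i p.1 * potCoeff ρ ε u i p.2)
      ((potential ρ ε u i 0 : ℂ) * (potential ρ ε u i 0 : ℂ)) := fun i => by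
    have hs := (isRapid_potCoeff ρ ε u i).summable_norm
    rw [h1]
    exact hs.of_norm.hasSum.mul hs.of_norm.hasSum (summable_mul_of_summable_norm hs hs)
  rw [potentialSq]
  push_cast
  refine (hasSum_sum fun i _ => h2 i).congr_fun fun p => ?_
  simp only [potKernel, potCoeff, Finset.sum_mul]
  refine Finset.sum_congr rfl fun i _ => ?_
  ring

section WhiteNoise

variable {Ω : Type*} [MeasurableSpace Ω] {μ : Measure Ω} [IsProbabilityMeasure μ]
  {ξ : Ω → TorusDistribution}

lemma IsWhiteNoise.hasSum_renormConst (hξ : IsWhiteNoise μ ξ) (ρ : Mollifier) (ε : ℝ) :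
    HasSum (fun k => 4 * Real.pi ^ 2 * freqSq k * heatMult k ^ 2 * ‖mollCoeff ρ ε k‖ ^ 2)
      (renormConst μ ξ ρ ε) := by
  have hg := hξ.isStdGaussianFamily
  set g := hξ.coord
  let w : (Fin 2 → ℤ) × (Fin 2 → ℤ) → ℂ := fun p =>
    potKernel p.1 p.2 * (mollCoeff ρ ε p.1 * mollCoeff ρ ε p.2)
  let F : (Fin 2 → ℤ) × (Fin 2 → ℤ) → Ω → ℂ := fun p ω =>
    w p * (fourierMode g p.1 ω * fourierMode g p.2 ω)
  have hr := (isRapid_mollCoeff ρ ε).summable_norm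
  have hF : ∀ p, Integrable (F p) μ := fun p => (hg.integral_fourierMode_mul p.1 p.2).1.const_mul _
  have hFs : Summable fun p => ∫ ω, ‖F p ω‖ ∂μ := by
    refine Summable.of_nonneg_of_le (fun p => integral_nonneg fun _ => norm_nonneg _) (fun p => ?_)
      ((summable_mul_of_summable_norm hr.norm hr.norm).mul_left 2)
    simp only [F, norm_mul (w p)]
    rw [integral_const_mul]
    refine (mul_le_of_le_one_right (norm_nonneg _)
      (hg.integral_norm_fourierMode_mul_le p.1 p.2)).trans ?_
    simp only [w]
    rw [norm_mul, norm_mul]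
    refine mul_le_mul_of_nonneg_right ?_ (by positivity)
    rw [potKernel]
    refine (norm_sum_le _ _).trans ?_
    rw [Fin.sum_univ_two, norm_mul, norm_mul]
    have h (i : Fin 2) : ‖potMult i p.1‖ * ‖potMult i p.2‖ ≤ 1 :=
      mul_le_one₀ (norm_potMult_le_one _ _) (norm_nonneg _) (norm_potMult_le_one _ _)
    linarith [h 0, h 1]
  have h1 := hasSum_integral_of_summable_integral_norm hF hFs
  have h2 : ∫ ω, ∑' p, F p ω ∂μ = (renormConst μ ξ ρ ε : ℂ) := by
    rw [renormConst, ← integral_complex_ofReal]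
    refine integral_congr_ae ?_
    filter_upwards [hξ.ae_fourierMode_eq] with ω hω
    rw [← (hasSum_potentialSq_zero ρ ε (ξ ω)).tsum_eq]
    simp only [F, w, g, hω]
  rw [h2] at h1
  have hinj : Function.Injective fun k : Fin 2 → ℤ => (k, -k) := fun k l h => congrArg Prod.fst h
  rw [← hinj.hasSum_iff] at h1
  · have h3 := Complex.hasSum_re h1
    refine h3.congr_fun fun k => ?_
    simp only [Function.comp_apply, F, w]
    rw [integral_const_mul, (hg.integral_fourierMode_mul k (-k)).2, if_pos (add_neg_cancel k),
      mul_one, potKernel_neg_self, isHermitianSeq_mollCoeff ρ ε k, Complex.mul_conj',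
      ← Complex.ofReal_pow, ← Complex.ofReal_mul, Complex.ofReal_re]
  · intro p hp
    simp only [F]
    rw [integral_const_mul, (hg.integral_fourierMode_mul p.1 p.2).2, if_neg, mul_zero]
    intro h
    exact hp ⟨p.1, Prod.ext rfl (neg_eq_of_add_eq_zero_right h)⟩

/-! ### The regularised squares as limits of truncated quadratic fields -/

lemma tendsto_two_pow_sub_one : Tendsto (fun i : ℕ => 2 ^ i - 1) atTop atTop :=
  tendsto_atTop_mono (fun i => Nat.le_sub_one_of_lt i.lt_two_pow_self) tendsto_id

lemma IsWhiteNoise.ae_tendsto_coeff_potentialSq (hξ : IsWhiteNoise μ ξ) (ρ : Mollifier) (ε : ℝ) :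
    ∀ᵐ ω ∂μ, ∀ n, Tendsto (fun N => chaosCoeff hξ.coord
        (fun k l => potKernel k l * (mollCoeff ρ ε k * mollCoeff ρ ε l)) N n ω) atTop
      (𝓝 ((distOfFun fun x => potentialSq ρ ε (ξ ω) x - renormConst μ ξ ρ ε).coeff n)) := by
  filter_upwards [hξ.ae_fourierMode_eq] with ω hω n
  have h1 := tendsto_coeff_potentialSq ρ ε (ξ ω) (renormConst μ ξ ρ ε) n
  -- the truncated renormalisation constants, which replace `c_ε` in the truncated fields
  let c : ℕ → ℂ := fun N => ∑ k ∈ freqBox N,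
    potKernel k (-k) * (mollCoeff ρ ε k * mollCoeff ρ ε (-k))
  have h2 : Tendsto c atTop (𝓝 (renormConst μ ξ ρ ε : ℂ)) := by
    have h := (Complex.hasSum_ofReal.2 (hξ.hasSum_renormConst ρ ε)).comp tendsto_freqBox
    refine h.congr fun N => Finset.sum_congr rfl fun k _ => ?_
    rw [potKernel_neg_self, isHermitianSeq_mollCoeff ρ ε k, Complex.mul_conj']
    push_cast
    ring
  have h3 : Tendsto (fun N => if n = 0 then (renormConst μ ξ ρ ε : ℂ) - c N else 0) atTop (𝓝 0) := by
    split_ifs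
    · simpa using h2.const_sub (renormConst μ ξ ρ ε : ℂ)
    · exact tendsto_const_nhds
  have h4 := h1.add h3
  rw [add_zero] at h4
  refine h4.congr fun N => ?_
  have h5 : (if n = 0 then c N else 0) = ∑ k ∈ freqBox N, ∑ l ∈ freqBox N, if k + l = n then
      potKernel k l * (mollCoeff ρ ε k * mollCoeff ρ ε l) * (if k + l = 0 then 1 else 0) else 0 := by
    split_ifs with hn
    · subst hn
      refine Finset.sum_congr rfl fun k hk => ?_
      rw [Finset.sum_eq_single_of_mem (-k) (neg_mem_freqBox.2 hk)]
      · simp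
      · intro l _ hl
        rw [if_neg fun h => hl (neg_eq_of_add_eq_zero_right h).symm]
    · refine (Finset.sum_eq_zero fun k _ => Finset.sum_eq_zero fun l _ => ?_).symm
      split_ifs with h6 h7
      · exact absurd (h6.symm.trans h7) hn
      · simp
      · rfl
  have h6 : (if n = 0 then (renormConst μ ξ ρ ε : ℂ) - c N else 0) =
      (if n = 0 then (renormConst μ ξ ρ ε : ℂ) else 0) - if n = 0 then c N else 0 := by
    split_ifs <;> simp
  rw [h6, sub_add_sub_cancel, h5, chaosCoeff, ← Finset.sum_sub_distrib]
  refine Finset.sum_congr rfl fun k _ => ?_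
  rw [← Finset.sum_sub_distrib]
  refine Finset.sum_congr rfl fun l _ => ?_
  simp only [wickProd, hω]
  split_ifs <;> ring

lemma chaosCoeff_sub {Ω : Type*} (g : (Fin 2 → ℤ) → Ω → ℝ)
    (a b : (Fin 2 → ℤ) → (Fin 2 → ℤ) → ℂ) (N : ℕ) (n : Fin 2 → ℤ) (ω : Ω) :
    chaosCoeff g a N n ω - chaosCoeff g b N n ω = chaosCoeff g (fun k l => a k l - b k l) N n ω := by
  simp only [chaosCoeff, ← Finset.sum_sub_distrib]
  refine Finset.sum_congr rfl fun k _ => Finset.sum_congr rfl fun l _ => ?_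
  split_ifs
  · ring
  · simp

/-- The error of the regularisation is a quadratic field with kernel
`potKernel k l * (1 - ρ̂(ε k) ρ̂(ε l))`. -/
lemma IsWhiteNoise.ae_tendsto_coeff_sub (hξ : IsWhiteNoise μ ξ) (ρ : Mollifier) (ε : ℝ) :
    ∀ᵐ ω ∂μ, ∀ n, Tendsto (fun i => chaosCoeff hξ.coord
        (fun k l => potKernel k l * (1 - mollCoeff ρ ε k * mollCoeff ρ ε l)) (2 ^ i - 1) n ω) atTop
      (𝓝 ((renormSquare hξ.coord ω -
        distOfFun fun x => potentialSq ρ ε (ξ ω) x - renormConst μ ξ ρ ε).coeff n)) := by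
  filter_upwards [hξ.ae_tendsto_coeff_potentialSq ρ ε,
    hξ.isStdGaussianFamily.ae_tendsto_coeff_renormSquare] with ω h1 h2 n
  have h3 := (h2 n).sub ((h1 n).comp tendsto_two_pow_sub_one)
  have e : ∀ u v : TorusDistribution, (u - v).coeff n = u.coeff n - v.coeff n := fun u v => by
    simp only [TorusDistribution.coeff, TorusDistribution.pair, Submodule.coe_sub,
      LinearMap.sub_apply]
    push_cast
    ring
  rw [e]
  refine h3.congr fun i => ?_
  rw [Function.comp_apply, chaosCoeff_sub]
  congr 1
  funext k l
  ring

end WhiteNoise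

/-! ### Logarithmic lattice sums -/

lemma antitoneOn_div_add_sq {a : ℝ} (ha : 0 < a) (x y : ℝ) (hx : 0 ≤ x) :
    AntitoneOn (fun t : ℝ => a / (a ^ 2 + t ^ 2)) (Set.Icc x y) := fun s hs t _ hst => by
  have : 0 ≤ s := hx.trans hs.1
  change a / (a ^ 2 + t ^ 2) ≤ a / (a ^ 2 + s ^ 2)
  gcongr

lemma integral_div_add_sq {a : ℝ} (ha : 0 < a) (x y : ℝ) :
    ∫ t in x..y, a / (a ^ 2 + t ^ 2) = Real.arctan (y / a) - Real.arctan (x / a) := by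
  have h : ∀ t, HasDerivAt (fun t => Real.arctan (t / a)) (a / (a ^ 2 + t ^ 2)) t := fun t => by
    have h1 := ((hasDerivAt_id t).div_const a).arctan
    refine h1.congr_deriv ?_
    simp only [id]
    field_simp
  refine intervalIntegral.integral_eq_sub_of_hasDerivAt (fun t _ => h t) ?_
  refine Continuous.intervalIntegrable ?_ _ _
  exact continuous_const.div (by fun_prop) fun t => by positivity

lemma arctan_le_self {x : ℝ} (hx : 0 ≤ x) : Real.arctan x ≤ x := by
  have h := Real.le_tan (Real.arctan_nonneg.2 hx) (Real.arctan_lt_pi_div_two x)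
  rwa [Real.tan_arctan] at h

/-- The sum over one row of the lattice, compared with `∫ dt / (a² + t²)`. -/
lemma abs_sum_inv_add_sq_sub_le {a : ℝ} (ha : 1 ≤ a) {R : ℕ} (hR : R ≠ 0) :
    |∑ j ∈ Finset.range R, (a ^ 2 + ((j + 1 : ℕ) : ℝ) ^ 2)⁻¹ - Real.pi / 2 * a⁻¹| ≤
      (R : ℝ)⁻¹ + (a ^ 2)⁻¹ := by
  have ha0 : 0 < a := by linarith
  have hR0 : (0 : ℝ) < R := by positivity
  have hup := (antitoneOn_div_add_sq ha0 0 (0 + R) le_rfl).sum_le_integral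
  have hlo := (antitoneOn_div_add_sq ha0 1 (1 + R) zero_le_one).integral_le_sum
  rw [integral_div_add_sq ha0] at hup hlo
  have hS : ∀ f : ℕ → ℝ, ∑ j ∈ Finset.range R, a / (a ^ 2 + f j ^ 2) =
      a * ∑ j ∈ Finset.range R, (a ^ 2 + f j ^ 2)⁻¹ := fun f => by
    rw [Finset.mul_sum]
    rfl
  rw [hS] at hup hlo
  simp only [zero_add] at hup
  have e1 : ∀ j : ℕ, (1 : ℝ) + j = ((j + 1 : ℕ) : ℝ) := fun j => by push_cast; ring
  simp only [e1] at hlo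
  set S := ∑ j ∈ Finset.range R, (a ^ 2 + ((j + 1 : ℕ) : ℝ) ^ 2)⁻¹
  have h1 : Real.arctan (R / a) = Real.pi / 2 - Real.arctan (a / R) := by
    rw [← Real.arctan_inv_of_pos (by positivity), inv_div]
  have h2 : 0 ≤ Real.arctan (a / R) := Real.arctan_nonneg.2 (by positivity)
  have h3 : Real.arctan (a / R) ≤ a / R := arctan_le_self (by positivity)
  have h4 : Real.arctan (R / a) ≤ Real.arctan (((R + 1 : ℕ) : ℝ) / a) :=
    Real.arctan_strictMono.monotone (by gcongr; simp)
  have h5 : Real.arctan (1 / a) ≤ 1 / a := arctan_le_self (by positivity)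
  rw [zero_div, Real.arctan_zero, sub_zero] at hup
  have h6 : a * (S - Real.pi / 2 * a⁻¹) = a * S - Real.pi / 2 := by
    field_simp
  have h7 : a * ((R : ℝ)⁻¹ + (a ^ 2)⁻¹) = a / R + 1 / a := by
    field_simp
  rw [abs_le]
  constructor
  · refine le_of_mul_le_mul_left ?_ ha0
    rw [mul_neg, h6, h7]
    linarith
  · refine le_of_mul_le_mul_left ?_ ha0
    rw [h6, h7]
    have : 0 ≤ a / R + 1 / a := by positivity
    linarith

lemma sum_inv_sq_le_two (R : ℕ) : ∑ j ∈ Finset.range R, (((j + 1 : ℕ) : ℝ) ^ 2)⁻¹ ≤ 2 := by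
  have h := sum_Ioo_inv_sq_le (α := ℝ) 0 (R + 1)
  rw [Nat.cast_zero, zero_add, div_one] at h
  refine le_trans (le_of_eq ?_) h
  rw [Finset.range_eq_Ico, Finset.sum_Ico_add' (fun j : ℕ => ((j : ℝ) ^ 2)⁻¹) 0 R 1]
  rfl

lemma sum_Icc_even (f : ℤ → ℝ) (hf : f.Even) (R : ℕ) :
    ∑ n ∈ Finset.Icc (-(R : ℤ)) R, f n = f 0 + 2 * ∑ j ∈ Finset.range R, f ((j + 1 : ℕ) : ℤ) := by
  rw [Finset.sum_Icc_of_even_eq_range hf, Finset.sum_range_succ', two_smul]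
  push_cast
  ring

lemma sum_freqBox (f : ℤ → ℤ → ℝ) (R : ℕ) : ∑ k ∈ freqBox R, f (k 0) (k 1) =
    ∑ i ∈ Finset.Icc (-(R : ℤ)) R, ∑ j ∈ Finset.Icc (-(R : ℤ)) R, f i j := by
  rw [← Finset.sum_product', freqBox]
  refine Finset.sum_bij' (fun k _ => (k 0, k 1)) (fun p _ => ![p.1, p.2]) ?_ ?_ ?_ ?_ ?_
  · intro k hk
    rw [Fintype.mem_piFinset] at hk
    exact Finset.mem_product.2 ⟨hk 0, hk 1⟩
  · intro p hp
    rw [Finset.mem_product] at hp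
    rw [Fintype.mem_piFinset]
    intro i
    fin_cases i
    · exact hp.1
    · exact hp.2
  · intro k _
    funext i
    fin_cases i <;> rfl
  · intro p _
    rfl
  · intro k _
    rfl

/-- `∑_{0 < |k|_∞ ≤ R} |k|⁻² = 2π log R + O(1)`, in terms of the harmonic numbers. -/
lemma abs_sum_inv_freqSq_sub_le {R : ℕ} (hR : R ≠ 0) :
    |∑ k ∈ freqBox R, (freqSq k)⁻¹ - 2 * Real.pi * harmonic R| ≤ 20 := by
  have hR0 : (0 : ℝ) < R := by positivity
  let F : ℤ → ℤ → ℝ := fun i j => ((i : ℝ) ^ 2 + (j : ℝ) ^ 2)⁻¹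
  let q : ℕ → ℝ := fun i => (((i + 1 : ℕ) : ℝ) ^ 2)⁻¹
  have hq : ∑ i ∈ Finset.range R, q i ≤ 2 := sum_inv_sq_le_two R
  have hq0 : 0 ≤ ∑ i ∈ Finset.range R, q i := Finset.sum_nonneg fun i _ => by positivity
  let T : ℕ → ℝ := fun i =>
    ∑ j ∈ Finset.range R, (((i + 1 : ℕ) : ℝ) ^ 2 + ((j + 1 : ℕ) : ℝ) ^ 2)⁻¹
  have h1 : ∑ k ∈ freqBox R, (freqSq k)⁻¹ =
      2 * ∑ i ∈ Finset.range R, q i + 2 * ∑ i ∈ Finset.range R, (q i + 2 * T i) := by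
    have e : ∀ k : Fin 2 → ℤ, (freqSq k)⁻¹ = F (k 0) (k 1) := fun k => by
      simp only [F, freqSq, Fin.sum_univ_two]
    simp only [e]
    rw [sum_freqBox, sum_Icc_even]
    · congr 1
      · rw [sum_Icc_even]
        · simp [F, q]
        · intro n
          simp [F]
      · congr 1
        refine Finset.sum_congr rfl fun i _ => ?_
        rw [sum_Icc_even]
        · simp [F, q, T]
        · intro n
          simp [F]
    · intro n
      simp [F]
  have h2 : (harmonic R : ℝ) = ∑ i ∈ Finset.range R, (((i + 1 : ℕ) : ℝ))⁻¹ := by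
    rw [harmonic]
    push_cast
    rfl
  have h3 : |∑ i ∈ Finset.range R, T i - Real.pi / 2 * harmonic R| ≤
      ∑ i ∈ Finset.range R, ((R : ℝ)⁻¹ + q i) := by
    rw [h2, Finset.mul_sum, ← Finset.sum_sub_distrib]
    refine (Finset.abs_sum_le_sum_abs _ _).trans (Finset.sum_le_sum fun i _ => ?_)
    exact abs_sum_inv_add_sq_sub_le (by push_cast; linarith [Nat.cast_nonneg (α := ℝ) i]) hR
  rw [Finset.sum_add_distrib, Finset.sum_const, Finset.card_range, nsmul_eq_mul,
    mul_inv_cancel₀ hR0.ne'] at h3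
  rw [h1, Finset.sum_add_distrib, ← Finset.mul_sum]
  rw [abs_le] at h3 ⊢
  constructor <;> linarith [h3.1, h3.2]

lemma norm_eq_of_mem_sdiff {R : ℕ} {k : Fin 2 → ℤ} (h1 : k ∈ freqBox (R + 1))
    (h2 : k ∉ freqBox R) : ‖k‖ = ((R + 1 : ℕ) : ℝ) := by
  refine le_antisymm (mem_freqBox.1 h1) ?_
  rw [mem_freqBox_iff_abs] at h2
  push Not at h2
  obtain ⟨j, hj⟩ := h2
  have h3 : ((R + 1 : ℕ) : ℤ) ≤ |k j| := by push_cast; omega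
  have h4 : ((R + 1 : ℕ) : ℝ) ≤ ‖k j‖ := by
    rw [Int.norm_eq_abs]
    exact_mod_cast h3
  exact h4.trans (norm_le_pi_norm k j)

/-- Summation of a radial function over the shells `|k|_∞ = n`, which contain `8 n` points. -/
lemma sum_radial (f : ℝ → ℝ) {M N : ℕ} (h : M ≤ N) :
    ∑ k ∈ freqBox N, f ‖k‖ = ∑ k ∈ freqBox M, f ‖k‖ + ∑ n ∈ Finset.Ioc M N, 8 * n * f n := by
  induction N, h using Nat.le_induction with
  | base => simp
  | succ N h ih =>
    have hsub : freqBox N ⊆ freqBox (N + 1) := freqBox_mono N.le_succ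
    rw [← Finset.sum_sdiff hsub, ih, ← Finset.insert_Ioc_right_eq_Ioc_add_one h,
      Finset.sum_insert (by simp), add_comm, add_assoc, add_comm (∑ n ∈ Finset.Ioc M N, _)]
    congr 2
    have hc : ((freqBox (N + 1) \ freqBox N).card : ℝ) = 8 * ((N + 1 : ℕ) : ℝ) := by
      rw [Finset.cast_card_sdiff hsub, card_freqBox, card_freqBox]
      push_cast
      ring
    rw [← hc, ← nsmul_eq_mul, ← Finset.sum_const]
    refine Finset.sum_congr rfl fun k hk => ?_
    rw [Finset.mem_sdiff] at hk
    rw [norm_eq_of_mem_sdiff hk.1 hk.2]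

/-! ### Logarithmic divergence of the renormalisation constant -/

lemma freqSq_zero : freqSq 0 = 0 := by simp [freqSq]

lemma one_le_four_pi_sq : 1 ≤ 4 * Real.pi ^ 2 := by nlinarith [Real.pi_gt_three]

lemma inv_mul_freqSq_le (k : Fin 2 → ℤ) : (4 * Real.pi ^ 2 * freqSq k)⁻¹ ≤ (‖k‖ ^ 2)⁻¹ := by
  rcases eq_or_ne k 0 with rfl | hk
  · simp [freqSq_zero]
  · have h0 : 0 < ‖k‖ := norm_pos_iff.2 hk
    refine inv_anti₀ (by positivity) ((norm_sq_le_freqSq k).trans ?_)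
    exact le_mul_of_one_le_left (freqSq_nonneg k) one_le_four_pi_sq

/-- The smoothing operator `e^Δ` in `Δ⁻¹` only contributes a summable error. -/
lemma abs_sq_heatMult_sub_le (k : Fin 2 → ℤ) :
    |4 * Real.pi ^ 2 * freqSq k * heatMult k ^ 2 - (4 * Real.pi ^ 2 * freqSq k)⁻¹| ≤
      2 * ‖k‖ ^ (-4 : ℝ) := by
  rcases eq_or_ne k 0 with rfl | hk
  · simp only [freqSq_zero, mul_zero, zero_mul, inv_zero, sub_self, abs_zero]
    positivity
  · have h0 : 0 < ‖k‖ := norm_pos_iff.2 hk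
    rw [heatMult_of_ne_zero hk]
    set L := 4 * Real.pi ^ 2 * freqSq k with hLdef
    have hL : ‖k‖ ^ 2 ≤ L := (norm_sq_le_freqSq k).trans
      (le_mul_of_one_le_left (freqSq_nonneg k) one_le_four_pi_sq)
    have hL0 : 0 < L := lt_of_lt_of_le (by positivity) hL
    have he : Real.exp (-L) ≤ L⁻¹ := by
      rw [Real.exp_neg]
      exact inv_anti₀ hL0 (by linarith [Real.add_one_le_exp L])
    have he0 := Real.exp_pos (-L)
    have he1 : Real.exp (-L) ≤ 1 := Real.exp_le_one_iff.2 (by linarith)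
    have e : L * ((1 - Real.exp (-L)) / L) ^ 2 - L⁻¹ =
        -(L⁻¹ * (Real.exp (-L) * (2 - Real.exp (-L)))) := by
      field_simp
      ring
    have hprod : 0 ≤ Real.exp (-L) * (2 - Real.exp (-L)) := mul_nonneg he0.le (by linarith)
    rw [e, abs_neg, abs_of_nonneg (mul_nonneg (by positivity) hprod)]
    calc L⁻¹ * (Real.exp (-L) * (2 - Real.exp (-L))) ≤ L⁻¹ * (L⁻¹ * 2) := by
          have h2 : 2 - Real.exp (-L) ≤ 2 := by linarith
          have h3 : 0 ≤ 2 - Real.exp (-L) := by linarith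
          exact mul_le_mul_of_nonneg_left (mul_le_mul he h2 h3 (by positivity)) (by positivity)
      _ ≤ (‖k‖ ^ 2)⁻¹ * ((‖k‖ ^ 2)⁻¹ * 2) := by gcongr
      _ = _ := by
          rw [show (-4 : ℝ) = ((-4 : ℤ) : ℝ) by norm_num, Real.rpow_intCast]
          field_simp

/-- The constant in `c_ε = (2π)⁻¹ log (1/ε) + O(1)`. -/
def renormBound (ρ : Mollifier) : ℝ :=
  mollConst ρ ^ 2 * (2 * ∑' k : Fin 2 → ℤ, ‖k‖ ^ (-4 : ℝ)) + 32 * mollConst ρ ^ 2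

/-- On frequencies below `1/ε` the mollifier is close to the identity, above `1/ε` it decays. -/
lemma abs_sum_mollCoeff_sub_le (ρ : Mollifier) {ε : ℝ} (hε : 0 < ε) (hε1 : ε ≤ 1) {N : ℕ}
    (hN : ⌊1 / ε⌋₊ ≤ N) :
    |∑ k ∈ freqBox N, 4 * Real.pi ^ 2 * freqSq k * heatMult k ^ 2 * ‖mollCoeff ρ ε k‖ ^ 2 -
      ∑ k ∈ freqBox ⌊1 / ε⌋₊, (4 * Real.pi ^ 2 * freqSq k)⁻¹| ≤ renormBound ρ := by
  set R := ⌊1 / ε⌋₊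
  set C := mollConst ρ
  have hC : 1 ≤ C := (mollConst_summands ρ).1
  have h1e : 1 ≤ 1 / ε := by rwa [le_div_iff₀ hε, one_mul]
  have hR1 : 1 ≤ R := Nat.le_floor (by simpa using h1e)
  have hR1' : (1 : ℝ) ≤ R := by exact_mod_cast hR1
  have hRe : (R : ℝ) ≤ 1 / ε := Nat.floor_le (by positivity)
  have hRe2 : 1 / ε ≤ 2 * R := by linarith [(Nat.lt_floor_add_one (1 / ε)).le]
  let a : (Fin 2 → ℤ) → ℝ := fun k => 4 * Real.pi ^ 2 * freqSq k * heatMult k ^ 2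
  let b : (Fin 2 → ℤ) → ℝ := fun k => (4 * Real.pi ^ 2 * freqSq k)⁻¹
  let r : (Fin 2 → ℤ) → ℝ := fun k => ‖mollCoeff ρ ε k‖
  have hb0 : ∀ k, 0 ≤ b k := fun k => inv_nonneg.2 (mul_nonneg (by positivity) (freqSq_nonneg k))
  have hr0 : ∀ k, 0 ≤ r k := fun k => norm_nonneg _
  have hrC : ∀ k, r k ≤ C := norm_mollCoeff_le ρ hε
  have hsub : freqBox R ⊆ freqBox N := freqBox_mono hN
  have hsplit : ∑ k ∈ freqBox N, a k * r k ^ 2 - ∑ k ∈ freqBox R, b k =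
      ∑ k ∈ freqBox N, (a k - b k) * r k ^ 2 + ∑ k ∈ freqBox R, b k * (r k ^ 2 - 1) +
        ∑ k ∈ freqBox N \ freqBox R, b k * r k ^ 2 := by
    simp only [sub_mul, mul_sub, mul_one, Finset.sum_sub_distrib]
    rw [← Finset.sum_sdiff hsub (f := fun k => b k * r k ^ 2)]
    ring
  have hpart1 : |∑ k ∈ freqBox N, (a k - b k) * r k ^ 2| ≤
      C ^ 2 * (2 * ∑' k : Fin 2 → ℤ, ‖k‖ ^ (-4 : ℝ)) := by
    refine (Finset.abs_sum_le_sum_abs _ _).trans ?_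
    have hs := (summable_norm_rpow (b := -4) (by norm_num)).mul_left 2
    rw [← tsum_mul_left]
    refine le_trans ?_ (mul_le_mul_of_nonneg_left (hs.sum_le_tsum (freqBox N) fun k _ => by
      positivity) (sq_nonneg C))
    rw [Finset.mul_sum]
    refine Finset.sum_le_sum fun k _ => ?_
    rw [abs_mul, abs_of_nonneg (sq_nonneg (r k)), mul_comm]
    exact mul_le_mul (pow_le_pow_left₀ (hr0 k) (hrC k) 2) (abs_sq_heatMult_sub_le k)
      (abs_nonneg _) (sq_nonneg C)
  have hpart2 : |∑ k ∈ freqBox R, b k * (r k ^ 2 - 1)| ≤ 16 * C ^ 2 := by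
    have hk : ∀ k, |b k * (r k ^ 2 - 1)| ≤ 2 * C ^ 2 * ε * ‖k‖⁻¹ := fun k => by
      have h1 : |r k - 1| ≤ C * (ε * ‖k‖) := by
        refine le_trans ?_ (norm_one_sub_mollCoeff_le ρ hε k)
        have := abs_norm_sub_norm_le (mollCoeff ρ ε k) 1
        rwa [norm_one, norm_sub_rev] at this
      have h2 : |r k ^ 2 - 1| ≤ 2 * C * (C * (ε * ‖k‖)) := by
        rw [show r k ^ 2 - 1 = (r k + 1) * (r k - 1) by ring, abs_mul,
          abs_of_nonneg (by linarith [hr0 k])]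
        exact mul_le_mul (by linarith [hrC k]) h1 (abs_nonneg _) (by positivity)
      rw [abs_mul, abs_of_nonneg (hb0 k)]
      refine (mul_le_mul (inv_mul_freqSq_le k) h2 (abs_nonneg _) (by positivity)).trans
        (le_of_eq ?_)
      rcases eq_or_ne k 0 with rfl | hk
      · simp
      · have : ‖k‖ ≠ 0 := norm_ne_zero_iff.2 hk
        field_simp
    refine (Finset.abs_sum_le_sum_abs _ _).trans
      ((Finset.sum_le_sum fun k _ => hk k).trans ?_)
    rw [sum_radial (fun x => 2 * C ^ 2 * ε * x⁻¹) (Nat.zero_le R), freqBox_zero]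
    have e : ∀ n ∈ Finset.Ioc 0 R, 8 * (n : ℝ) * (2 * C ^ 2 * ε * (n : ℝ)⁻¹) = 16 * C ^ 2 * ε :=
      fun n hn => by
        have : (n : ℝ) ≠ 0 := Nat.cast_ne_zero.2 (Finset.mem_Ioc.1 hn).1.ne'
        field_simp
        ring
    rw [Finset.sum_congr rfl e]
    simp only [Finset.sum_singleton, norm_zero, inv_zero, mul_zero, zero_add, Finset.sum_const,
      Nat.card_Ioc, Nat.sub_zero, nsmul_eq_mul]
    have h3 : R * ε ≤ 1 := by rwa [le_div_iff₀ hε] at hRe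
    nlinarith [sq_nonneg C]
  have hpart3 : |∑ k ∈ freqBox N \ freqBox R, b k * r k ^ 2| ≤ 16 * C ^ 2 := by
    have hk : ∀ k, b k * r k ^ 2 ≤ C ^ 2 / ε * (‖k‖ ^ 3)⁻¹ := fun k => by
      rcases eq_or_ne k 0 with rfl | hk
      · simp [b, freqSq_zero]
      · have h0 : 0 < ‖k‖ := norm_pos_iff.2 hk
        have h1 : r k ≤ C / (ε * ‖k‖) := by
          rw [le_div_iff₀ (by positivity), mul_comm]
          exact mul_norm_mollCoeff_le ρ hε k
        have h2 : r k ^ 2 ≤ C * (C / (ε * ‖k‖)) := by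
          rw [sq]
          exact mul_le_mul (hrC k) h1 (hr0 k) (by positivity)
        refine (mul_le_mul (inv_mul_freqSq_le k) h2 (sq_nonneg _) (by positivity)).trans
          (le_of_eq ?_)
        field_simp
    rw [abs_of_nonneg (Finset.sum_nonneg fun k _ => mul_nonneg (hb0 k) (sq_nonneg _))]
    refine (Finset.sum_le_sum fun k _ => hk k).trans ?_
    have h1 := sum_radial (fun x => C ^ 2 / ε * (x ^ 3)⁻¹) hN
    rw [← Finset.sum_sdiff hsub, add_comm, add_right_inj] at h1
    rw [h1]
    have e : ∀ n ∈ Finset.Ioc R N, 8 * (n : ℝ) * (C ^ 2 / ε * ((n : ℝ) ^ 3)⁻¹) =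
        8 * C ^ 2 / ε * ((n : ℝ) ^ 2)⁻¹ := fun n hn => by
      have : (n : ℝ) ≠ 0 := Nat.cast_ne_zero.2 (by have := (Finset.mem_Ioc.1 hn).1; omega)
      field_simp
    rw [Finset.sum_congr rfl e, ← Finset.mul_sum]
    have h2 := sum_Ioc_inv_sq_le_sub (α := ℝ) (by omega : R ≠ 0) hN
    have h3 : (0 : ℝ) ≤ (N : ℝ)⁻¹ := by positivity
    calc 8 * C ^ 2 / ε * ∑ n ∈ Finset.Ioc R N, ((n : ℝ) ^ 2)⁻¹
        ≤ 8 * C ^ 2 * (1 / ε) * (R : ℝ)⁻¹ := by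
          rw [mul_one_div]
          gcongr
          linarith
      _ ≤ 8 * C ^ 2 * (2 * R) * (R : ℝ)⁻¹ := by gcongr
      _ = _ := by field_simp; ring
  change |∑ k ∈ freqBox N, a k * r k ^ 2 - ∑ k ∈ freqBox R, b k| ≤ _
  rw [hsplit, renormBound]
  refine (abs_add_le _ _).trans ((add_le_add_left (abs_add_le _ _) _).trans ?_)
  linarith

section WhiteNoise

variable {Ω : Type*} [MeasurableSpace Ω] {μ : Measure Ω} [IsProbabilityMeasure μ]
  {ξ : Ω → TorusDistribution}

lemma IsWhiteNoise.abs_renormConst_sub_log_le (hξ : IsWhiteNoise μ ξ) (ρ : Mollifier) {ε : ℝ}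
    (hε : 0 < ε) (hε1 : ε ≤ 1) :
    |renormConst μ ξ ρ ε - 1 / (2 * Real.pi) * Real.log (1 / ε)| ≤ renormBound ρ + 21 := by
  have hpi := Real.pi_gt_three
  have h1e : 1 ≤ 1 / ε := by rwa [le_div_iff₀ hε, one_mul]
  set R := ⌊1 / ε⌋₊
  have hR1 : 1 ≤ R := Nat.le_floor (by simpa using h1e)
  have h1 : |renormConst μ ξ ρ ε - ∑ k ∈ freqBox R, (4 * Real.pi ^ 2 * freqSq k)⁻¹| ≤
      renormBound ρ := by
    refine le_of_tendsto ((((hξ.hasSum_renormConst ρ ε).comp tendsto_freqBox).sub_const _).abs) ?_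
    filter_upwards [eventually_ge_atTop R] with N hN
    exact abs_sum_mollCoeff_sub_le ρ hε hε1 hN
  have h2 : ∑ k ∈ freqBox R, (4 * Real.pi ^ 2 * freqSq k)⁻¹ =
      (4 * Real.pi ^ 2)⁻¹ * ∑ k ∈ freqBox R, (freqSq k)⁻¹ := by
    rw [Finset.mul_sum]
    exact Finset.sum_congr rfl fun k _ => mul_inv _ _
  have h3 : |∑ k ∈ freqBox R, (4 * Real.pi ^ 2 * freqSq k)⁻¹ -
      1 / (2 * Real.pi) * harmonic R| ≤ 20 := by
    have e : (4 * Real.pi ^ 2)⁻¹ * ∑ k ∈ freqBox R, (freqSq k)⁻¹ - 1 / (2 * Real.pi) * harmonic R =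
        (4 * Real.pi ^ 2)⁻¹ * (∑ k ∈ freqBox R, (freqSq k)⁻¹ - 2 * Real.pi * harmonic R) := by
      field_simp
      ring
    rw [h2, e, abs_mul, abs_of_pos (by positivity)]
    exact (mul_le_of_le_one_left (abs_nonneg _) (inv_le_one_of_one_le₀ one_le_four_pi_sq)).trans
      (abs_sum_inv_freqSq_sub_le (by omega))
  have h4 : |1 / (2 * Real.pi) * harmonic R - 1 / (2 * Real.pi) * Real.log (1 / ε)| ≤ 1 := by
    rw [← mul_sub, abs_mul, abs_of_pos (by positivity)]
    have h5 := log_le_harmonic_floor (1 / ε) (by positivity)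
    have h6 := harmonic_floor_le_one_add_log (1 / ε) h1e
    have h7 : |(harmonic R : ℝ) - Real.log (1 / ε)| ≤ 1 := by
      rw [abs_le]
      constructor <;> linarith
    refine (mul_le_of_le_one_left (abs_nonneg _) ?_).trans h7
    rw [div_le_one (by positivity)]
    linarith
  have h8 := abs_sub_le (renormConst μ ξ ρ ε)
    (∑ k ∈ freqBox R, (4 * Real.pi ^ 2 * freqSq k)⁻¹) (1 / (2 * Real.pi) * Real.log (1 / ε))
  have h9 := abs_sub_le (∑ k ∈ freqBox R, (4 * Real.pi ^ 2 * freqSq k)⁻¹)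
    (1 / (2 * Real.pi) * harmonic R) (1 / (2 * Real.pi) * Real.log (1 / ε))
  linarith

lemma IsWhiteNoise.tendsto_renormConst_div_log (hξ : IsWhiteNoise μ ξ) (ρ : Mollifier) :
    Tendsto (fun ε : ℝ => renormConst μ ξ ρ ε / Real.log (1 / ε)) (𝓝[>] 0)
      (𝓝 (1 / (2 * Real.pi))) := by
  have hlog : Tendsto (fun ε : ℝ => Real.log (1 / ε)) (𝓝[>] 0) atTop := by
    simp only [one_div]
    exact Real.tendsto_log_atTop.comp tendsto_inv_nhdsGT_zero
  rw [tendsto_iff_dist_tendsto_zero]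
  refine squeeze_zero' (Eventually.of_forall fun _ => dist_nonneg) ?_
    (hlog.const_div_atTop (renormBound ρ + 21))
  filter_upwards [hlog.eventually_gt_atTop 0, Ioc_mem_nhdsGT one_pos] with ε hl hε
  rw [Real.dist_eq]
  have e : renormConst μ ξ ρ ε / Real.log (1 / ε) - 1 / (2 * Real.pi) =
      (renormConst μ ξ ρ ε - 1 / (2 * Real.pi) * Real.log (1 / ε)) / Real.log (1 / ε) := by
    field_simp
  rw [e, abs_div, abs_of_pos hl]
  gcongr
  exact hξ.abs_renormConst_sub_log_le ρ hε.1 hε.2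

end WhiteNoise

/-! ### Regularity and convergence -/

section WhiteNoise

variable {Ω : Type*} [MeasurableSpace Ω] {μ : Measure Ω} [IsProbabilityMeasure μ]
  {ξ : Ω → TorusDistribution}

/-- Admissible parameters for the moment bound at negative regularity `s`: a loss `κ` in the size
of the kernel and an even moment `2 m` above any prescribed order. -/
lemma exists_moment_parameters {s : ℝ} (hs : s < 0) (p : ℝ) :
    ∃ (κ : ℝ) (m : ℕ), 0 < κ ∧ κ ≤ 1 / 10 ∧ 9 * κ ≤ -s ∧ 2 < m * -s ∧ p ≤ 2 * m := by
  obtain ⟨m, hm⟩ := exists_nat_gt (max (2 / -s) p)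
  refine ⟨min (-s / 9) (1 / 10), m, lt_min (by linarith) (by norm_num), min_le_right _ _, ?_, ?_, ?_⟩
  · linarith [min_le_left (-s / 9) (1 / 10)]
  · exact (div_lt_iff₀ (by linarith)).1 ((le_max_left _ _).trans_lt hm)
  · have h1 := (le_max_right (2 / -s) p).trans hm.le
    linarith [Nat.cast_nonneg (α := ℝ) m]

lemma IsWhiteNoise.ae_renormSquare_mem_besovHolder (hξ : IsWhiteNoise μ ξ) {s : ℝ} (hs : s < 0) :
    ∀ᵐ ω ∂μ, renormSquare hξ.coord ω ∈ BesovHolder s := by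
  obtain ⟨κ, m, hκ, hκ', hκs, hm, -⟩ := exists_moment_parameters hs 0
  have hg := hξ.isStdGaussianFamily
  obtain ⟨Y, hYm, hY, hYi⟩ := hg.exists_besovHolderNorm_le hκ hκ' hκs hm
    (norm_potKernel_le_rpow hκ.le) _ hg.ae_tendsto_coeff_renormSquare
  filter_upwards [hY, ae_lt_top hYm (hYi.trans_lt ENNReal.ofReal_lt_top).ne] with ω h1 h2
  have hm0 : 2 * m ≠ 0 := by
    rintro h
    obtain rfl : m = 0 := by omega
    norm_num at hm
  exact (ENNReal.pow_lt_top_iff.1 (h1.trans_lt h2)).resolve_right hm0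

lemma IsWhiteNoise.tendsto_lintegral_besovHolderNorm (hξ : IsWhiteNoise μ ξ) (ρ : Mollifier)
    {s : ℝ} (hs : s < 0) {p : ℝ} (hp : 0 < p) :
    Tendsto (fun ε : ℝ => ∫⁻ ω, besovHolderNorm s (renormSquare hξ.coord ω -
      distOfFun fun x => potentialSq ρ ε (ξ ω) x - renormConst μ ξ ρ ε) ^ p ∂μ)
      (𝓝[>] 0) (𝓝 0) := by
  obtain ⟨κ, m, hκ, hκ', hκs, hm, hpm⟩ := exists_moment_parameters hs p
  have hg := hξ.isStdGaussianFamily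
  have hm0 : 0 < (2 * m : ℝ) := hp.trans_le hpm
  have hq : 0 < p / (2 * m) := by positivity
  have hbound : ∀ ε : ℝ, 0 < ε → ∫⁻ ω, besovHolderNorm s (renormSquare hξ.coord ω -
      distOfFun fun x => potentialSq ρ ε (ξ ω) x - renormConst μ ξ ρ ε) ^ p ∂μ ≤
      ENNReal.ofReal ((8 * mollConst ρ ^ 2 * ε ^ κ) ^ (2 * m) * besovConst s κ m) ^
        (p / (2 * m)) := fun ε hε => by
    obtain ⟨Y, hYm, hY, hYi⟩ := hg.exists_besovHolderNorm_le hκ hκ' hκs hm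
      (norm_potKernel_mul_one_sub_le ρ hε hκ.le (by linarith)) _ (hξ.ae_tendsto_coeff_sub ρ ε)
    have h1 : ∀ x y : ℝ≥0∞, x ^ (2 * m) ≤ y → x ^ p ≤ y ^ (p / (2 * m)) := fun x y h => by
      refine le_trans (le_of_eq ?_) (ENNReal.rpow_le_rpow h hq.le)
      rw [← ENNReal.rpow_natCast, ← ENNReal.rpow_mul]
      congr 1
      push_cast
      have hm1 : (m : ℝ) ≠ 0 := fun h => by simp [h] at hm0
      field_simp
    refine (lintegral_mono_ae (hY.mono fun ω hω => h1 _ _ hω)).trans ?_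
    -- Jensen's inequality reduces the moment of order `p` to the one of order `2 m`
    have h2 := eLpNorm'_le_eLpNorm'_of_exponent_le hq ((div_le_one hm0).2 hpm) μ
      hYm.aestronglyMeasurable
    simp only [eLpNorm', enorm_eq_self, ENNReal.rpow_one, div_one] at h2
    rw [one_div, ENNReal.rpow_inv_le_iff hq] at h2
    exact h2.trans (ENNReal.rpow_le_rpow hYi hq.le)
  have hlim : Tendsto (fun ε : ℝ => ENNReal.ofReal ((8 * mollConst ρ ^ 2 * ε ^ κ) ^ (2 * m) *
      besovConst s κ m) ^ (p / (2 * m))) (𝓝[>] 0) (𝓝 0) := by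
    have h1 : Tendsto (fun ε : ℝ => ε ^ κ) (𝓝[>] 0) (𝓝 0) := by
      have h := (Real.continuousAt_rpow_const 0 κ (Or.inr hκ.le)).tendsto
      rw [Real.zero_rpow hκ.ne'] at h
      exact h.mono_left nhdsWithin_le_nhds
    have h2 := (((h1.const_mul (8 * mollConst ρ ^ 2)).pow (2 * m)).mul_const (besovConst s κ m))
    have hm1 : 2 * m ≠ 0 := by
      rintro h
      have h' : (2 * m : ℝ) = 0 := by exact_mod_cast h
      linarith
    rw [mul_zero, zero_pow hm1, zero_mul] at h2
    have h3 := (ENNReal.continuous_rpow_const (y := p / (2 * m))).tendsto _ |>.comp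
      (ENNReal.tendsto_ofReal h2)
    rwa [ENNReal.ofReal_zero, ENNReal.zero_rpow_of_pos hq] at h3
  refine tendsto_of_tendsto_of_tendsto_of_le_of_le' tendsto_const_nhds hlim
    (Eventually.of_forall fun _ => zero_le) ?_
  filter_upwards [self_mem_nhdsWithin] with ε hε
  exact hbound ε hε

end WhiteNoise

end

theorem mainTheorem5 {Ω : Type*} [MeasurableSpace Ω] (μ : Measure Ω) [IsProbabilityMeasure μ]
    (ξ : Ω → TorusDistribution) (hξ : IsWhiteNoise μ ξ) :
    ∃ Asq : Ω → TorusDistribution,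
      (∀ f : TestFunctions, Measurable fun ω => (Asq ω).pair f) ∧
      (∀ α : ℝ, α < 1 → ∀ᵐ ω ∂μ, Asq ω ∈ BesovHolder (2 * α - 2)) ∧
      ∀ ρ : Mollifier,
        (∀ (ω : Ω) (ε : ℝ), 0 < ε → ∀ i, IsSmooth (potential ρ ε (ξ ω) i)) ∧
        (∀ α : ℝ, α < 1 → ∀ p : ℝ, 1 ≤ p →
          Tendsto
            (fun ε : ℝ => ∫⁻ ω, besovHolderNorm (2 * α - 2)
              (Asq ω - distOfFun fun x => potentialSq ρ ε (ξ ω) x - renormConst μ ξ ρ ε) ^ p ∂μ)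
            (𝓝[>] 0) (𝓝 0)) ∧
        Tendsto (fun ε : ℝ => renormConst μ ξ ρ ε / Real.log (1 / ε)) (𝓝[>] 0)
          (𝓝 (1 / (2 * Real.pi))) := by
  have hg := hξ.isStdGaussianFamily
  refine ⟨renormSquare hξ.coord, measurable_pair_renormSquare hg.measurable,
    fun α hα => hξ.ae_renormSquare_mem_besovHolder (by linarith), fun ρ => ⟨?_, ?_, ?_⟩⟩
  · exact fun ω ε _ i => isSmooth_potential ρ ε (ξ ω) i
  · exact fun α hα p hp => hξ.tendsto_lintegral_besovHolderNorm ρ (by linarith) (by linarith)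
  · exact hξ.tendsto_renormConst_div_log ρ
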